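/- **Conventions.** Let $k$ be a field. All graded vector spaces are $\mathbb Z$-graded, differentials have degree $-1$, and the Koszul sign rule is used. $\mathrm{DGA}_0$ is the category of (associative) non-unital dg algebras over $k$, and $\mathrm{cDGA}$ is the category of conilpotent non-counital coassociative dg coalgebras over $k$ (every element is killed by some iterated comultiplication). $\mathrm{cDGA}$ is semi-monoidal (monoidal without a unit) under $\otimes=\otimes_k$. Write $\Delta c=\sum c'\otimes c''$, and let $T_0V=\bigoplus_{n\ge1}V^{\otimes n}$. For $C,D\in\mathrm{cDGA}$ and $A,B\in\mathrm{DGA}_0$: - $\{C,A\}$ is the convolution algebra: the internal hom complex $[C,A]$ with product $(f*g)(c)=\sum(-1)^{|g||c'|}f(c')g(c'')$. - A *measuring* is a degree $0$ chain map $u:C\otimes A\to B$ with $u(c\otimes aa')=\sum(-1)^{|a||c''|}u(c'\otimes a)\,u(c''\otimes a')$. - $C\rhd A$ is the quotient of the free non-unital dg algebra $T_0(C\otimes A)$ by the dg ideal generated by the relations which make the inclusion of $C\otimes A$ a measuring. Let $u:C\otimes A\to C\rhd A$ be the resulting universal measuring. - $\underline{\mathrm{DGA}}(A,B)$ is the largest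 dg subcoalgebra of the cofree conilpotent dg coalgebra on $[A,B]$ on which the evaluation $w\otimes a\mapsto p(w)(a)$ is a measuring, $p$ being the projection to $[A,B]$. - $\Omega C$ is the cobar construction: $T_0(\Sigma C)$ with $(\Sigma C)_n=C_{n+1}$, generators $sc$, and $d(sc)=-s(dc)-\sum(-1)^{|c'|}(sc')(sc'')$. - $BA$ is the bar construction: the conilpotent tensor coalgebra on $\Sigma^{-1}A$, $(\Sigma^{-1}A)_n=A_{n-1}$, with the coderivation determined by $[a]\mapsto-[da]$ and $[a|a']\mapsto(-1)^{|a|}[aa']$. Let $\pi:BA\to A$ be the projection, $[a]\mapsto a$. - $\mathbf{mc}$ is the universal Maurer–Cartan algebra: the free non-unital algebra on one generator $x$ of degree $-1$, with $dx=-x^2$. A module structure over a semi-monoidal category $\mathcal V$ on a category $\mathcal C$ is a functor $\rhd:\mathcal V\times\mathcal C\to\mathcal C$ with a natural isomorphism $\alpha:(X\otimes Y)\rhd A\cong X\rhd(Y\rhd A)$ satisfying the pentagon axiom. A (strong) $\mathcal V$-module functor is a functor $F$ with a natural isomorphism $m:X\rhd FA\cong F(X\rhd A)$ compatible with the associativity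 isomorphisms. A $\mathcal V$-module adjunction is an adjunction $F\dashv U$ whose left adjoint $F$ is equipped with such an $m$. **Proposition.** 1. There are adjunctions, natural in all variables, $$\mathrm{DGA}_0(C\rhd A,B)\cong\mathrm{DGA}_0(A,\{C,B\}),\qquad \mathrm{DGA}_0(C\rhd A,B)\cong\mathrm{cDGA}(C,\underline{\mathrm{DGA}}(A,B)).$$ 2. There are natural isomorphisms $e_C:\Omega C\cong C\rhd\mathbf{mc}$ (natural in $C\in\mathrm{cDGA}$) and $BA\cong\underline{\mathrm{DGA}}(\mathbf{mc},A)$ (natural in $A\in\mathrm{DGA}_0$). 3. The tensoring $\rhd$ is part of a $\mathrm{cDGA}$-module structure on $\mathrm{DGA}_0$ whose associativity isomorphism $\alpha$ satisfies $\alpha\big(u((c\otimes d)\otimes a)\big)=u\big(c\otimes u(d\otimes a)\big)$. The bar–cobar adjunction $\Omega\dashv B$, under which $f:\Omega C\to A$ corresponds to $g:C\to BA$ with $\pi(g(c))=f(sc)$, is a $\mathrm{cDGA}$-module adjunction from $\mathrm{cDGA}$ (acting on itself by $\otimes$) to $\mathrm{DGA}_0$. Its structure isomorphism $m_{X,C}:X\rhd\Omega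 C\cong\Omega(X\otimes C)$ corresponds under $e$ to $\alpha^{-1}$; that is, for all $X,C$ the composite $$X\rhd\Omega C\xrightarrow{\;m_{X,C}\;}\Omega(X\otimes C)\xrightarrow{\;e_{X\otimes C}\;}(X\otimes C)\rhd\mathbf{mc}\xrightarrow{\;\alpha\;}X\rhd(C\rhd\mathbf{mc})$$ equals $X\rhd e_C$. -/

import Mathlib

open scoped TensorProduct
open CategoryTheory

universe u

namespace Koszul

/-! ### Graded vector spaces -/

section Graded

variable {k : Type u} [Field k]

/-- A `ℤ`-grading on a vector space: subspaces `V_n` of which `V` is the internal direct sum. -/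
class GrMod (k : Type u) [Field k] (V : Type u) [AddCommGroup V] [Module k V] where
  grade : ℤ → Submodule k V
  internal : DirectSum.IsInternal grade

/-- The subspace of elements of degree `n`. -/
abbrev gr (k : Type u) [Field k] (V : Type u) [AddCommGroup V] [Module k V] [GrMod k V] (n : ℤ) :
    Submodule k V := GrMod.grade n

theorem internal_of {V M : Type u} [AddCommGroup V] [Module k V] [AddCommGroup M] [Module k M]
    (G : ℤ → Submodule k V) (j : V →ₗ[k] M) (hj : Function.Injective j) (p : ℤ → V →ₗ[k] M)
    (h1 : ∀ n, ∀ v ∈ G n, p n v = j v) (h2 : ∀ m n, m ≠ n → ∀ v ∈ G n, p m v = 0)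
    (h3 : ⨆ n, G n = ⊤) : DirectSum.IsInternal G := by
  refine (DirectSum.isInternal_submodule_iff_iSupIndep_and_iSup_eq_top G).2 ⟨?_, h3⟩
  rw [iSupIndep_def]
  intro i
  rw [Submodule.disjoint_def]
  intro x hx hx'
  have : ⨆ (m) (_ : m ≠ i), G m ≤ LinearMap.ker (p i) :=
    iSup₂_le fun m hm v hv => h2 i m hm.symm v hv
  have h0 : p i x = 0 := this hx'
  rw [h1 i x hx] at h0
  exact hj (by simpa using h0)

section Basic
variable {V W M N : Type u} [AddCommGroup V] [Module k V] [AddCommGroup W] [Module k W]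
  [AddCommGroup M] [Module k M] [AddCommGroup N] [Module k N]

theorem iSup_gr [GrMod k V] : ⨆ n, gr k V n = ⊤ :=
  (GrMod.internal (k := k) (V := V)).submodule_iSup_eq_top

theorem ext_gr [GrMod k V] {f g : V →ₗ[k] M} (h : ∀ n, ∀ v ∈ gr k V n, f v = g v) : f = g := by
  have : (⊤ : Submodule k V) ≤ LinearMap.eqLocus f g := by
    rw [← iSup_gr]; exact iSup_le fun n v hv => h n v hv
  ext v; exact this (Submodule.mem_top (x := v))

/-- The decomposition `v ↦ (v_n)_n` of an element into its homogeneous components. -/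
noncomputable def dec [GrMod k V] : V →ₗ[k] (ℤ →₀ V) :=
  (DirectSum.toModule k ℤ (ℤ →₀ V) fun n => Finsupp.lsingle n ∘ₗ (gr k V n).subtype) ∘ₗ
    (LinearEquiv.ofBijective (DirectSum.coeLinearMap (gr k V)) GrMod.internal).symm.toLinearMap

theorem dec_of_mem [GrMod k V] {n : ℤ} {v : V} (hv : v ∈ gr k V n) :
    dec (k := k) v = Finsupp.single n v := by
  have : (LinearEquiv.ofBijective (DirectSum.coeLinearMap (gr k V)) GrMod.internal).symm v
      = DirectSum.lof k ℤ (fun n => gr k V n) n ⟨v, hv⟩ := by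
    rw [LinearEquiv.symm_apply_eq]
    exact (DirectSum.coeLinearMap_lof (gr k V) n ⟨v, hv⟩).symm
  simp only [dec, LinearMap.comp_apply, LinearEquiv.coe_coe, this, DirectSum.toModule_lof]
  simp

/-- The homogeneous component of degree `n`. -/
noncomputable def cmp [GrMod k V] (n : ℤ) : V →ₗ[k] V := Finsupp.lapply n ∘ₗ dec

theorem cmp_of_mem [GrMod k V] {n : ℤ} {v : V} (hv : v ∈ gr k V n) : cmp (k := k) n v = v := by
  simp [cmp, dec_of_mem hv]

theorem cmp_of_ne [GrMod k V] {m n : ℤ} (h : m ≠ n) {v : V} (hv : v ∈ gr k V n) :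
    cmp (k := k) m v = 0 := by
  simp [cmp, dec_of_mem hv, h.symm]

theorem cmp_mem [GrMod k V] (n : ℤ) (v : V) : cmp (k := k) n v ∈ gr k V n := by
  have : (⊤ : Submodule k V) ≤ (gr k V n).comap (cmp n) := by
    rw [← iSup_gr]
    refine iSup_le fun m w hw => ?_
    by_cases h : n = m
    · subst h; simpa [cmp_of_mem hw] using hw
    · simp [cmp_of_ne h hw]
  exact this Submodule.mem_top

theorem sum_cmp [GrMod k V] (v : V) : (dec (k := k) v).sum (fun _ x => x) = v := by
  have : (Finsupp.lsum k fun _ : ℤ => (LinearMap.id : V →ₗ[k] V)) ∘ₗ dec = LinearMap.id :=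
    ext_gr fun n v hv => by simp [dec_of_mem hv]
  exact LinearMap.congr_fun this v

theorem mem_of_cmp [GrMod k V] (S : Submodule k V) (v : V) (h : ∀ n, cmp (k := k) n v ∈ S) :
    v ∈ S := by
  rw [← sum_cmp (k := k) v]
  exact Submodule.sum_mem _ fun n _ => h n

/-- The operator acting on `V_n` as multiplication by the scalar `c n`. -/
noncomputable def degOp [GrMod k V] (c : ℤ → k) : V →ₗ[k] V :=
  (Finsupp.lsum k fun n : ℤ => c n • (LinearMap.id : V →ₗ[k] V)) ∘ₗ dec

theorem degOp_of_mem [GrMod k V] (c : ℤ → k) {n : ℤ} {v : V} (hv : v ∈ gr k V n) :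
    degOp c v = c n • v := by
  simp [degOp, dec_of_mem hv]

theorem degOp_mem [GrMod k V] (c : ℤ → k) {n : ℤ} {v : V} (hv : v ∈ gr k V n) :
    degOp c v ∈ gr k V n := by
  rw [degOp_of_mem c hv]; exact Submodule.smul_mem _ _ hv

theorem degOp_mem_of_graded [GrMod k V] (c : ℤ → k) (S : Submodule k V)
    (hS : ∀ v ∈ S, ∀ n, cmp (k := k) n v ∈ S) {v : V} (hv : v ∈ S) : degOp c v ∈ S := by
  have : degOp c v = (dec (k := k) v).sum (fun n x => c n • x) := by
    rw [degOp, LinearMap.comp_apply, Finsupp.lsum_apply]; rfl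
  rw [this]
  exact Submodule.sum_mem _ fun n _ => Submodule.smul_mem _ _ (hS v hv n)

variable (k) in
/-- The sign `(-1)^n` as a scalar. -/
def sgn (n : ℤ) : k := ((n.negOnePow : ℤˣ) : ℤ)

theorem sgn_add (m n : ℤ) : sgn k (m + n) = sgn k m * sgn k n := by
  simp [sgn, Int.negOnePow_add]

theorem sgn_even {n : ℤ} (h : Even n) : sgn k n = 1 := by simp [sgn, Int.negOnePow_even n h]

theorem sgn_odd {n : ℤ} (h : ¬ Even n) : sgn k n = -1 := by
  simp [sgn, Int.negOnePow_odd n (Int.not_even_iff_odd.1 h)]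

theorem sgn_neg (n : ℤ) : sgn k (-n) = sgn k n := by simp [sgn, Int.negOnePow_neg]

theorem sgn_mul_self (n : ℤ) : sgn k n * sgn k n = 1 := by
  rw [← sgn_add]; exact sgn_even ⟨n, rfl⟩

/-- The sign operator `v ↦ (-1)^{q|v|} v`. -/
noncomputable def kap [GrMod k V] (q : ℤ) : V →ₗ[k] V := degOp fun n => sgn k (q * n)

/-- The sign operator `v ↦ (-1)^{|v|} v`. -/
noncomputable def sig [GrMod k V] : V →ₗ[k] V := degOp (sgn k)

/-- The projection onto the part of even degree. -/
noncomputable def ev [GrMod k V] : V →ₗ[k] V := degOp fun n => if Even n then 1 else 0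

/-- The projection onto the part of odd degree. -/
noncomputable def od [GrMod k V] : V →ₗ[k] V := degOp fun n => if Even n then 0 else 1

theorem sig_of_mem [GrMod k V] {n : ℤ} {v : V} (hv : v ∈ gr k V n) :
    sig (k := k) v = sgn k n • v := degOp_of_mem _ hv

theorem kap_of_mem [GrMod k V] (q : ℤ) {n : ℤ} {v : V} (hv : v ∈ gr k V n) :
    kap (k := k) q v = sgn k (q * n) • v := degOp_of_mem _ hv

theorem sig_mem [GrMod k V] {n : ℤ} {v : V} (hv : v ∈ gr k V n) :
    sig (k := k) v ∈ gr k V n := degOp_mem _ hv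

theorem ev_of_mem [GrMod k V] {n : ℤ} {v : V} (hv : v ∈ gr k V n) :
    ev (k := k) v = (if Even n then (1 : k) else 0) • v := degOp_of_mem _ hv

theorem od_of_mem [GrMod k V] {n : ℤ} {v : V} (hv : v ∈ gr k V n) :
    od (k := k) v = (if Even n then (0 : k) else 1) • v := degOp_of_mem _ hv

theorem sig_sig [GrMod k V] (v : V) : sig (k := k) (sig (k := k) v) = v := by
  have : (sig ∘ₗ sig : V →ₗ[k] V) = LinearMap.id := ext_gr fun n v hv => by
    simp [sig_of_mem hv, smul_smul, sgn_mul_self]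
  exact LinearMap.congr_fun this v

variable (k V W) in
/-- Linear maps that are homogeneous of degree `p`. -/
def homDeg [GrMod k V] [GrMod k W] (p : ℤ) : Submodule k (V →ₗ[k] W) where
  carrier := {f | ∀ n, ∀ v ∈ gr k V n, f v ∈ gr k W (n + p)}
  add_mem' hf hg n v hv := Submodule.add_mem _ (hf n v hv) (hg n v hv)
  zero_mem' _ _ _ := Submodule.zero_mem _
  smul_mem' c _ hf n v hv := Submodule.smul_mem _ c (hf n v hv)

theorem degOp_comm [GrMod k V] [GrMod k W] {f : V →ₗ[k] W} (hf : f ∈ homDeg k V W 0)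
    (c : ℤ → k) (v : V) : f (degOp c v) = degOp c (f v) := by
  have : f ∘ₗ degOp c = degOp c ∘ₗ f := ext_gr fun n v hv => by
    have h := hf n v hv
    rw [add_zero] at h
    simp [degOp_of_mem c hv, degOp_of_mem c h]
  exact LinearMap.congr_fun this v

theorem sig_hom [GrMod k V] [GrMod k W] {p : ℤ} {f : V →ₗ[k] W} (hf : f ∈ homDeg k V W p)
    (v : V) : sig (k := k) (f v) = sgn k p • f (sig (k := k) v) := by
  have : sig ∘ₗ f = sgn k p • (f ∘ₗ sig) := ext_gr fun n v hv => by
    have h := hf n v hv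
    simp [sig_of_mem hv, sig_of_mem h, smul_smul, sgn_add, mul_comm]
  exact LinearMap.congr_fun this v

end Basic

/-! ### Tensor products and internal homs of graded vector spaces -/

section Tensor
variable {V W V' W' : Type u} [AddCommGroup V] [Module k V] [AddCommGroup W] [Module k W]
  [AddCommGroup V'] [Module k V'] [AddCommGroup W'] [Module k W']
  [GrMod k V] [GrMod k W] [GrMod k V'] [GrMod k W']

variable (k V W) in
/-- `(V ⊗ W)_n` is spanned by the `v ⊗ w` with `|v| + |w| = n`. -/
def tensorGr (n : ℤ) : Submodule k (V ⊗[k] W) :=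
  Submodule.span k {t | ∃ i j v w, v ∈ gr k V i ∧ w ∈ gr k W j ∧ i + j = n ∧ t = v ⊗ₜ[k] w}

variable (k V W) in
noncomputable def tensorDec : V ⊗[k] W →ₗ[k] (ℤ →₀ V ⊗[k] W) :=
  Finsupp.lmapDomain _ k (fun p : ℤ × ℤ => p.1 + p.2) ∘ₗ
    (finsuppTensorFinsupp k k V W ℤ ℤ).toLinearMap ∘ₗ TensorProduct.map dec dec

theorem tensorDec_of_mem {n : ℤ} {t : V ⊗[k] W} (ht : t ∈ tensorGr k V W n) :
    tensorDec k V W t = Finsupp.single n t := by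
  have : tensorGr k V W n ≤ LinearMap.eqLocus (tensorDec k V W) (Finsupp.lsingle n) := by
    refine Submodule.span_le.2 ?_
    rintro _ ⟨i, j, v, w, hv, hw, rfl, rfl⟩
    simp [tensorDec, dec_of_mem hv, dec_of_mem hw, Finsupp.mapDomain_single]
  exact this ht

theorem tmul_mem {i j n : ℤ} {v : V} {w : W} (hv : v ∈ gr k V i) (hw : w ∈ gr k W j)
    (h : i + j = n) : v ⊗ₜ[k] w ∈ tensorGr k V W n :=
  Submodule.subset_span ⟨i, j, v, w, hv, hw, h, rfl⟩

theorem iSup_tensorGr : ⨆ n, tensorGr k V W n = ⊤ := by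
  rw [eq_top_iff]
  intro t _
  induction t with
  | zero => exact Submodule.zero_mem _
  | add x y hx hy => exact Submodule.add_mem _ (hx trivial) (hy trivial)
  | tmul v w =>
    rw [← sum_cmp (k := k) v, ← sum_cmp (k := k) w, Finsupp.sum, Finsupp.sum,
      TensorProduct.sum_tmul]
    refine Submodule.sum_mem _ fun i _ => ?_
    rw [TensorProduct.tmul_sum]
    refine Submodule.sum_mem _ fun j _ => ?_
    exact (le_iSup (tensorGr k V W) (i + j)) (tmul_mem (cmp_mem i v) (cmp_mem j w) rfl)

noncomputable instance tensorGrMod : GrMod k (V ⊗[k] W) where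
  grade := tensorGr k V W
  internal := internal_of _ LinearMap.id Function.injective_id
    (fun n => Finsupp.lapply n ∘ₗ tensorDec k V W)
    (fun n v hv => by simp [tensorDec_of_mem hv])
    (fun m n h v hv => by simp [tensorDec_of_mem hv, h.symm])
    iSup_tensorGr

theorem tmul_mem_gr {i j n : ℤ} {v : V} {w : W} (hv : v ∈ gr k V i) (hw : w ∈ gr k W j)
    (h : i + j = n) : v ⊗ₜ[k] w ∈ gr k (V ⊗[k] W) n := tmul_mem hv hw h

theorem tensor_gr_le {M : Type u} [AddCommGroup M] [Module k M] (f : V ⊗[k] W →ₗ[k] M)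
    (S : Submodule k M) (n : ℤ)
    (h : ∀ i j, i + j = n → ∀ v ∈ gr k V i, ∀ w ∈ gr k W j, f (v ⊗ₜ w) ∈ S) :
    ∀ t ∈ gr k (V ⊗[k] W) n, f t ∈ S := by
  intro t ht
  have : tensorGr k V W n ≤ S.comap f := by
    refine Submodule.span_le.2 ?_
    rintro _ ⟨i, j, v, w, hv, hw, hn, rfl⟩
    exact h i j hn v hv w hw
  exact this ht

theorem tensor_homDeg {M : Type u} [AddCommGroup M] [Module k M] [GrMod k M]
    {f : V ⊗[k] W →ₗ[k] M} {p : ℤ}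
    (h : ∀ i j, ∀ v ∈ gr k V i, ∀ w ∈ gr k W j, f (v ⊗ₜ w) ∈ gr k M (i + j + p)) :
    f ∈ homDeg k (V ⊗[k] W) M p :=
  fun n => tensor_gr_le f _ n fun i j hn v hv w hw => hn ▸ h i j v hv w hw

theorem map_homDeg {f : V →ₗ[k] V'} {g : W →ₗ[k] W'} {p q r : ℤ} (hf : f ∈ homDeg k V V' p)
    (hg : g ∈ homDeg k W W' q) (h : p + q = r) :
    TensorProduct.map f g ∈ homDeg k (V ⊗[k] W) (V' ⊗[k] W') r :=
  tensor_homDeg fun i j v hv w hw => by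
    rw [TensorProduct.map_tmul]
    exact tmul_mem_gr (hf i v hv) (hg j w hw) (by omega)

theorem ext_gr₂ {M : Type u} [AddCommGroup M] [Module k M] {f g : V ⊗[k] W →ₗ[k] M}
    (h : ∀ i j, ∀ v ∈ gr k V i, ∀ w ∈ gr k W j, f (v ⊗ₜ w) = g (v ⊗ₜ w)) : f = g := by
  apply TensorProduct.ext
  apply ext_gr
  intro i v hv
  apply ext_gr
  intro j w hw
  exact h i j v hv w hw

theorem sig_tmul (v : V) (w : W) :
    sig (k := k) (v ⊗ₜ[k] w) = sig (k := k) v ⊗ₜ sig (k := k) w := by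
  have : (sig : V ⊗[k] W →ₗ[k] _) = TensorProduct.map sig sig := ext_gr₂ fun i j v hv w hw => by
    simp [sig_of_mem hv, sig_of_mem hw, sig_of_mem (tmul_mem_gr hv hw rfl), sgn_add,
      TensorProduct.smul_tmul', TensorProduct.tmul_smul, smul_smul, mul_comm]
  simpa using LinearMap.congr_fun this (v ⊗ₜ w)

theorem kap_tmul (q : ℤ) (v : V) (w : W) :
    kap (k := k) q (v ⊗ₜ[k] w) = kap (k := k) q v ⊗ₜ kap (k := k) q w := by
  have : (kap q : V ⊗[k] W →ₗ[k] _) = TensorProduct.map (kap q) (kap q) :=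
    ext_gr₂ fun i j v hv w hw => by
    simp [kap_of_mem _ hv, kap_of_mem _ hw, kap_of_mem _ (tmul_mem_gr hv hw rfl), mul_add, sgn_add,
      TensorProduct.smul_tmul', TensorProduct.tmul_smul, smul_smul, mul_comm]
  simpa using LinearMap.congr_fun this (v ⊗ₜ w)

end Tensor

section InternalHom
variable {V W V' W' : Type u} [AddCommGroup V] [Module k V] [AddCommGroup W] [Module k W]
  [AddCommGroup V'] [Module k V'] [AddCommGroup W'] [Module k W']
  [GrMod k V] [GrMod k W] [GrMod k V'] [GrMod k W']

variable (k V W) in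
/-- The linear maps that are finite sums of homogeneous ones: the underlying space of the
internal hom of graded vector spaces. -/
def iHomSub : Submodule k (V →ₗ[k] W) := ⨆ p, homDeg k V W p

variable (k V W) in
/-- The internal hom of graded vector spaces. -/
abbrev IHom : Type u := iHomSub k V W

variable (k V W) in
noncomputable def homCmp (p : ℤ) : (V →ₗ[k] W) →ₗ[k] (V →ₗ[k] W) where
  toFun f := (Finsupp.lsum k fun n : ℤ => cmp (n + p) ∘ₗ f) ∘ₗ dec
  map_add' f g := ext_gr fun n v hv => by simp [dec_of_mem hv]
  map_smul' c f := ext_gr fun n v hv => by simp [dec_of_mem hv]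

theorem homCmp_of_mem {p : ℤ} {f : V →ₗ[k] W} (hf : f ∈ homDeg k V W p) :
    homCmp k V W p f = f :=
  ext_gr fun n v hv => by simp [homCmp, dec_of_mem hv, cmp_of_mem (hf n v hv)]

theorem homCmp_of_ne {p q : ℤ} (h : q ≠ p) {f : V →ₗ[k] W} (hf : f ∈ homDeg k V W p) :
    homCmp k V W q f = 0 :=
  ext_gr fun n v hv => by
    simp [homCmp, dec_of_mem hv, cmp_of_ne (by omega : n + q ≠ n + p) (hf n v hv)]

noncomputable instance iHomGrMod : GrMod k (IHom k V W) where
  grade p := (homDeg k V W p).comap (iHomSub k V W).subtype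
  internal := internal_of _ (iHomSub k V W).subtype (Submodule.subtype_injective _)
    (fun p => homCmp k V W p ∘ₗ (iHomSub k V W).subtype)
    (fun p f hf => homCmp_of_mem hf) (fun p q h f hf => homCmp_of_ne h hf)
    (by
      apply Submodule.map_injective_of_injective (Submodule.subtype_injective (iHomSub k V W))
      rw [Submodule.map_iSup, Submodule.map_top, Submodule.range_subtype]
      refine (iSup_congr fun p => ?_ : _ = ⨆ p, homDeg k V W p)
      rw [Submodule.map_comap_subtype, inf_eq_right]
      exact le_iSup (homDeg k V W) p)

theorem mem_gr_iHom {p : ℤ} {f : IHom k V W} :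
    f ∈ gr k (IHom k V W) p ↔ (f : V →ₗ[k] W) ∈ homDeg k V W p := Iff.rfl

theorem homDeg_le (p : ℤ) : homDeg k V W p ≤ iHomSub k V W := le_iSup (homDeg k V W) p

theorem sig_iHom (f : IHom k V W) :
    ((sig (k := k) f : IHom k V W) : V →ₗ[k] W) = sig ∘ₗ (f : V →ₗ[k] W) ∘ₗ sig := by
  have : (iHomSub k V W).subtype ∘ₗ sig =
      LinearMap.llcomp k V W W sig ∘ₗ LinearMap.lcomp k W sig ∘ₗ (iHomSub k V W).subtype :=
    ext_gr fun p f hf => by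
      ext v
      have h := sig_hom (mem_gr_iHom.1 hf) (sig (k := k) v)
      rw [sig_sig] at h
      simp only [sig_of_mem hf, LinearMap.comp_apply, Submodule.subtype_apply,
        LinearMap.llcomp_apply, LinearMap.lcomp_apply, h]
      simp
  exact LinearMap.congr_fun this f

/-- A linear endomorphism of the space of linear maps that shifts degrees restricts to the
internal homs. -/
theorem iHomSub_le_of {V₁ W₁ : Type u} [AddCommGroup V₁] [Module k V₁] [AddCommGroup W₁]
    [Module k W₁] [GrMod k V₁] [GrMod k W₁] (F : (V →ₗ[k] W) →ₗ[k] (V₁ →ₗ[k] W₁)) (q : ℤ)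
    (h : ∀ p, ∀ f ∈ homDeg k V W p, F f ∈ homDeg k V₁ W₁ (p + q)) :
    ∀ f ∈ iHomSub k V W, F f ∈ iHomSub k V₁ W₁ := by
  intro f hf
  have : iHomSub k V W ≤ (iHomSub k V₁ W₁).comap F :=
    iSup_le fun p f hf => homDeg_le _ (h p f hf)
  exact this hf

end InternalHom

end Graded

/-! ### Differential graded vector spaces, algebras and coalgebras -/

section DG

/-- A dg vector space, homologically graded: the differential lowers the degree by one. -/
class DGMod (k : Type u) [Field k] (V : Type u) [AddCommGroup V] [Module k V]
    extends GrMod k V where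
  d : V →ₗ[k] V
  d_deg : ∀ n, ∀ v ∈ grade n, d v ∈ grade (n - 1)
  d_d : ∀ v, d (d v) = 0

/-- A non-unital dg algebra. -/
class DGA (k : Type u) [Field k] (A : Type u) [AddCommGroup A] [Module k A]
    extends DGMod k A where
  mul : A →ₗ[k] A →ₗ[k] A
  mul_assoc : ∀ a b c, mul (mul a b) c = mul a (mul b c)
  mul_deg : ∀ i j, ∀ a ∈ grade i, ∀ b ∈ grade j, mul a b ∈ grade (i + j)
  /-- `d (a b) = (d a) b + (-1)^{|a|} a (d b)` -/
  leibniz : ∀ a b, d (mul a b) = mul (d a) b + mul (sig (k := k) a) (d b)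

/-- A non-counital coassociative dg coalgebra. -/
class DGC (k : Type u) [Field k] (C : Type u) [AddCommGroup C] [Module k C]
    extends DGMod k C where
  comul : C →ₗ[k] C ⊗[k] C
  coassoc : ∀ c, TensorProduct.assoc k C C C (TensorProduct.map comul LinearMap.id (comul c)) =
    TensorProduct.map LinearMap.id comul (comul c)
  comul_deg : ∀ n, ∀ c ∈ grade n, comul c ∈ gr k (C ⊗[k] C) n
  /-- `Δ d = (d ⊗ 1 + 1 ⊗ d) Δ`, where `(1 ⊗ d) (x ⊗ y) = (-1)^{|x|} x ⊗ d y` -/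
  coleibniz : ∀ c, comul (d c) = TensorProduct.map d LinearMap.id (comul c) +
    TensorProduct.map (sig (k := k)) d (comul c)

/-- The differential. -/
abbrev dd (k : Type u) [Field k] (V : Type u) [AddCommGroup V] [Module k V] [DGMod k V] :
    V →ₗ[k] V := DGMod.d

/-- The multiplication. -/
abbrev mu (k : Type u) [Field k] (A : Type u) [AddCommGroup A] [Module k A] [DGA k A] :
    A →ₗ[k] A →ₗ[k] A := DGA.mul

/-- The comultiplication. -/
abbrev Del (k : Type u) [Field k] (C : Type u) [AddCommGroup C] [Module k C] [DGC k C] :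
    C →ₗ[k] C ⊗[k] C := DGC.comul

variable {k : Type u} [Field k]

variable (k) in
/-- The iterated tensor power `C^{⊗ (n+1)} = (⋯ (C ⊗ C) ⊗ ⋯) ⊗ C`. -/
noncomputable def TPow (C : Type u) [AddCommGroup C] [Module k C] : ℕ → ModuleCat.{u} k
  | 0 => ModuleCat.of k C
  | n + 1 => ModuleCat.of k (TPow C n ⊗[k] C)

variable (k) in
/-- The iterated comultiplication `Δ^n : C → C^{⊗ (n+1)}`. -/
noncomputable def iterDel (C : Type u) [AddCommGroup C] [Module k C] (Δ : C →ₗ[k] C ⊗[k] C) :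
    ∀ n : ℕ, C →ₗ[k] TPow k C n
  | 0 => LinearMap.id
  | n + 1 => TensorProduct.map (iterDel C Δ n) LinearMap.id ∘ₗ Δ

variable (k) in
/-- A coalgebra is conilpotent if every element is annihilated by some iterated
comultiplication. -/
def Conil (C : Type u) [AddCommGroup C] [Module k C] [DGC k C] : Prop :=
  ∀ c : C, ∃ n, iterDel k C (Del k C) n c = 0

section Basic
variable {V W : Type u} [AddCommGroup V] [Module k V] [AddCommGroup W] [Module k W]

theorem d_homDeg [DGMod k V] : dd k V ∈ homDeg k V V (-1) := fun n v hv => DGMod.d_deg n v hv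

theorem d_sig [DGMod k V] (v : V) : dd k V (sig (k := k) v) = - sig (k := k) (dd k V v) := by
  rw [sig_hom d_homDeg, sgn_odd (by decide)]; simp

end Basic

/-! ### The internal hom complex and the convolution algebra -/

section Conv
variable {V W : Type u} [AddCommGroup V] [Module k V] [AddCommGroup W] [Module k W]

variable (k V W) in
/-- `f ↦ d f - (-1)^{|f|} f d` -/
noncomputable def dHom [DGMod k V] [DGMod k W] : (V →ₗ[k] W) →ₗ[k] (V →ₗ[k] W) where
  toFun f := dd k W ∘ₗ f - (sig ∘ₗ f ∘ₗ sig) ∘ₗ dd k V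
  map_add' f g := by ext v; simp; abel
  map_smul' c f := by ext v; simp [smul_sub]

theorem dHom_of_mem [DGMod k V] [DGMod k W] {p : ℤ} {f : V →ₗ[k] W} (hf : f ∈ homDeg k V W p) :
    dHom k V W f = dd k W ∘ₗ f - sgn k p • (f ∘ₗ dd k V) := by
  ext v
  simp [dHom, sig_hom hf, sig_sig]

theorem homDeg_comp {U : Type u} [AddCommGroup U] [Module k U] [GrMod k U] [GrMod k V] [GrMod k W]
    {f : V →ₗ[k] W} {g : U →ₗ[k] V} {p q r : ℤ} (hf : f ∈ homDeg k V W p)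
    (hg : g ∈ homDeg k U V q) (h : q + p = r) : f ∘ₗ g ∈ homDeg k U W r := fun n u hu => by
  have := hf _ _ (hg n u hu)
  rwa [add_assoc, h] at this

theorem degOp_homDeg [GrMod k V] (c : ℤ → k) : (degOp c : V →ₗ[k] V) ∈ homDeg k V V 0 :=
  fun n v hv => by rw [add_zero]; exact degOp_mem c hv

theorem dHom_homDeg [DGMod k V] [DGMod k W] {p : ℤ} {f : V →ₗ[k] W} (hf : f ∈ homDeg k V W p) :
    dHom k V W f ∈ homDeg k V W (p + -1) := by
  rw [dHom_of_mem hf]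
  exact Submodule.sub_mem _ (homDeg_comp d_homDeg hf rfl)
    (Submodule.smul_mem _ _ (homDeg_comp hf d_homDeg (by omega)))

/-- The internal hom of dg vector spaces. -/
noncomputable instance iHomDGMod [DGMod k V] [DGMod k W] : DGMod k (IHom k V W) where
  toGrMod := iHomGrMod
  d := (dHom k V W ∘ₗ (iHomSub k V W).subtype).codRestrict (iHomSub k V W) fun f =>
    iHomSub_le_of (dHom k V W) (-1) (fun _ _ hf => dHom_homDeg hf) f f.2
  d_deg p f hf := dHom_homDeg hf
  d_d f := by
    have : dHom k V W ∘ₗ dHom k V W ∘ₗ (iHomSub k V W).subtype = 0 := ext_gr fun p f hf => by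
      have hf' := mem_gr_iHom.1 hf
      have h1 : sgn k (p + -1) = - sgn k p := by
        rw [sgn_add, sgn_odd (n := -1) (by decide)]; simp
      ext v
      simp only [LinearMap.comp_apply, Submodule.subtype_apply, dHom_of_mem (dHom_homDeg hf')]
      simp [dHom_of_mem hf', h1, DGMod.d_d]
    exact Subtype.ext (LinearMap.congr_fun this f)

theorem coe_d_iHom [DGMod k V] [DGMod k W] (f : IHom k V W) :
    ((dd k (IHom k V W) f : IHom k V W) : V →ₗ[k] W) = dHom k V W f := rfl

variable {C A : Type u} [AddCommGroup C] [Module k C] [AddCommGroup A] [Module k A]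

variable (k C A) in
/-- The convolution product `f * g = μ (f ⊗ g) Δ` with the Koszul sign rule
`(f ⊗ g) (x ⊗ y) = (-1)^{|g||x|} f x ⊗ g y`; note that `(-1)^{|g|} g = sig ∘ g ∘ sig`. -/
noncomputable def convMul [DGC k C] [DGA k A] :
    (C →ₗ[k] A) →ₗ[k] (C →ₗ[k] A) →ₗ[k] (C →ₗ[k] A) :=
  LinearMap.mk₂ k
    (fun f g => TensorProduct.lift (mu k A) ∘ₗ
      (TensorProduct.map (f ∘ₗ ev) g + TensorProduct.map (f ∘ₗ od) (sig ∘ₗ g ∘ₗ sig)) ∘ₗ Del k C)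
    (fun f f' g => by
      simp only [LinearMap.add_comp, TensorProduct.map_add_left, LinearMap.comp_add]; abel)
    (fun c f g => by
      simp only [LinearMap.smul_comp, TensorProduct.map_smul_left, LinearMap.comp_add,
        LinearMap.add_comp, LinearMap.comp_smul, smul_add])
    (fun f g g' => by
      simp only [LinearMap.add_comp, TensorProduct.map_add_right, LinearMap.comp_add]; abel)
    (fun c f g => by
      simp only [LinearMap.smul_comp, TensorProduct.map_smul_right, LinearMap.comp_add,
        LinearMap.add_comp, LinearMap.comp_smul, smul_add])

theorem ev_add_od [GrMod k V] (q : ℤ) :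
    (ev + sgn k q • od : V →ₗ[k] V) = kap q := ext_gr fun n v hv => by
  by_cases hn : Even n
  · simp [ev_of_mem hv, od_of_mem hv, kap_of_mem _ hv, hn, sgn_even (hn.mul_left q)]
  · have : sgn k (q * n) = sgn k q := by
      by_cases hj : Even q
      · rw [sgn_even hj, sgn_even (hj.mul_right n)]
      · rw [sgn_odd hj, sgn_odd]; rw [Int.even_mul]; tauto
    simp [ev_of_mem hv, od_of_mem hv, kap_of_mem _ hv, hn, this]

theorem convMul_of_mem [DGC k C] [DGA k A] (f : C →ₗ[k] A) {q : ℤ} {g : C →ₗ[k] A}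
    (hg : g ∈ homDeg k C A q) : convMul k C A f g =
      TensorProduct.lift (mu k A) ∘ₗ TensorProduct.map (f ∘ₗ kap q) g ∘ₗ Del k C := by
  have h : (sig ∘ₗ g ∘ₗ sig : C →ₗ[k] A) = sgn k q • g := by
    ext v; simp [sig_hom hg, sig_sig]
  simp only [convMul, LinearMap.mk₂_apply, h, TensorProduct.map_smul_right]
  rw [← ev_add_od, LinearMap.comp_add, TensorProduct.map_add_left, LinearMap.comp_smul,
    TensorProduct.map_smul_left]

theorem comul_homDeg [DGC k C] : Del k C ∈ homDeg k C (C ⊗[k] C) 0 := fun n v hv => by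
  rw [add_zero]; exact DGC.comul_deg n v hv

theorem mul_homDeg [DGA k A] : TensorProduct.lift (mu k A) ∈ homDeg k (A ⊗[k] A) A 0 :=
  tensor_homDeg fun i j v hv w hw => by
    rw [add_zero, TensorProduct.lift.tmul]; exact DGA.mul_deg i j v hv w hw

theorem convMul_homDeg [DGC k C] [DGA k A] {p q : ℤ} {f g : C →ₗ[k] A}
    (hf : f ∈ homDeg k C A p) (hg : g ∈ homDeg k C A q) :
    convMul k C A f g ∈ homDeg k C A (p + q) := by
  rw [convMul_of_mem f hg]
  have h1 : f ∘ₗ kap q ∈ homDeg k C A p := homDeg_comp hf (degOp_homDeg _) (zero_add p)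
  exact homDeg_comp mul_homDeg (homDeg_comp (map_homDeg h1 hg rfl) comul_homDeg
    (zero_add (p + q))) (add_zero (p + q))

theorem iHom_induction [GrMod k V] [GrMod k W] (P : (V →ₗ[k] W) → Prop)
    {f : V →ₗ[k] W} (hf : f ∈ iHomSub k V W) (h : ∀ p, ∀ f ∈ homDeg k V W p, P f)
    (hadd : ∀ f g, P f → P g → P (f + g)) : P f :=
  Submodule.iSup_induction (motive := P) _ hf h (h 0 0 (Submodule.zero_mem _)) hadd

theorem convMul_mem [DGC k C] [DGA k A] {f g : C →ₗ[k] A} (hf : f ∈ iHomSub k C A)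
    (hg : g ∈ iHomSub k C A) : convMul k C A f g ∈ iHomSub k C A := by
  refine iHom_induction (fun g => convMul k C A f g ∈ iHomSub k C A) hg (fun q g hg => ?_)
    (fun g g' h h' => by rw [map_add]; exact Submodule.add_mem _ h h')
  refine iHom_induction (fun f => convMul k C A f g ∈ iHomSub k C A) hf (fun p f hf => ?_)
    (fun f f' h h' => by
      rw [map_add, LinearMap.add_apply]; exact Submodule.add_mem _ h h')
  exact homDeg_le _ (convMul_homDeg hf hg)

theorem kap_kap [GrMod k V] (q r : ℤ) (v : V) :
    kap (k := k) q (kap (k := k) r v) = kap (k := k) (q + r) v := by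
  have : (kap q ∘ₗ kap r : V →ₗ[k] V) = kap (q + r) := ext_gr fun n v hv => by
    simp [kap_of_mem _ hv, smul_smul, add_mul, sgn_add, mul_comm (sgn k (r * n))]
  exact LinearMap.congr_fun this v

theorem kap_one [GrMod k V] : (kap 1 : V →ₗ[k] V) = sig := by
  simp [kap, sig]

theorem kap_neg_one [GrMod k V] : (kap (-1) : V →ₗ[k] V) = sig := by
  have : ∀ n, sgn k (-n) = sgn k n := fun n => by simp [sgn, Int.negOnePow_neg]
  simp [kap, sig, this]

theorem comul_kap [DGC k C] (q : ℤ) (c : C) :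
    Del k C (kap (k := k) q c) = TensorProduct.map (kap q) (kap q) (Del k C c) := by
  have : (kap q : C ⊗[k] C →ₗ[k] _) = TensorProduct.map (kap q) (kap q) :=
    TensorProduct.ext' fun x y => by simp [kap_tmul]
  rw [← this]
  exact degOp_comm comul_homDeg _ c

theorem convMul_assoc [DGC k C] [DGA k A] (f : C →ₗ[k] A) {g h : C →ₗ[k] A}
    (hg : g ∈ iHomSub k C A) (hh : h ∈ iHomSub k C A) :
    convMul k C A (convMul k C A f g) h = convMul k C A f (convMul k C A g h) := by
  refine iHom_induction (fun h => convMul k C A (convMul k C A f g) h =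
    convMul k C A f (convMul k C A g h)) hh (fun r h hh => ?_)
    (fun h h' e e' => by simp only [map_add, e, e'])
  refine iHom_induction (fun g => convMul k C A (convMul k C A f g) h =
    convMul k C A f (convMul k C A g h)) hg (fun q g hg => ?_) (fun g g' e e' => by
    simp only [map_add, LinearMap.add_apply, e, e'])
  rw [convMul_of_mem _ hh, convMul_of_mem f (convMul_homDeg hg hh), convMul_of_mem f hg,
    convMul_of_mem g hh]
  have key : ∀ t : C ⊗[k] C,
      TensorProduct.lift (mu k A) (TensorProduct.map ((TensorProduct.lift (mu k A) ∘ₗ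
        TensorProduct.map (f ∘ₗ kap q) g ∘ₗ Del k C) ∘ₗ kap r) h t) =
      TensorProduct.lift (mu k A) (TensorProduct.map (f ∘ₗ kap (q + r))
        (TensorProduct.lift (mu k A) ∘ₗ TensorProduct.map (g ∘ₗ kap r) h)
        (TensorProduct.assoc k C C C (TensorProduct.map (Del k C) LinearMap.id t))) := by
    intro t
    induction t with
    | zero => simp
    | add x y hx hy => simp only [map_add, hx, hy]
    | tmul x y =>
      simp only [TensorProduct.map_tmul, LinearMap.comp_apply, comul_kap, LinearMap.id_apply]
      induction Del k C x with
      | zero => simp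
      | add x y hx hy => simp only [map_add, hx, hy, TensorProduct.add_tmul]
      | tmul a b => simp [kap_kap, DGA.mul_assoc]
  ext c
  simp only [LinearMap.comp_apply, key, DGC.coassoc]
  induction Del k C c with
  | zero => simp
  | add x y hx hy => simp only [map_add, hx, hy]
  | tmul a b => simp

theorem d_kap [DGMod k V] (q : ℤ) (v : V) :
    kap (k := k) q (dd k V v) = sgn k q • dd k V (kap (k := k) q v) := by
  have : kap q ∘ₗ dd k V = sgn k q • (dd k V ∘ₗ kap q) := ext_gr fun n v hv => by
    have h := DGMod.d_deg (k := k) n v hv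
    have h2 : sgn k (q * (n - 1)) = sgn k q * sgn k (q * n) := by
      rw [← sgn_add, mul_sub, mul_one, sub_eq_add_neg, sgn_add, add_comm, sgn_add]
      congr 1
      simp [sgn, Int.negOnePow_neg]
    simp [kap_of_mem _ hv, kap_of_mem _ h, smul_smul, h2]
  exact LinearMap.congr_fun this v

theorem convMul_leibniz [DGC k C] [DGA k A] {f g : C →ₗ[k] A} (hf : f ∈ iHomSub k C A)
    (hg : g ∈ iHomSub k C A) :
    dHom k C A (convMul k C A f g) =
      convMul k C A (dHom k C A f) g + convMul k C A (sig ∘ₗ f ∘ₗ sig) (dHom k C A g) := by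
  refine iHom_induction (fun g => dHom k C A (convMul k C A f g) =
      convMul k C A (dHom k C A f) g + convMul k C A (sig ∘ₗ f ∘ₗ sig) (dHom k C A g)) hg
    (fun q g hg => ?_) (fun g g' e e' => by simp only [map_add, e, e']; abel)
  refine iHom_induction (fun f => dHom k C A (convMul k C A f g) =
      convMul k C A (dHom k C A f) g + convMul k C A (sig ∘ₗ f ∘ₗ sig) (dHom k C A g)) hf
    (fun p f hf => ?_) (fun f f' e e' => by
      simp only [map_add, LinearMap.add_apply, e, e', LinearMap.add_comp, LinearMap.comp_add]
      abel)
  have h : (sig ∘ₗ f ∘ₗ sig : C →ₗ[k] A) = sgn k p • f := by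
    ext v; simp [sig_hom hf, sig_sig]
  rw [h, dHom_of_mem (convMul_homDeg hf hg), convMul_of_mem _ hg,
    convMul_of_mem _ hg, convMul_of_mem _ (dHom_homDeg hg), dHom_of_mem hf, dHom_of_mem hg]
  ext c
  simp only [LinearMap.sub_apply, LinearMap.smul_apply, LinearMap.comp_apply, LinearMap.add_apply,
    DGC.coleibniz]
  induction Del k C c with
  | zero => simp
  | add x y hx hy =>
    simp only [map_add, smul_add]
    have := congrArg₂ (· + ·) hx hy
    simp only [map_add, smul_add] at this
    rw [← sub_eq_zero] at this ⊢
    rw [← this]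
    abel
  | tmul a b =>
    have e1 : kap (k := k) (q + -1) a = kap (k := k) q (sig (k := k) a) := by
      rw [← kap_kap, kap_neg_one]
    simp [DGA.leibniz, e1, d_kap, sgn_add, sig_hom hf, smul_smul]
    have e2 : sig (k := k) (kap (k := k) q a) = kap (k := k) q (sig (k := k) a) := by
      rw [← e1, ← kap_neg_one, kap_kap, add_comm]
    rw [e2, mul_assoc, sgn_mul_self, mul_one, smul_sub, smul_smul]
    abel

/-- The convolution algebra. -/
noncomputable instance convDGA [DGC k C] [DGA k A] : DGA k (IHom k C A) where
  toDGMod := iHomDGMod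
  mul := LinearMap.mk₂ k (fun f g => ⟨convMul k C A f g, convMul_mem f.2 g.2⟩)
    (fun _ _ _ => Subtype.ext (by simp)) (fun _ _ _ => Subtype.ext (by simp))
    (fun _ _ _ => Subtype.ext (by simp)) (fun _ _ _ => Subtype.ext (by simp))
  mul_assoc f g h := Subtype.ext (convMul_assoc _ g.2 h.2)
  mul_deg i j f hf g hg := convMul_homDeg hf hg
  leibniz f g := Subtype.ext (by
    have := convMul_leibniz f.2 g.2
    rw [← sig_iHom f] at this
    exact this)

end Conv
end DG

/-! ### Words: the tensor algebra as a graded space -/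

section Words

variable {k : Type u} [Field k] {V W U : Type u} [AddCommGroup V] [Module k V]
  [AddCommGroup W] [Module k W] [AddCommGroup U] [Module k U]

/-- The tensor algebra of `V`, spanned by the words in `V`. -/
abbrev TA (k : Type u) [Field k] (V : Type u) [AddCommGroup V] [Module k V] : Type u :=
  TensorAlgebra k V

section
variable {M : Type u} [AddCommGroup M] [Module k M]

noncomputable def paraStep (A : V →ₗ[k] TA k V →ₗ[k] M) (B : V →ₗ[k] M →ₗ[k] M) :
    V →ₗ[k] Module.End k (TA k V × M) where
  toFun v := LinearMap.prod (LinearMap.mulLeft k (TensorAlgebra.ι k v) ∘ₗ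
    LinearMap.fst k (TA k V) M) (LinearMap.coprod (A v) (B v))
  map_add' v w := by ext <;> simp [add_mul]
  map_smul' c v := by ext <;> simp

theorem paraStep_apply (A : V →ₗ[k] TA k V →ₗ[k] M) (B : V →ₗ[k] M →ₗ[k] M) (v : V)
    (p : TA k V × M) : paraStep A B v p = (TensorAlgebra.ι k v * p.1, A v p.1 + B v p.2) := rfl

/-- Recursion on words: `para A B m` sends the empty word to `m`, and `v w` (with first letter
`v` and tail `w`) to `A v w + B v (para A B m w)`. -/
noncomputable def para (A : V →ₗ[k] TA k V →ₗ[k] M) (B : V →ₗ[k] M →ₗ[k] M) (m : M) :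
    TA k V →ₗ[k] M :=
  LinearMap.snd k (TA k V) M ∘ₗ
    LinearMap.applyₗ (M₂ := TA k V × M) ((1 : TA k V), m) ∘ₗ
    (TensorAlgebra.lift k (paraStep A B)).toLinearMap

/-- Induction on words. -/
theorem left_induction (S : Submodule k (TA k V)) (h1 : 1 ∈ S)
    (h : ∀ v, ∀ w ∈ S, TensorAlgebra.ι k v * w ∈ S) (x : TA k V) : x ∈ S := by
  suffices H : ∀ w ∈ S, x * w ∈ S by simpa using H 1 h1
  induction x using TensorAlgebra.induction with
  | algebraMap r => intro w hw; rw [← Algebra.smul_def]; exact S.smul_mem r hw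
  | ι v => exact fun w hw => h v w hw
  | mul a b ha hb => intro w hw; rw [mul_assoc]; exact ha _ (hb w hw)
  | add a b ha hb => intro w hw; rw [add_mul]; exact S.add_mem (ha w hw) (hb w hw)

theorem ext_word {f g : TA k V →ₗ[k] M} (h1 : f 1 = g 1)
    (h : ∀ v w, f w = g w → f (TensorAlgebra.ι k v * w) = g (TensorAlgebra.ι k v * w)) : f = g := by
  ext x
  exact left_induction (LinearMap.eqLocus f g) h1 (fun v w hw => h v w hw) x

variable (A : V →ₗ[k] TA k V →ₗ[k] M) (B : V →ₗ[k] M →ₗ[k] M) (m : M)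

theorem para_one : para A B m 1 = m := by simp [para]

theorem para_ι_mul (v : V) (w : TA k V) :
    para A B m (TensorAlgebra.ι k v * w) = A v w + B v (para A B m w) := by
  have h : ∀ x : TA k V, (TensorAlgebra.lift k (paraStep A B) x (1, m)).1 = x := by
    intro x
    refine left_induction (LinearMap.eqLocus (LinearMap.fst k (TA k V) M ∘ₗ
      LinearMap.applyₗ (M₂ := TA k V × M) ((1 : TA k V), m) ∘ₗ
      (TensorAlgebra.lift k (paraStep A B)).toLinearMap) LinearMap.id) ?_ ?_ x
    · simp
    · intro v w hw
      simp only [LinearMap.mem_eqLocus, LinearMap.comp_apply, LinearMap.applyₗ_apply_apply,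
        AlgHom.toLinearMap_apply, LinearMap.id_apply] at hw ⊢
      simp only [LinearMap.fst_apply] at hw
      simp [paraStep_apply, hw]
  simp only [para, LinearMap.comp_apply, LinearMap.applyₗ_apply_apply,
    AlgHom.toLinearMap_apply, map_mul, TensorAlgebra.lift_ι_apply, Module.End.mul_apply]
  simp [h, paraStep_apply]

end

section Grading
variable [GrMod k V] [GrMod k W] [GrMod k U]

variable (k) in
/-- `IsMono n w`: the word `w` is a product of homogeneous letters whose degrees add up to `n`. -/
inductive IsMono : ℤ → TA k V → Prop
  | one : IsMono 0 1
  | cons {i n : ℤ} {v : V} {w : TA k V} (hv : v ∈ gr k V i) (hw : IsMono n w) :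
      IsMono (i + n) (TensorAlgebra.ι k v * w)

variable (k V) in
noncomputable def wordDec : TA k V →ₗ[k] (ℤ →₀ TA k V) :=
  para 0 (TensorProduct.curry
    (Finsupp.mapRange.linearMap (TensorProduct.lift
        ((LinearMap.mul k (TA k V)) ∘ₗ TensorAlgebra.ι k)) ∘ₗ
      Finsupp.lmapDomain _ k (fun p : ℤ × ℤ => p.1 + p.2) ∘ₗ
      (finsuppTensorFinsupp k k V (TA k V) ℤ ℤ).toLinearMap ∘ₗ TensorProduct.map dec LinearMap.id))
    (Finsupp.single 0 1)

theorem wordDec_of_mono {n : ℤ} {w : TA k V} (h : IsMono k n w) :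
    wordDec k V w = Finsupp.single n w := by
  induction h with
  | one => simp [wordDec, para_one]
  | cons hv hw ih =>
    rw [wordDec] at ih ⊢
    rw [para_ι_mul, ih]
    simp [dec_of_mem hv, Finsupp.mapDomain_single]

theorem wordDec_of_mem {n : ℤ} {w : TA k V} (h : w ∈ Submodule.span k {w | IsMono k n w}) :
    wordDec k V w = Finsupp.single n w := by
  have : Submodule.span k {w | IsMono k n w} ≤
      LinearMap.eqLocus (wordDec k V) (Finsupp.lsingle n) :=
    Submodule.span_le.2 fun w hw => wordDec_of_mono hw
  exact this h

theorem ι_mul_mem_span {i n : ℤ} {v : V} {w : TA k V} (hv : v ∈ gr k V i)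
    (hw : w ∈ Submodule.span k {w | IsMono k n w}) :
    TensorAlgebra.ι k v * w ∈ Submodule.span k {w : TA k V | IsMono k (i + n) w} := by
  have : Submodule.span k {w | IsMono k n w} ≤
      (Submodule.span k {w | IsMono k (i + n) w}).comap
        (LinearMap.mulLeft k (TensorAlgebra.ι k v)) :=
    Submodule.span_le.2 fun w hw => Submodule.subset_span (IsMono.cons hv hw)
  exact this hw

/-- The weight grading of the tensor algebra: degrees of the letters of a word are added. -/
noncomputable instance wordGrMod : GrMod k (TA k V) where
  grade n := Submodule.span k {w | IsMono k n w}
  internal := internal_of _ LinearMap.id Function.injective_id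
    (fun n => Finsupp.lapply n ∘ₗ wordDec k V)
    (fun n v hv => by simp [wordDec_of_mem hv])
    (fun m n h v hv => by simp [wordDec_of_mem hv, h.symm])
    (by
      rw [eq_top_iff]
      intro x _
      refine left_induction _ ?_ ?_ x
      · exact le_iSup (fun n => Submodule.span k {w : TA k V | IsMono k n w}) 0
          (Submodule.subset_span IsMono.one)
      · intro v w hw
        have : (⨆ n, Submodule.span k {w : TA k V | IsMono k n w}) ≤
            (⨆ n, Submodule.span k {w : TA k V | IsMono k n w}).comap
              (LinearMap.mulLeft k (TensorAlgebra.ι k v)) := by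
          refine iSup_le fun n w hw => ?_
          simp only [Submodule.mem_comap, LinearMap.mulLeft_apply]
          rw [← sum_cmp (k := k) v, Finsupp.sum, map_sum, Finset.sum_mul]
          exact Submodule.sum_mem _ fun i _ =>
            (le_iSup (fun n => Submodule.span k {w : TA k V | IsMono k n w}) (i + n))
              (ι_mul_mem_span (cmp_mem i v) hw)
        exact this hw)

theorem one_mem_gr : (1 : TA k V) ∈ gr k (TA k V) 0 := Submodule.subset_span IsMono.one

theorem ι_mul_mem {i n m : ℤ} {v : V} {w : TA k V} (hv : v ∈ gr k V i)
    (hw : w ∈ gr k (TA k V) n) (h : i + n = m) : TensorAlgebra.ι k v * w ∈ gr k (TA k V) m :=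
  h ▸ ι_mul_mem_span hv hw

theorem word_homDeg {M : Type u} [AddCommGroup M] [Module k M] [GrMod k M] {f : TA k V →ₗ[k] M}
    {p : ℤ} (h1 : f 1 ∈ gr k M p) (h : ∀ i n, ∀ v ∈ gr k V i, ∀ w ∈ gr k (TA k V) n,
      f w ∈ gr k M (n + p) → f (TensorAlgebra.ι k v * w) ∈ gr k M (i + n + p)) :
    f ∈ homDeg k (TA k V) M p := by
  have : ∀ n, ∀ w : TA k V, IsMono k n w → f w ∈ gr k M (n + p) := by
    intro n w hw
    induction hw with
    | one => simpa using h1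
    | cons hv hw ih => exact h _ _ _ hv _ (Submodule.subset_span hw) ih
  intro n w hw
  have h2 : Submodule.span k {w : TA k V | IsMono k n w} ≤ (gr k M (n + p)).comap f :=
    Submodule.span_le.2 fun w hw => this n w hw
  exact h2 hw

theorem mul_mem_word {i j m : ℤ} {x y : TA k V} (hx : x ∈ gr k (TA k V) i)
    (hy : y ∈ gr k (TA k V) j) (h : i + j = m) : x * y ∈ gr k (TA k V) m := by
  have : LinearMap.mulRight k y ∈ homDeg k (TA k V) (TA k V) j :=
    word_homDeg (by simpa using hy) fun i n v hv w hw hwy => by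
      simp only [LinearMap.mulRight_apply] at hwy ⊢
      rw [mul_assoc]
      exact ι_mul_mem hv hwy (by omega)
  exact h ▸ this i x hx

theorem sig_one : sig (k := k) (1 : TA k V) = 1 := by
  rw [sig_of_mem one_mem_gr]; simp [sgn]

theorem sig_ι_mul (v : V) (w : TA k V) :
    sig (k := k) (TensorAlgebra.ι k v * w) =
      TensorAlgebra.ι k (sig (k := k) v) * sig (k := k) w := by
  have : sig ∘ₗ TensorProduct.lift ((LinearMap.mul k (TA k V)) ∘ₗ TensorAlgebra.ι k) =
      TensorProduct.lift ((LinearMap.mul k (TA k V)) ∘ₗ TensorAlgebra.ι k) ∘ₗ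
        TensorProduct.map sig sig := ext_gr₂ fun i j v hv w hw => by
    simp [sig_of_mem hv, sig_of_mem hw, sig_of_mem (ι_mul_mem hv hw rfl), sgn_add,
      smul_smul, mul_comm]
  simpa using LinearMap.congr_fun this (v ⊗ₜ w)

theorem sig_mul_word (x y : TA k V) :
    sig (k := k) (x * y) = sig (k := k) x * sig (k := k) y := by
  have : sig ∘ₗ LinearMap.mulRight k y =
      LinearMap.mulRight k (sig (k := k) y) ∘ₗ (sig : TA k V →ₗ[k] _) := by
    refine ext_word ?_ ?_
    · simp [sig_one]
    · intro v w hw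
      simp only [LinearMap.comp_apply, LinearMap.mulRight_apply] at hw ⊢
      rw [mul_assoc, sig_ι_mul, hw, sig_ι_mul, mul_assoc]
  simpa using LinearMap.congr_fun this x

end Grading

/-! ### Nonempty words, concatenation and cutting -/

variable (k V) in
/-- The space `⨁_{n ≥ 1} V^{⊗ n}` of nonempty words, written as `V ⊗ T V` (first letter and
tail). -/
abbrev Wd : Type u := V ⊗[k] TA k V

variable (k V) in
/-- The inclusion of the nonempty words into the tensor algebra. -/
noncomputable def inc : Wd k V →ₗ[k] TA k V :=
  TensorProduct.lift ((LinearMap.mul k (TA k V)) ∘ₗ TensorAlgebra.ι k)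

theorem inc_tmul (v : V) (w : TA k V) : inc k V (v ⊗ₜ w) = TensorAlgebra.ι k v * w := by simp [inc]

variable (k V) in
/-- The projection onto the nonempty words. -/
noncomputable def hd : TA k V →ₗ[k] Wd k V := para (TensorProduct.mk k V (TA k V)) 0 0

theorem hd_one : hd k V 1 = 0 := para_one _ _ _

theorem hd_ι_mul (v : V) (w : TA k V) : hd k V (TensorAlgebra.ι k v * w) = v ⊗ₜ w := by
  simp [hd, para_ι_mul]

theorem hd_inc (x : Wd k V) : hd k V (inc k V x) = x := by
  induction x using TensorProduct.induction_on with
  | zero => simp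
  | add x y hx hy => simp [hx, hy]
  | tmul v w => rw [inc_tmul, hd_ι_mul]

variable (k V) in
/-- A single letter as a word. -/
noncomputable def letter : V →ₗ[k] Wd k V := (TensorProduct.mk k V (TA k V)).flip 1

theorem letter_apply (v : V) : letter k V v = v ⊗ₜ 1 := rfl

variable (k V) in
/-- The projection of nonempty words onto the words with one letter. -/
noncomputable def toLetter : Wd k V →ₗ[k] V :=
  (TensorProduct.rid k V).toLinearMap ∘ₗ
    TensorProduct.map LinearMap.id (TensorAlgebra.algebraMapInv (R := k) (M := V)).toLinearMap

variable (k V) in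
/-- Right multiplication of a nonempty word by a word. -/
noncomputable def rmul : Wd k V →ₗ[k] TA k V →ₗ[k] Wd k V :=
  (LinearMap.lTensorHom V ∘ₗ (LinearMap.mul k (TA k V)).flip).flip

theorem rmul_tmul (v : V) (w t : TA k V) : rmul k V (v ⊗ₜ w) t = v ⊗ₜ (w * t) := by simp [rmul]

theorem rmul_rmul (x : Wd k V) (s t : TA k V) : rmul k V (rmul k V x s) t = rmul k V x (s * t) := by
  induction x using TensorProduct.induction_on with
  | zero => simp
  | add x y hx hy => simp [hx, hy]
  | tmul v w => simp [rmul_tmul, mul_assoc]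

theorem inc_rmul (x : Wd k V) (t : TA k V) : inc k V (rmul k V x t) = inc k V x * t := by
  induction x using TensorProduct.induction_on with
  | zero => simp
  | add x y hx hy => simp [hx, hy, add_mul]
  | tmul v w => simp [rmul_tmul, inc_tmul, mul_assoc]

variable (k V) in
/-- Concatenation of nonempty words. -/
noncomputable def conc : Wd k V →ₗ[k] Wd k V →ₗ[k] Wd k V := (rmul k V).compl₂ (inc k V)

theorem conc_apply (x y : Wd k V) : conc k V x y = rmul k V x (inc k V y) := rfl

variable (k V) in
/-- `w ↦ Σ w' ⊗ w''` over all decompositions `w = w' w''` with `w''` nonempty. -/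
noncomputable def split : TA k V →ₗ[k] TA k V ⊗[k] Wd k V :=
  para ((TensorProduct.mk k (TA k V) (Wd k V) 1).compRight k ∘ₗ TensorProduct.mk k V (TA k V))
    (LinearMap.rTensorHom (Wd k V) ∘ₗ LinearMap.mul k (TA k V) ∘ₗ TensorAlgebra.ι k) 0

theorem split_one : split k V 1 = 0 := para_one _ _ _

theorem split_ι_mul (v : V) (w : TA k V) : split k V (TensorAlgebra.ι k v * w) =
    1 ⊗ₜ (v ⊗ₜ w) + TensorProduct.map (LinearMap.mulLeft k (TensorAlgebra.ι k v)) LinearMap.id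
      (split k V w) := by
  rw [split, para_ι_mul]; rfl

variable (k V) in
/-- The cut comultiplication `w ↦ Σ w' ⊗ w''` over all decompositions `w = w' w''` into nonempty
words. -/
noncomputable def cut : Wd k V →ₗ[k] Wd k V ⊗[k] Wd k V :=
  (TensorProduct.assoc k V (TA k V) (Wd k V)).symm.toLinearMap ∘ₗ
    TensorProduct.map LinearMap.id (split k V)

end Words

/-! ### Free algebras with a derivation -/

section Free

variable {k : Type u} [Field k] {V W : Type u} [AddCommGroup V] [Module k V] [GrMod k V]
  [AddCommGroup W] [Module k W] [GrMod k W]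

theorem conc_assoc {V : Type u} [AddCommGroup V] [Module k V] (x y z : Wd k V) :
    conc k V (conc k V x y) z = conc k V x (conc k V y z) := by
  simp only [conc_apply, rmul_rmul, inc_rmul]

theorem inc_homDeg : inc k V ∈ homDeg k (Wd k V) (TA k V) 0 :=
  tensor_homDeg fun i j v hv w hw => by
    rw [inc_tmul]; exact ι_mul_mem hv hw (by omega)

theorem sig_inc (x : Wd k V) : sig (k := k) (inc k V x) = inc k V (sig (k := k) x) :=
  (degOp_comm inc_homDeg _ x).symm

theorem rmul_mem {i j m : ℤ} {x : Wd k V} {t : TA k V} (hx : x ∈ gr k (Wd k V) i)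
    (ht : t ∈ gr k (TA k V) j) (h : i + j = m) : rmul k V x t ∈ gr k (Wd k V) m := by
  have : (rmul k V).flip t ∈ homDeg k (Wd k V) (Wd k V) j :=
    tensor_homDeg fun a b v hv w hw => by
      rw [LinearMap.flip_apply, rmul_tmul]
      exact tmul_mem_gr hv (mul_mem_word hw ht rfl) (by omega)
  exact h ▸ this i x hx

theorem sig_rmul (x : Wd k V) (t : TA k V) :
    sig (k := k) (rmul k V x t) = rmul k V (sig (k := k) x) (sig (k := k) t) := by
  induction x using TensorProduct.induction_on with
  | zero => simp
  | add x y hx hy => simp [hx, hy]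
  | tmul v w => simp [rmul_tmul, sig_tmul, sig_mul_word]

variable (δ : V →ₗ[k] Wd k V)

/-- The odd derivation of the tensor algebra that restricts to `δ` on letters. -/
noncomputable def derT : TA k V →ₗ[k] TA k V :=
  para (LinearMap.mul k (TA k V) ∘ₗ inc k V ∘ₗ δ)
    (LinearMap.mul k (TA k V) ∘ₗ TensorAlgebra.ι k ∘ₗ sig) 0

theorem derT_one : derT δ 1 = 0 := para_one _ _ _

theorem derT_ι_mul (v : V) (w : TA k V) : derT δ (TensorAlgebra.ι k v * w) =
    inc k V (δ v) * w + TensorAlgebra.ι k (sig (k := k) v) * derT δ w := by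
  rw [derT, para_ι_mul]; rfl

/-- The odd derivation of the free non-unital algebra that restricts to `δ` on letters:
`v₁ ⋯ vₙ ↦ Σ ± v₁ ⋯ δ(vᵢ) ⋯ vₙ`, with sign `(-1)^{|v₁| + ⋯ + |vᵢ₋₁|}`. -/
noncomputable def der : Wd k V →ₗ[k] Wd k V :=
  TensorProduct.lift (rmul k V ∘ₗ δ) + TensorProduct.map sig (derT δ)

theorem der_tmul (v : V) (w : TA k V) :
    der δ (v ⊗ₜ w) = rmul k V (δ v) w + sig (k := k) v ⊗ₜ derT δ w := by simp [der]

theorem inc_der (x : Wd k V) : inc k V (der δ x) = derT δ (inc k V x) := by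
  induction x using TensorProduct.induction_on with
  | zero => simp
  | add x y hx hy => simp [hx, hy]
  | tmul v w => simp [der_tmul, inc_tmul, inc_rmul, derT_ι_mul]

theorem derT_mul (x y : TA k V) :
    derT δ (x * y) = derT δ x * y + sig (k := k) x * derT δ y := by
  have : derT δ ∘ₗ LinearMap.mulRight k y = LinearMap.mulRight k y ∘ₗ derT δ +
      LinearMap.mulRight k (derT δ y) ∘ₗ sig := by
    refine ext_word ?_ ?_
    · simp [derT_one, sig_one]
    · intro v w hw
      simp only [LinearMap.comp_apply, LinearMap.add_apply, LinearMap.mulRight_apply] at hw ⊢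
      rw [mul_assoc, derT_ι_mul, hw, derT_ι_mul, sig_ι_mul]
      simp only [mul_add, add_mul, mul_assoc, add_assoc]
  simpa using LinearMap.congr_fun this x

theorem der_rmul (x : Wd k V) (t : TA k V) :
    der δ (rmul k V x t) = rmul k V (der δ x) t + rmul k V (sig (k := k) x) (derT δ t) := by
  induction x using TensorProduct.induction_on with
  | zero => simp
  | add x y hx hy => simp only [map_add, LinearMap.add_apply, hx, hy]; abel
  | tmul v w =>
    simp only [der_tmul, rmul_tmul, map_add, LinearMap.add_apply, derT_mul, sig_tmul,
      TensorProduct.tmul_add, rmul_rmul, add_assoc]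

theorem der_conc (x y : Wd k V) :
    der δ (conc k V x y) = conc k V (der δ x) y + conc k V (sig (k := k) x) (der δ y) := by
  simp only [conc_apply, der_rmul, inc_der]

variable {δ}

theorem derT_homDeg (hδ : δ ∈ homDeg k V (Wd k V) (-1)) :
    derT δ ∈ homDeg k (TA k V) (TA k V) (-1) :=
  word_homDeg (by simp [derT_one]) fun i n v hv w hw hwd => by
    rw [derT_ι_mul]
    refine Submodule.add_mem _ (mul_mem_word (inc_homDeg _ _ (hδ i v hv)) hw (by omega))
      (ι_mul_mem (sig_mem hv) hwd (by omega))

theorem der_homDeg (hδ : δ ∈ homDeg k V (Wd k V) (-1)) :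
    der δ ∈ homDeg k (Wd k V) (Wd k V) (-1) :=
  tensor_homDeg fun i n v hv w hw => by
    rw [der_tmul]
    exact Submodule.add_mem _ (rmul_mem (hδ i v hv) hw (by omega))
      (tmul_mem_gr (sig_mem hv) (derT_homDeg hδ n w hw) (by omega))

theorem sig_odd {f : V →ₗ[k] W} (hf : f ∈ homDeg k V W (-1)) (v : V) :
    f (sig (k := k) v) = - sig (k := k) (f v) := by
  rw [sig_hom hf, sgn_odd (by decide)]; simp

theorem derT_derT (hδ : δ ∈ homDeg k V (Wd k V) (-1)) (h : ∀ v, der δ (δ v) = 0) (w : TA k V) :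
    derT δ (derT δ w) = 0 := by
  have : derT δ ∘ₗ derT δ = 0 := by
    refine ext_word (by simp [derT_one]) ?_
    intro v w hw
    simp only [LinearMap.comp_apply, LinearMap.zero_apply] at hw ⊢
    rw [derT_ι_mul, map_add, derT_mul, derT_ι_mul, hw, ← inc_der, h, sig_odd hδ, sig_inc, map_neg]
    simp
  exact LinearMap.congr_fun this w

theorem der_der (hδ : δ ∈ homDeg k V (Wd k V) (-1)) (h : ∀ v, der δ (δ v) = 0) (x : Wd k V) :
    der δ (der δ x) = 0 := by
  induction x using TensorProduct.induction_on with
  | zero => simp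
  | add x y hx hy => simp [hx, hy]
  | tmul v w =>
    rw [der_tmul, map_add, der_rmul, der_tmul, derT_derT hδ h, h, sig_odd hδ]
    simp

variable (δ) in
/-- The free non-unital graded algebra on `V` with the differential that extends `δ`. -/
@[reducible] noncomputable def freeDGA (hδ : δ ∈ homDeg k V (Wd k V) (-1))
    (h : ∀ v, der δ (δ v) = 0) : DGA k (Wd k V) where
  toGrMod := tensorGrMod
  d := der δ
  d_deg := der_homDeg hδ
  d_d := der_der hδ h
  mul := conc k V
  mul_assoc := conc_assoc
  mul_deg i j x hx y hy := rmul_mem hx (inc_homDeg j y hy) (by omega)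
  leibniz := der_conc δ

/-! Functoriality -/

variable (k) in
/-- Apply a linear map to every letter of a word. -/
noncomputable def tmap {V W : Type u} [AddCommGroup V] [Module k V] [AddCommGroup W] [Module k W]
    (f : V →ₗ[k] W) : TA k V →ₐ[k] TA k W :=
  TensorAlgebra.lift k (TensorAlgebra.ι k ∘ₗ f)

theorem tmap_ι {V W : Type u} [AddCommGroup V] [Module k V] [AddCommGroup W] [Module k W]
    (f : V →ₗ[k] W) (v : V) : tmap k f (TensorAlgebra.ι k v) = TensorAlgebra.ι k (f v) := by
  simp [tmap]

theorem tmap_id {V : Type u} [AddCommGroup V] [Module k V] :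
    tmap k (LinearMap.id : V →ₗ[k] V) = AlgHom.id k _ := by
  ext v; simp [tmap_ι]

variable (k) in
/-- Apply a linear map to every letter of a nonempty word. -/
noncomputable def wmap {V W : Type u} [AddCommGroup V] [Module k V] [AddCommGroup W] [Module k W]
    (f : V →ₗ[k] W) : Wd k V →ₗ[k] Wd k W :=
  TensorProduct.map f (tmap k f).toLinearMap

theorem tmap_ι_mul {V W : Type u} [AddCommGroup V] [Module k V] [AddCommGroup W] [Module k W]
    (f : V →ₗ[k] W) (v : V) (w : TA k V) : tmap k f (TensorAlgebra.ι k v * w) =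
      TensorAlgebra.ι k (f v) * tmap k f w := by
  rw [map_mul, tmap_ι]

section
variable {V W U : Type u} [AddCommGroup V] [Module k V] [AddCommGroup W] [Module k W]
  [AddCommGroup U] [Module k U] (f : V →ₗ[k] W)

theorem wmap_tmul (v : V) (w : TA k V) :
    wmap k f (v ⊗ₜ w) = f v ⊗ₜ tmap k f w := rfl

theorem wmap_id : wmap k (LinearMap.id : V →ₗ[k] V) = LinearMap.id := by
  simp [wmap, tmap_id]

theorem wmap_comp (g : W →ₗ[k] U) : wmap k (g ∘ₗ f) = wmap k g ∘ₗ wmap k f := by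
  rw [wmap, wmap, wmap, ← TensorProduct.map_comp]
  congr 1
  have : tmap k (g ∘ₗ f) = (tmap k g).comp (tmap k f) := by ext v; simp [tmap_ι]
  rw [this]; rfl

theorem inc_wmap (x : Wd k V) : inc k W (wmap k f x) = tmap k f (inc k V x) := by
  induction x using TensorProduct.induction_on with
  | zero => simp
  | add x y hx hy => simp [hx, hy]
  | tmul v w => simp [wmap_tmul, inc_tmul, tmap_ι]

theorem hd_tmap (x : TA k V) : hd k W (tmap k f x) = wmap k f (hd k V x) := by
  have : hd k W ∘ₗ (tmap k f).toLinearMap = wmap k f ∘ₗ hd k V :=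
    ext_word (by simp [hd_one]) fun v w _ => by
      simp [hd_ι_mul, wmap_tmul, tmap_ι]
  exact LinearMap.congr_fun this x

theorem wmap_rmul (x : Wd k V) (t : TA k V) :
    wmap k f (rmul k V x t) = rmul k W (wmap k f x) (tmap k f t) := by
  induction x using TensorProduct.induction_on with
  | zero => simp
  | add x y hx hy => simp [hx, hy]
  | tmul v w => simp [rmul_tmul, wmap_tmul]

theorem wmap_conc (x y : Wd k V) :
    wmap k f (conc k V x y) = conc k W (wmap k f x) (wmap k f y) := by
  simp only [conc_apply, wmap_rmul, inc_wmap]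

theorem wmap_letter (v : V) : wmap k f (letter k V v) = letter k W (f v) := by
  simp [letter_apply, wmap_tmul]

theorem split_tmap (x : TA k V) : split k W (tmap k f x) =
    TensorProduct.map (tmap k f).toLinearMap (wmap k f) (split k V x) := by
  have : split k W ∘ₗ (tmap k f).toLinearMap =
      TensorProduct.map (tmap k f).toLinearMap (wmap k f) ∘ₗ split k V := by
    refine ext_word (by simp [split_one]) fun v w hw => ?_
    simp only [LinearMap.comp_apply, AlgHom.toLinearMap_apply] at hw ⊢
    rw [tmap_ι_mul, split_ι_mul, hw, split_ι_mul, map_add]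
    congr 1
    · simp [wmap_tmul]
    · induction split k V w using TensorProduct.induction_on with
      | zero => simp
      | add x y hx hy => simp only [map_add, hx, hy]
      | tmul a b => simp [tmap_ι]
  exact LinearMap.congr_fun this x

theorem cut_wmap (x : Wd k V) :
    cut k W (wmap k f x) = TensorProduct.map (wmap k f) (wmap k f) (cut k V x) := by
  induction x using TensorProduct.induction_on with
  | zero => simp
  | add x y hx hy => simp only [map_add, hx, hy]
  | tmul v w =>
    simp only [cut, wmap_tmul, LinearMap.comp_apply, LinearEquiv.coe_coe, TensorProduct.map_tmul,
      LinearMap.id_apply, split_tmap]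
    induction split k V w using TensorProduct.induction_on with
    | zero => simp
    | add x y hx hy => simp only [map_add, hx, hy, TensorProduct.tmul_add]
    | tmul a b => simp [wmap_tmul]

end

theorem tmap_homDeg {f : V →ₗ[k] W} (hf : f ∈ homDeg k V W 0) :
    (tmap k f).toLinearMap ∈ homDeg k (TA k V) (TA k W) 0 :=
  word_homDeg (by simpa using one_mem_gr) fun i n v hv w hw h => by
    rw [AlgHom.toLinearMap_apply, tmap_ι_mul]
    exact ι_mul_mem (hf i v hv) h (by omega)

theorem wmap_homDeg {f : V →ₗ[k] W} (hf : f ∈ homDeg k V W 0) :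
    wmap k f ∈ homDeg k (Wd k V) (Wd k W) 0 :=
  map_homDeg hf (tmap_homDeg hf) rfl

theorem wmap_der {f : V →ₗ[k] W} (hf : f ∈ homDeg k V W 0) (δ : V →ₗ[k] Wd k V)
    (δ' : W →ₗ[k] Wd k W) (h : ∀ v, wmap k f (δ v) = δ' (f v)) (x : Wd k V) :
    wmap k f (der δ x) = der δ' (wmap k f x) := by
  have hs : ∀ v, f (sig (k := k) v) = sig (k := k) (f v) := fun v => degOp_comm hf _ v
  have ht : ∀ t, tmap k f (derT δ t) = derT δ' (tmap k f t) := by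
    intro t
    have : (tmap k f).toLinearMap ∘ₗ derT δ =
        derT δ' ∘ₗ (tmap k f).toLinearMap := by
      refine ext_word (by simp [derT_one]) fun v w hw => ?_
      simp only [LinearMap.comp_apply, AlgHom.toLinearMap_apply] at hw ⊢
      rw [derT_ι_mul, map_add, map_mul, map_mul, hw, tmap_ι_mul, derT_ι_mul, ← inc_wmap, h,
        tmap_ι, hs]
    exact LinearMap.congr_fun this t
  induction x using TensorProduct.induction_on with
  | zero => simp
  | add x y hx hy => simp [hx, hy]
  | tmul v w => simp only [der_tmul, wmap_tmul, map_add, wmap_rmul, h, ht, hs]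

end Free

/-! ### Tensor coalgebras with a coderivation -/

section Cofree

variable {k : Type u} [Field k]

section
variable {V : Type u} [AddCommGroup V] [Module k V]

theorem cut_tmul (v : V) (w : TA k V) : cut k V (v ⊗ₜ w) =
    (TensorProduct.assoc k V (TA k V) (Wd k V)).symm (v ⊗ₜ split k V w) := rfl

theorem split_coassoc (w : TA k V) :
    TensorProduct.assoc k _ _ _ (TensorProduct.map (split k V) LinearMap.id (split k V w)) =
      TensorProduct.map LinearMap.id (cut k V) (split k V w) := by
  have : (TensorProduct.assoc k _ _ _).toLinearMap ∘ₗ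
      TensorProduct.map (split k V) LinearMap.id ∘ₗ split k V =
      TensorProduct.map LinearMap.id (cut k V) ∘ₗ split k V := by
    refine ext_word (by simp [split_one]) fun v w hw => ?_
    simp only [LinearMap.comp_apply, LinearEquiv.coe_coe] at hw ⊢
    have e : ∀ t : TA k V ⊗[k] Wd k V, TensorProduct.assoc k _ _ _ (TensorProduct.map (split k V)
        LinearMap.id (TensorProduct.map (LinearMap.mulLeft k (TensorAlgebra.ι k v))
          LinearMap.id t)) = (1 : TA k V) ⊗ₜ ((TensorProduct.assoc k _ _ _).symm (v ⊗ₜ t)) +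
        TensorProduct.map (LinearMap.mulLeft k (TensorAlgebra.ι k v)) LinearMap.id
          (TensorProduct.assoc k _ _ _ (TensorProduct.map (split k V) LinearMap.id t)) := by
      intro t
      induction t using TensorProduct.induction_on with
      | zero => simp
      | add x y hx hy => simp only [map_add, hx, hy, TensorProduct.tmul_add]; abel
      | tmul x y =>
        simp only [TensorProduct.map_tmul, LinearMap.mulLeft_apply, split_ι_mul, LinearMap.id_apply,
          TensorProduct.add_tmul, map_add, TensorProduct.assoc_tmul, TensorProduct.assoc_symm_tmul]
        congr 1
        induction split k V x using TensorProduct.induction_on with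
        | zero => simp
        | add x y hx hy => simp only [map_add, hx, hy, TensorProduct.add_tmul]
        | tmul a b => simp
    rw [split_ι_mul, map_add, map_add, e, hw]
    simp only [TensorProduct.map_tmul, split_one, TensorProduct.zero_tmul, map_zero, zero_add,
      map_add, LinearMap.id_apply, cut_tmul]
    congr 1
    induction split k V w using TensorProduct.induction_on with
    | zero => simp
    | add x y hx hy => simp only [map_add, hx, hy]
    | tmul a b => simp
  exact LinearMap.congr_fun this w

theorem cut_coassoc (x : Wd k V) :
    TensorProduct.assoc k _ _ _ (TensorProduct.map (cut k V) LinearMap.id (cut k V x)) =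
      TensorProduct.map LinearMap.id (cut k V) (cut k V x) := by
  induction x using TensorProduct.induction_on with
  | zero => simp
  | add x y hx hy => simp only [map_add, hx, hy]
  | tmul v w =>
    rw [cut_tmul]
    have e1 : ∀ t : TA k V ⊗[k] Wd k V, TensorProduct.map LinearMap.id (cut k V)
        ((TensorProduct.assoc k _ _ _).symm (v ⊗ₜ t)) =
        (TensorProduct.assoc k _ _ _).symm (v ⊗ₜ TensorProduct.map LinearMap.id (cut k V) t) := by
      intro t
      induction t using TensorProduct.induction_on with
      | zero => simp
      | add x y hx hy => simp only [map_add, hx, hy, TensorProduct.tmul_add]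
      | tmul x y => simp
    rw [e1, ← split_coassoc]
    induction split k V w using TensorProduct.induction_on with
    | zero => simp
    | add x y hx hy => simp only [map_add, hx, hy, TensorProduct.tmul_add]
    | tmul x y =>
      simp only [TensorProduct.assoc_symm_tmul, TensorProduct.map_tmul, cut_tmul, LinearMap.id_apply]
      induction split k V x using TensorProduct.induction_on with
      | zero => simp
      | add x y hx hy => simp only [map_add, hx, hy, TensorProduct.tmul_add, TensorProduct.add_tmul]
      | tmul a b => simp

variable (k V) in
/-- The span of the words with at most `n` letters. -/
def lenLe : ℕ → Submodule k (TA k V)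
  | 0 => Submodule.span k {1}
  | n + 1 => Submodule.span k {1} ⊔
      Submodule.span k {x | ∃ v, ∃ w ∈ lenLe n, x = TensorAlgebra.ι k v * w}

theorem lenLe_mono : Monotone (lenLe k V) := by
  refine monotone_nat_of_le_succ fun n => ?_
  induction n with
  | zero => exact le_sup_left
  | succ n ih =>
    refine sup_le le_sup_left (le_trans (Submodule.span_mono ?_) le_sup_right)
    rintro _ ⟨v, w, hw, rfl⟩
    exact ⟨v, w, ih hw, rfl⟩

theorem exists_lenLe (w : TA k V) : ∃ n, w ∈ lenLe k V n := by
  have h := Submodule.mem_iSup_of_directed (lenLe k V) lenLe_mono.directed_le (x := w)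
  rw [← h]
  refine left_induction _ ?_ ?_ w
  · exact Submodule.mem_iSup_of_mem 0 (Submodule.mem_span_singleton_self 1)
  · intro v w hw
    obtain ⟨n, hn⟩ := (Submodule.mem_iSup_of_directed (lenLe k V) lenLe_mono.directed_le).1 hw
    refine Submodule.mem_iSup_of_mem (n + 1) ?_
    exact Submodule.mem_sup_right (Submodule.subset_span ⟨v, w, hn, rfl⟩)

theorem iterDel_cut (n : ℕ) (v : V) {w : TA k V} (hw : w ∈ lenLe k V n) :
    iterDel k (Wd k V) (cut k V) (n + 1) (v ⊗ₜ w) = 0 := by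
  have key : ∀ n, ∀ w ∈ lenLe k V (n + 1), ∀ {M : Type u} [AddCommGroup M] [Module k M]
      (g : TA k V →ₗ[k] M), (∀ x ∈ lenLe k V n, g x = 0) →
        TensorProduct.map g (LinearMap.id : Wd k V →ₗ[k] _) (split k V w) = 0 := by
    intro n
    induction n with
    | zero =>
      intro w hw M _ _ g hg
      have : lenLe k V 1 ≤ LinearMap.ker
          (TensorProduct.map g (LinearMap.id : Wd k V →ₗ[k] _) ∘ₗ split k V) := by
        refine sup_le (Submodule.span_le.2 ?_) (Submodule.span_le.2 ?_)
        · rintro _ rfl; simp [split_one]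
        · rintro _ ⟨v, w, hw, rfl⟩
          obtain ⟨c, rfl⟩ := Submodule.mem_span_singleton.1 hw
          have h1 : g 1 = 0 := hg 1 (Submodule.mem_span_singleton_self 1)
          rw [SetLike.mem_coe, LinearMap.mem_ker, LinearMap.comp_apply, mul_smul_comm, map_smul,
            split_ι_mul, split_one]
          simp [h1]
      exact this hw
    | succ n ih =>
      intro w hw M _ _ g hg
      have : lenLe k V (n + 2) ≤ LinearMap.ker
          (TensorProduct.map g (LinearMap.id : Wd k V →ₗ[k] _) ∘ₗ split k V) := by
        refine sup_le (Submodule.span_le.2 ?_) (Submodule.span_le.2 ?_)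
        · rintro _ rfl; simp [split_one]
        · rintro _ ⟨v, w, hw, rfl⟩
          have h1 : g 1 = 0 :=
            hg 1 (Submodule.mem_sup_left (Submodule.mem_span_singleton_self 1))
          have h2 := ih w hw (g ∘ₗ LinearMap.mulLeft k (TensorAlgebra.ι k v)) fun x hx =>
            hg _ (Submodule.mem_sup_right (Submodule.subset_span ⟨v, x, hx, rfl⟩))
          have h3 : TensorProduct.map (g ∘ₗ LinearMap.mulLeft k (TensorAlgebra.ι k v))
              (LinearMap.id : Wd k V →ₗ[k] _) = TensorProduct.map g LinearMap.id ∘ₗ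
              TensorProduct.map (LinearMap.mulLeft k (TensorAlgebra.ι k v)) LinearMap.id := by
            rw [← TensorProduct.map_comp, LinearMap.id_comp]
          rw [h3, LinearMap.comp_apply] at h2
          rw [SetLike.mem_coe, LinearMap.mem_ker, LinearMap.comp_apply, split_ι_mul, map_add, h2]
          simp [h1]
      exact this hw
  have cutmap : ∀ {M : Type u} [AddCommGroup M] [Module k M] (g : Wd k V →ₗ[k] M) (v : V)
      (w : TA k V), TensorProduct.map g LinearMap.id (cut k V (v ⊗ₜ w)) =
        TensorProduct.map (g ∘ₗ TensorProduct.mk k V (TA k V) v) LinearMap.id (split k V w) := by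
    intro M _ _ g v w
    rw [cut_tmul]
    induction split k V w using TensorProduct.induction_on with
    | zero => simp
    | add x y hx hy => simp only [map_add, hx, hy, TensorProduct.tmul_add]
    | tmul x y => simp
  induction n generalizing w with
  | zero =>
    obtain ⟨c, rfl⟩ := Submodule.mem_span_singleton.1 hw
    show TensorProduct.map _ LinearMap.id (cut k V _) = 0
    rw [cutmap]
    simp [split_one]
  | succ n ih =>
    show TensorProduct.map (iterDel k (Wd k V) (cut k V) (n + 1)) LinearMap.id (cut k V _) = 0
    rw [cutmap]
    exact key n w hw _ fun x hx => ih hx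

theorem cut_conil (x : Wd k V) : ∃ n, iterDel k (Wd k V) (cut k V) n x = 0 := by
  have : ∃ n, ∀ m, n ≤ m → iterDel k (Wd k V) (cut k V) (m + 1) x = 0 := by
    induction x using TensorProduct.induction_on with
    | zero => exact ⟨0, fun m _ => map_zero _⟩
    | add x y hx hy =>
      obtain ⟨n, hn⟩ := hx
      obtain ⟨m, hm⟩ := hy
      exact ⟨max n m, fun l hl => by
        rw [map_add, hn l (le_of_max_le_left hl), hm l (le_of_max_le_right hl), add_zero]⟩
    | tmul v w =>
      obtain ⟨n, hn⟩ := exists_lenLe w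
      exact ⟨n, fun m hm => iterDel_cut m v (lenLe_mono hm hn)⟩
  obtain ⟨n, hn⟩ := this
  exact ⟨n + 1, hn n le_rfl⟩

end

/-- `v ↦ (v₁ v₂ ⋯ vₙ ↦ b(v, v₁) v₂ ⋯ vₙ)` -/
noncomputable def merge {V : Type u} [AddCommGroup V] [Module k V] (b : V →ₗ[k] V →ₗ[k] V) :
    V →ₗ[k] Wd k V →ₗ[k] Wd k V :=
  LinearMap.rTensorHom (TA k V) ∘ₗ b

theorem merge_tmul {V : Type u} [AddCommGroup V] [Module k V] (b : V →ₗ[k] V →ₗ[k] V)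
    (v u : V) (w : TA k V) : merge b v (u ⊗ₜ w) = b v u ⊗ₜ w := rfl

theorem split_merge {V : Type u} [AddCommGroup V] [Module k V] (b : V →ₗ[k] V →ₗ[k] V)
    (v : V) (w : TA k V) : split k V (inc k V (merge b v (hd k V w))) =
      1 ⊗ₜ merge b v (hd k V w) +
      TensorProduct.map (inc k V ∘ₗ merge b v ∘ₗ hd k V) LinearMap.id (split k V w) := by
  have : split k V ∘ₗ inc k V ∘ₗ merge b v ∘ₗ hd k V =
      TensorProduct.mk k (TA k V) (Wd k V) 1 ∘ₗ merge b v ∘ₗ hd k V +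
      TensorProduct.map (inc k V ∘ₗ merge b v ∘ₗ hd k V) LinearMap.id ∘ₗ split k V := by
    refine ext_word (by simp [hd_one, split_one]) fun u w _ => ?_
    simp only [LinearMap.comp_apply, LinearMap.add_apply, hd_ι_mul, merge_tmul, inc_tmul,
      split_ι_mul, TensorProduct.mk_apply, map_add, TensorProduct.map_tmul, hd_one, map_zero,
      TensorProduct.zero_tmul, zero_add, LinearMap.id_apply]
    congr 1
    induction split k V w using TensorProduct.induction_on with
    | zero => simp
    | add x y hx hy => simp only [map_add, hx, hy]
    | tmul a c => simp [hd_ι_mul, merge_tmul, inc_tmul]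
  exact LinearMap.congr_fun this w

theorem cut_merge {V : Type u} [AddCommGroup V] [Module k V] (b : V →ₗ[k] V →ₗ[k] V)
    (v : V) (w : TA k V) : cut k V (merge b v (hd k V w)) =
      TensorProduct.map (merge b v ∘ₗ hd k V) LinearMap.id (split k V w) := by
  have : cut k V ∘ₗ merge b v ∘ₗ hd k V =
      TensorProduct.map (merge b v ∘ₗ hd k V) LinearMap.id ∘ₗ split k V := by
    refine ext_word (by simp [hd_one, split_one]) fun u w _ => ?_
    simp only [LinearMap.comp_apply, hd_ι_mul, merge_tmul, cut_tmul,
      split_ι_mul, map_add, TensorProduct.map_tmul, hd_one, map_zero,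
      TensorProduct.zero_tmul, zero_add]
    induction split k V w using TensorProduct.induction_on with
    | zero => simp
    | add x y hx hy => simp only [map_add, hx, hy, TensorProduct.tmul_add]
    | tmul a c => simp [hd_ι_mul, merge_tmul]
  exact LinearMap.congr_fun this w

variable {V W : Type u} [AddCommGroup V] [Module k V] [GrMod k V]
  [AddCommGroup W] [Module k W] [GrMod k W]

variable (d₁ : V →ₗ[k] V) (b : V →ₗ[k] V →ₗ[k] V)

/-- The odd operator on words that applies `d₁` to single letters and `b` to pairs of
neighbouring letters. -/
noncomputable def coderT : TA k V →ₗ[k] TA k V :=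
  para (LinearMap.mul k (TA k V) ∘ₗ TensorAlgebra.ι k ∘ₗ d₁ +
      (inc k V).compRight k ∘ₗ (merge b).compl₂ (hd k V))
    (LinearMap.mul k (TA k V) ∘ₗ TensorAlgebra.ι k ∘ₗ sig) 0

theorem coderT_one : coderT d₁ b 1 = 0 := para_one _ _ _

theorem coderT_ι_mul (v : V) (w : TA k V) : coderT d₁ b (TensorAlgebra.ι k v * w) =
    TensorAlgebra.ι k (d₁ v) * w + inc k V (merge b v (hd k V w)) +
      TensorAlgebra.ι k (sig (k := k) v) * coderT d₁ b w := by
  rw [coderT, para_ι_mul]; rfl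

/-- The coderivation of the tensor coalgebra given by
`v₁ ⋯ vₙ ↦ Σ ± v₁ ⋯ d₁(vᵢ) ⋯ vₙ + Σ ± v₁ ⋯ b(vᵢ, vᵢ₊₁) ⋯ vₙ`
with signs `(-1)^{|v₁| + ⋯ + |vᵢ₋₁|}`. -/
noncomputable def coder : Wd k V →ₗ[k] Wd k V :=
  TensorProduct.map d₁ LinearMap.id + TensorProduct.lift ((merge b).compl₂ (hd k V)) +
    TensorProduct.map sig (coderT d₁ b)

theorem coder_tmul (v : V) (w : TA k V) : coder d₁ b (v ⊗ₜ w) =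
    d₁ v ⊗ₜ w + merge b v (hd k V w) + sig (k := k) v ⊗ₜ coderT d₁ b w := rfl

theorem hd_coderT (w : TA k V) : hd k V (coderT d₁ b w) = coder d₁ b (hd k V w) := by
  have : hd k V ∘ₗ coderT d₁ b = coder d₁ b ∘ₗ hd k V := by
    refine ext_word (by simp [coderT_one, hd_one]) fun v w _ => ?_
    simp only [LinearMap.comp_apply, coderT_ι_mul, map_add, hd_ι_mul, hd_inc, coder_tmul]
  exact LinearMap.congr_fun this w

theorem split_coderT (w : TA k V) : split k V (coderT d₁ b w) =
    TensorProduct.map (coderT d₁ b) LinearMap.id (split k V w) +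
      TensorProduct.map (sig (k := k)) (coder d₁ b) (split k V w) := by
  have : split k V ∘ₗ coderT d₁ b = (TensorProduct.map (coderT d₁ b) LinearMap.id +
      TensorProduct.map (sig (k := k)) (coder d₁ b)) ∘ₗ split k V := by
    refine ext_word (by simp [coderT_one, split_one]) fun v w hw => ?_
    simp only [LinearMap.comp_apply, LinearMap.add_apply] at hw ⊢
    have e : ∀ t : TA k V ⊗[k] Wd k V,
        TensorProduct.map (coderT d₁ b) LinearMap.id
          (TensorProduct.map (LinearMap.mulLeft k (TensorAlgebra.ι k v)) LinearMap.id t) +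
        TensorProduct.map (sig (k := k)) (coder d₁ b)
          (TensorProduct.map (LinearMap.mulLeft k (TensorAlgebra.ι k v)) LinearMap.id t) =
        TensorProduct.map (LinearMap.mulLeft k (TensorAlgebra.ι k (d₁ v))) LinearMap.id t +
        TensorProduct.map (inc k V ∘ₗ merge b v ∘ₗ hd k V) LinearMap.id t +
        TensorProduct.map (LinearMap.mulLeft k (TensorAlgebra.ι k (sig (k := k) v))) LinearMap.id
          (TensorProduct.map (coderT d₁ b) LinearMap.id t +
            TensorProduct.map (sig (k := k)) (coder d₁ b) t) := by
      intro t
      induction t using TensorProduct.induction_on with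
      | zero => simp
      | add x y hx hy =>
        have := congrArg₂ (· + ·) hx hy
        simp only [map_add] at this ⊢
        rw [← sub_eq_zero] at this ⊢
        rw [← this]
        abel
      | tmul x y => simp [coderT_ι_mul, sig_ι_mul, TensorProduct.add_tmul, add_assoc]
    have h1 : TensorProduct.map (coderT d₁ b) LinearMap.id ((1 : TA k V) ⊗ₜ[k] (v ⊗ₜ[k] w)) = 0 := by
      simp [coderT_one]
    have h2 : TensorProduct.map (sig (k := k)) (coder d₁ b) ((1 : TA k V) ⊗ₜ[k] (v ⊗ₜ[k] w)) =
        1 ⊗ₜ (d₁ v ⊗ₜ w) + 1 ⊗ₜ merge b v (hd k V w) +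
          1 ⊗ₜ (sig (k := k) v ⊗ₜ coderT d₁ b w) := by
      simp [coder_tmul, sig_one, TensorProduct.tmul_add]
    have e' := e (split k V w)
    rw [← hw] at e'
    rw [coderT_ι_mul, map_add, map_add, split_ι_mul, split_merge, split_ι_mul, split_ι_mul,
      map_add, map_add, h1, h2, zero_add]
    rw [← sub_eq_zero] at e' ⊢
    rw [← neg_eq_zero, ← e']
    abel
  exact LinearMap.congr_fun this w

theorem cut_coder (x : Wd k V) : cut k V (coder d₁ b x) =
    TensorProduct.map (coder d₁ b) LinearMap.id (cut k V x) +
      TensorProduct.map (sig (k := k)) (coder d₁ b) (cut k V x) := by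
  induction x using TensorProduct.induction_on with
  | zero => simp
  | add x y hx hy => simp only [map_add, hx, hy]; abel
  | tmul v w =>
    rw [coder_tmul, map_add, map_add, cut_merge, cut_tmul, cut_tmul, cut_tmul, split_coderT]
    induction split k V w using TensorProduct.induction_on with
    | zero => simp
    | add x y hx hy =>
      have := congrArg₂ (· + ·) hx hy
      simp only [map_add, TensorProduct.tmul_add] at this ⊢
      rw [← sub_eq_zero] at this ⊢
      rw [← this]
      abel
    | tmul x y =>
      simp [coder_tmul, sig_tmul, TensorProduct.add_tmul, TensorProduct.tmul_add, add_assoc]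

theorem hd_homDeg : hd k V ∈ homDeg k (TA k V) (Wd k V) 0 :=
  word_homDeg (by simp [hd_one]) fun i n v hv w hw _ => by
    rw [hd_ι_mul]; exact tmul_mem_gr hv hw (by omega)

theorem split_homDeg : split k V ∈ homDeg k (TA k V) (TA k V ⊗[k] Wd k V) 0 :=
  word_homDeg (by simp [split_one]) fun i n v hv w hw h => by
    rw [split_ι_mul]
    refine Submodule.add_mem _ (tmul_mem_gr one_mem_gr (tmul_mem_gr hv hw rfl) (by omega)) ?_
    have hm : LinearMap.mulLeft k (TensorAlgebra.ι k v) ∈ homDeg k (TA k V) (TA k V) i :=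
      fun m x hx => ι_mul_mem hv hx (by omega)
    have hi : (LinearMap.id : Wd k V →ₗ[k] _) ∈ homDeg k (Wd k V) (Wd k V) 0 :=
      fun m x hx => by simpa using hx
    have := map_homDeg hm hi (add_zero i) _ _ h
    rwa [show n + 0 + i = i + n + 0 by omega] at this

theorem assoc_symm_homDeg {U : Type u} [AddCommGroup U] [Module k U] [GrMod k U] :
    (TensorProduct.assoc k V W U).symm.toLinearMap ∈
      homDeg k (V ⊗[k] (W ⊗[k] U)) ((V ⊗[k] W) ⊗[k] U) 0 :=
  tensor_homDeg fun i j v hv t ht => by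
    refine tensor_gr_le ((TensorProduct.assoc k V W U).symm.toLinearMap ∘ₗ
      TensorProduct.mk k V (W ⊗[k] U) v) _ j (fun a c hac w hw u hu => ?_) t ht
    exact tmul_mem_gr (tmul_mem_gr hv hw rfl) hu (by omega)

theorem cut_homDeg : cut k V ∈ homDeg k (Wd k V) (Wd k V ⊗[k] Wd k V) 0 := by
  have hi : (LinearMap.id : V →ₗ[k] _) ∈ homDeg k V V 0 := fun m x hx => by simpa using hx
  exact homDeg_comp assoc_symm_homDeg (map_homDeg hi split_homDeg rfl) rfl

/-- The conditions on `d₁` and `b` under which `coder d₁ b` is a differential: in the case of the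
bar construction they say that `A` is a dg algebra. -/
structure BarData (d₁ : V →ₗ[k] V) (b : V →ₗ[k] V →ₗ[k] V) : Prop where
  d_deg : d₁ ∈ homDeg k V V (-1)
  b_deg : ∀ i j, ∀ v ∈ gr k V i, ∀ w ∈ gr k V j, b v w ∈ gr k V (i + j - 1)
  d_d : ∀ v, d₁ (d₁ v) = 0
  d_b : ∀ v w, d₁ (b v w) + b (d₁ v) w + b (sig (k := k) v) (d₁ w) = 0
  b_b : ∀ u v w, b (b u v) w + b (sig (k := k) u) (b v w) = 0

variable {d₁ b}

theorem merge_homDeg (h : BarData d₁ b) {i : ℤ} {v : V} (hv : v ∈ gr k V i) :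
    merge b v ∈ homDeg k (Wd k V) (Wd k V) (i - 1) :=
  tensor_homDeg fun a c u hu w hw => by
    rw [merge_tmul]; exact tmul_mem_gr (h.b_deg _ _ v hv u hu) hw (by omega)

theorem coderT_homDeg (h : BarData d₁ b) : coderT d₁ b ∈ homDeg k (TA k V) (TA k V) (-1) :=
  word_homDeg (by simp [coderT_one]) fun i n v hv w hw hwd => by
    rw [coderT_ι_mul]
    refine Submodule.add_mem _ (Submodule.add_mem _ (ι_mul_mem (h.d_deg i v hv) hw (by omega)) ?_)
      (ι_mul_mem (sig_mem hv) hwd (by omega))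
    have := inc_homDeg _ _ (merge_homDeg h hv _ _ (hd_homDeg n w hw))
    rwa [show n + 0 + (i - 1) + 0 = i + n + -1 by omega] at this

theorem coder_homDeg (h : BarData d₁ b) : coder d₁ b ∈ homDeg k (Wd k V) (Wd k V) (-1) :=
  tensor_homDeg fun i n v hv w hw => by
    rw [coder_tmul]
    refine Submodule.add_mem _ (Submodule.add_mem _ (tmul_mem_gr (h.d_deg i v hv) hw (by omega)) ?_)
      (tmul_mem_gr (sig_mem hv) (coderT_homDeg h n w hw) (by omega))
    have := merge_homDeg h hv _ _ (hd_homDeg n w hw)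
    rwa [show n + 0 + (i - 1) = i + n + -1 by omega] at this

theorem sig_b (h : BarData d₁ b) (v w : V) :
    b (sig (k := k) v) (sig (k := k) w) = - sig (k := k) (b v w) := by
  have h1 : TensorProduct.lift b ∈ homDeg k (V ⊗[k] V) V (-1) :=
    tensor_homDeg fun i j v hv w hw => h.b_deg i j v hv w hw
  have := sig_odd h1 (v ⊗ₜ w)
  simpa [sig_tmul] using this

theorem coderT_coderT (h : BarData d₁ b) (w : TA k V) : coderT d₁ b (coderT d₁ b w) = 0 := by
  have : coderT d₁ b ∘ₗ coderT d₁ b = 0 := by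
    refine ext_word (by simp [coderT_one]) fun v w hw => ?_
    simp only [LinearMap.comp_apply, LinearMap.zero_apply] at hw ⊢
    have key : coderT d₁ b (inc k V (merge b v (hd k V w))) +
        inc k V (merge b (d₁ v) (hd k V w)) +
        inc k V (merge b (sig (k := k) v) (hd k V (coderT d₁ b w))) = 0 := by
      rw [hd_coderT]
      generalize hd k V w = x
      induction x using TensorProduct.induction_on with
      | zero => simp
      | add x y hx hy =>
        have := congrArg₂ (· + ·) hx hy
        simp only [map_add, add_zero] at this ⊢
        rw [← this]
        abel
      | tmul u t =>
        simp only [merge_tmul, inc_tmul, coderT_ι_mul, coder_tmul, map_add, sig_b h]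
        have e1 := h.d_b v u
        have e2 : inc k V (merge b (b v u) (hd k V t)) +
            inc k V (merge b (sig (k := k) v) (merge b u (hd k V t))) = 0 := by
          generalize hd k V t = y
          induction y using TensorProduct.induction_on with
          | zero => simp
          | add x y hx hy =>
            have := congrArg₂ (· + ·) hx hy
            simp only [map_add, add_zero] at this ⊢
            rw [← this]
            abel
          | tmul z s =>
            simp only [merge_tmul, inc_tmul]
            rw [← add_mul, ← map_add, h.b_b]; simp
        have e3 : TensorAlgebra.ι k (d₁ (b v u)) * t + TensorAlgebra.ι k (b (d₁ v) u) * t +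
            TensorAlgebra.ι k (b (sig (k := k) v) (d₁ u)) * t = 0 := by
          rw [← add_mul, ← add_mul, ← map_add, ← map_add, e1]; simp
        rw [map_neg, neg_mul]
        rw [← add_zero (0 : TA k V)]
        nth_rewrite 1 [← e2]
        rw [← e3]
        abel
    rw [coderT_ι_mul, map_add, map_add, coderT_ι_mul, coderT_ι_mul, hw, h.d_d, sig_sig,
      sig_odd h.d_deg]
    simp only [map_neg, neg_mul, map_zero, zero_mul, mul_zero, zero_add, add_zero]
    rw [← key]
    abel
  exact LinearMap.congr_fun this w

theorem coder_coder (h : BarData d₁ b) (x : Wd k V) : coder d₁ b (coder d₁ b x) = 0 := by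
  have hi : ∀ y, inc k V (coder d₁ b y) = coderT d₁ b (inc k V y) := by
    intro y
    induction y using TensorProduct.induction_on with
    | zero => simp
    | add x y hx hy => simp [hx, hy]
    | tmul v w => simp [coder_tmul, inc_tmul, coderT_ι_mul]
  rw [← hd_inc (coder d₁ b (coder d₁ b x)), hi, hi, coderT_coderT h, map_zero]

/-- The tensor coalgebra with the cut comultiplication and the differential `coder d₁ b`. -/
@[reducible] noncomputable def cofreeDGC (h : BarData d₁ b) : DGC k (Wd k V) where
  toGrMod := tensorGrMod
  d := coder d₁ b
  d_deg := coder_homDeg h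
  d_d := coder_coder h
  comul := cut k V
  coassoc := cut_coassoc
  comul_deg n c hc := by simpa using cut_homDeg n c hc
  coleibniz := cut_coder d₁ b

theorem wmap_coder {f : V →ₗ[k] W} (hf : f ∈ homDeg k V W 0) (d₁ : V →ₗ[k] V)
    (b : V →ₗ[k] V →ₗ[k] V) (d₁' : W →ₗ[k] W) (b' : W →ₗ[k] W →ₗ[k] W)
    (hd₁ : ∀ v, f (d₁ v) = d₁' (f v)) (hb : ∀ u v, f (b u v) = b' (f u) (f v)) (x : Wd k V) :
    wmap k f (coder d₁ b x) = coder d₁' b' (wmap k f x) := by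
  have hs : ∀ v, f (sig (k := k) v) = sig (k := k) (f v) := fun v => degOp_comm hf _ v
  have hm : ∀ v x, wmap k f (merge b v x) = merge b' (f v) (wmap k f x) := by
    intro v x
    induction x using TensorProduct.induction_on with
    | zero => simp
    | add x y hx hy => simp [hx, hy]
    | tmul u w => simp [merge_tmul, wmap_tmul, hb]
  have ht : ∀ t, tmap k f (coderT d₁ b t) = coderT d₁' b' (tmap k f t) := by
    intro t
    have : (tmap k f).toLinearMap ∘ₗ coderT d₁ b = coderT d₁' b' ∘ₗ (tmap k f).toLinearMap := by
      refine ext_word (by simp [coderT_one]) fun v w hw => ?_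
      simp only [LinearMap.comp_apply, AlgHom.toLinearMap_apply] at hw ⊢
      rw [coderT_ι_mul, map_add, map_add, map_mul, map_mul, hw, tmap_ι_mul, coderT_ι_mul,
        ← inc_wmap, hm, hd_tmap, tmap_ι, tmap_ι, hs, hd₁]
    exact LinearMap.congr_fun this t
  induction x using TensorProduct.induction_on with
  | zero => simp
  | add x y hx hy => simp [hx, hy]
  | tmul v w => simp only [coder_tmul, wmap_tmul, map_add, hm, ht, hs, hd₁, hd_tmap]

end Cofree

/-! ### The categories of dg algebras and of conilpotent dg coalgebras -/

section Cat

/-- Non-unital dg algebras over `k`. -/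
structure DGAlg (k : Type u) [Field k] where
  carrier : Type u
  [grp : AddCommGroup carrier]
  [mod : Module k carrier]
  [alg : DGA k carrier]

/-- Conilpotent non-counital dg coalgebras over `k`. -/
structure CoDGA (k : Type u) [Field k] where
  carrier : Type u
  [grp : AddCommGroup carrier]
  [mod : Module k carrier]
  [coalg : DGC k carrier]
  conil : Conil k carrier

variable {k : Type u} [Field k]

instance : CoeSort (DGAlg k) (Type u) := ⟨DGAlg.carrier⟩
instance : CoeSort (CoDGA k) (Type u) := ⟨CoDGA.carrier⟩

attribute [instance] DGAlg.grp DGAlg.mod DGAlg.alg CoDGA.grp CoDGA.mod CoDGA.coalg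

/-- Morphisms of dg algebras. -/
@[ext] structure DGAlg.Hom (A B : DGAlg k) where
  toLin : A →ₗ[k] B
  deg : ∀ n, ∀ a ∈ gr k A n, toLin a ∈ gr k B n
  comm_d : ∀ a, toLin (dd k A a) = dd k B (toLin a)
  map_mul : ∀ a b, toLin (mu k A a b) = mu k B (toLin a) (toLin b)

/-- Morphisms of dg coalgebras. -/
@[ext] structure CoDGA.Hom (C D : CoDGA k) where
  toLin : C →ₗ[k] D
  deg : ∀ n, ∀ c ∈ gr k C n, toLin c ∈ gr k D n
  comm_d : ∀ c, toLin (dd k C c) = dd k D (toLin c)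
  map_comul : ∀ c, Del k D (toLin c) = TensorProduct.map toLin toLin (Del k C c)

instance : Category (DGAlg k) where
  Hom := DGAlg.Hom
  id A := ⟨LinearMap.id, fun _ _ h => h, fun _ => rfl, fun _ _ => rfl⟩
  comp f g := ⟨g.toLin ∘ₗ f.toLin, fun n a h => g.deg n _ (f.deg n a h),
    fun a => by simp [f.comm_d, g.comm_d], fun a b => by simp [f.map_mul, g.map_mul]⟩

instance : Category (CoDGA k) where
  Hom := CoDGA.Hom
  id C := ⟨LinearMap.id, fun _ _ h => h, fun _ => rfl, fun _ => by simp⟩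
  comp f g := ⟨g.toLin ∘ₗ f.toLin, fun n a h => g.deg n _ (f.deg n a h),
    fun a => by simp [f.comm_d, g.comm_d], fun c => by
      simp [f.map_comul, g.map_comul, TensorProduct.map_map]⟩

@[ext] theorem DGAlg.hom_ext {A B : DGAlg k} {f g : A ⟶ B}
    (h : DGAlg.Hom.toLin f = DGAlg.Hom.toLin g) : f = g := DGAlg.Hom.ext h

@[ext] theorem CoDGA.hom_ext {A B : CoDGA k} {f g : A ⟶ B}
    (h : CoDGA.Hom.toLin f = CoDGA.Hom.toLin g) : f = g := CoDGA.Hom.ext h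

@[simp] theorem DGAlg.toLin_id (A : DGAlg k) : DGAlg.Hom.toLin (𝟙 A) = LinearMap.id := rfl
@[simp] theorem DGAlg.toLin_comp {A B C : DGAlg k} (f : A ⟶ B) (g : B ⟶ C) :
    DGAlg.Hom.toLin (f ≫ g) = DGAlg.Hom.toLin g ∘ₗ DGAlg.Hom.toLin f := rfl
@[simp] theorem CoDGA.toLin_id (A : CoDGA k) : CoDGA.Hom.toLin (𝟙 A) = LinearMap.id := rfl
@[simp] theorem CoDGA.toLin_comp {A B C : CoDGA k} (f : A ⟶ B) (g : B ⟶ C) :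
    CoDGA.Hom.toLin (f ≫ g) = CoDGA.Hom.toLin g ∘ₗ CoDGA.Hom.toLin f := rfl

theorem DGAlg.Hom.homDeg {A B : DGAlg k} (f : A ⟶ B) : DGAlg.Hom.toLin f ∈ homDeg k A B 0 :=
  fun n a h => by rw [add_zero]; exact DGAlg.Hom.deg f n a h

theorem CoDGA.Hom.homDeg {A B : CoDGA k} (f : A ⟶ B) : CoDGA.Hom.toLin f ∈ homDeg k A B 0 :=
  fun n a h => by rw [add_zero]; exact CoDGA.Hom.deg f n a h

end Cat

/-! ### Shifts -/

section Shift

variable {k : Type u} [Field k]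

/-- The shifted space with `(Shift m V)_n = V_{n+m}`. -/
def Shift (_ : ℤ) (V : Type u) : Type u := V

variable {V W : Type u} [AddCommGroup V] [Module k V] [AddCommGroup W] [Module k W]

instance (m : ℤ) : AddCommGroup (Shift m V) := inferInstanceAs (AddCommGroup V)
instance (m : ℤ) : Module k (Shift m V) := inferInstanceAs (Module k V)

variable (k) in
/-- The identity map, from a space to its shift. -/
def toShift (m : ℤ) : V →ₗ[k] Shift m V := (LinearMap.id : V →ₗ[k] V)

variable (k) in
/-- The identity map, from a shift to the original space. -/
def ofShift (m : ℤ) : Shift m V →ₗ[k] V := (LinearMap.id : V →ₗ[k] V)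

@[simp] theorem ofShift_toShift (m : ℤ) (v : V) : ofShift k m (toShift k m v) = v := rfl
@[simp] theorem toShift_ofShift (m : ℤ) (v : Shift m V) : toShift k m (ofShift k m v) = v := rfl

noncomputable instance shiftGrMod [GrMod k V] (m : ℤ) : GrMod k (Shift m V) where
  grade n := (gr k V (n + m)).comap (ofShift k m)
  internal := internal_of _ (ofShift k m) (fun _ _ h => h) (fun n => cmp (V := V) (n + m) ∘ₗ ofShift k m)
    (fun n v hv => cmp_of_mem (k := k) (V := V) (n := n + m) (v := ofShift k m v) hv)
    (fun n p h v hv => cmp_of_ne (k := k) (V := V) (m := n + m) (n := p + m) (v := ofShift k m v) (by omega) hv) (by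
      have := (Equiv.addRight m).iSup_comp (g := gr k V)
      rw [iSup_gr] at this
      exact this)

theorem mem_shift [GrMod k V] {m n : ℤ} {v : Shift m V} :
    v ∈ gr k (Shift m V) n ↔ ofShift k m v ∈ gr k V (n + m) := Iff.rfl

theorem toShift_mem [GrMod k V] {m n p : ℤ} {v : V} (hv : v ∈ gr k V p) (h : n + m = p) :
    toShift k m v ∈ gr k (Shift m V) n := by subst h; exact hv

theorem sig_toShift [GrMod k V] {m : ℤ} (hm : ¬ Even m) (v : V) :
    sig (k := k) (toShift k m v) = - toShift k m (sig (k := k) v) := by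
  have : sig ∘ₗ toShift k m = -(toShift k m ∘ₗ (sig : V →ₗ[k] V)) := ext_gr fun n v hv => by
    have h := toShift_mem (m := m) (n := n + -m) hv (by omega)
    have h1 : sgn k (n + -m) = - sgn k n := by
      rw [sgn_add, sgn_odd (n := -m) (by rwa [even_neg])]; simp
    simp [sig_of_mem hv, sig_of_mem h, h1]
  exact LinearMap.congr_fun this v

end Shift

/-! ### The cobar construction -/

section Cobar

variable {k : Type u} [Field k] {C D : Type u} [AddCommGroup C] [Module k C] [DGC k C]
  [AddCommGroup D] [Module k D] [DGC k D]

theorem rmul_letter_one {V : Type u} [AddCommGroup V] [Module k V] (x : Wd k V) :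
    rmul k V x 1 = x := by
  induction x using TensorProduct.induction_on with
  | zero => simp
  | add x y hx hy => simp [hx, hy]
  | tmul v w => simp [rmul_tmul]

theorem der_letter {V : Type u} [AddCommGroup V] [Module k V] [GrMod k V] (δ : V →ₗ[k] Wd k V)
    (v : V) : der δ (letter k V v) = δ v := by
  rw [letter_apply, der_tmul, derT_one, rmul_letter_one]; simp

theorem letter_mem {V : Type u} [AddCommGroup V] [Module k V] [GrMod k V] {n : ℤ} {v : V}
    (hv : v ∈ gr k V n) : letter k V v ∈ gr k (Wd k V) n :=
  tmul_mem_gr hv one_mem_gr (add_zero n)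

theorem sig_letter {V : Type u} [AddCommGroup V] [Module k V] [GrMod k V] (v : V) :
    sig (k := k) (letter k V v) = letter k V (sig (k := k) v) := by
  rw [letter_apply, sig_tmul, sig_one, letter_apply]

theorem conc_mem {V : Type u} [AddCommGroup V] [Module k V] [GrMod k V] {i j n : ℤ} {x y : Wd k V}
    (hx : x ∈ gr k (Wd k V) i) (hy : y ∈ gr k (Wd k V) j) (h : i + j = n) :
    conc k V x y ∈ gr k (Wd k V) n := rmul_mem hx (inc_homDeg j y hy) (by omega)

variable (k C) in
/-- The generator `s c` of the cobar construction. -/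
noncomputable def sus : C →ₗ[k] Wd k (Shift 1 C) := letter k (Shift 1 C) ∘ₗ toShift k 1

variable (k C) in
/-- `x ⊗ y ↦ (-1)^{|x|} (s x) (s y)` -/
noncomputable def susMul : C ⊗[k] C →ₗ[k] Wd k (Shift 1 C) :=
  TensorProduct.lift ((conc k (Shift 1 C)).compl₁₂ (sus k C ∘ₗ sig) (sus k C))

theorem susMul_tmul (x y : C) :
    susMul k C (x ⊗ₜ y) = conc k _ (sus k C (sig (k := k) x)) (sus k C y) := rfl

variable (k C) in
/-- The differential of the cobar construction on generators:
`s c ↦ - s (d c) - Σ (-1)^{|c'|} (s c') (s c'')`, where `Δ c = Σ c' ⊗ c''`. -/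
noncomputable def cobarD : Shift 1 C →ₗ[k] Wd k (Shift 1 C) :=
  (-(sus k C ∘ₗ dd k C) - susMul k C ∘ₗ Del k C) ∘ₗ ofShift k 1

theorem cobarD_apply (c : C) : cobarD k C (toShift k 1 c) =
    - sus k C (dd k C c) - susMul k C (Del k C c) := rfl

theorem sus_mem {n m : ℤ} {c : C} (hc : c ∈ gr k C n) (h : m + 1 = n) :
    sus k C c ∈ gr k (Wd k (Shift 1 C)) m := letter_mem (toShift_mem hc h)

theorem susMul_homDeg : susMul k C ∈ homDeg k (C ⊗[k] C) (Wd k (Shift 1 C)) (-2) :=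
  tensor_homDeg fun i j x hx y hy => by
    rw [susMul_tmul]
    exact conc_mem (sus_mem (m := i - 1) (sig_mem hx) (by omega))
      (sus_mem (m := j - 1) hy (by omega)) (by omega)

theorem cobarD_homDeg : cobarD k C ∈ homDeg k (Shift 1 C) (Wd k (Shift 1 C)) (-1) := by
  intro n c hc
  have hc' : ofShift k 1 c ∈ gr k C (n + 1) := hc
  rw [← toShift_ofShift (k := k) 1 c, cobarD_apply]
  have h2 := susMul_homDeg _ _ (DGC.comul_deg _ _ hc')
  rw [show n + 1 + -2 = n + -1 by omega] at h2
  exact Submodule.sub_mem _ (Submodule.neg_mem _ (sus_mem (DGMod.d_deg _ _ hc') (by omega))) h2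

theorem cobar_d_d (c : Shift 1 C) : der (cobarD k C) (cobarD k C c) = 0 := by
  have hsig : ∀ c : C, sig (k := k) (sus k C c) = - sus k C (sig (k := k) c) := fun c => by
    rw [sus, LinearMap.comp_apply, sig_letter, sig_toShift (by decide), map_neg]; rfl
  have hder : ∀ c : C, der (cobarD k C) (sus k C c) =
      - sus k C (dd k C c) - susMul k C (Del k C c) := fun c => by
    rw [sus, LinearMap.comp_apply, der_letter, cobarD_apply]; rfl
  have h1 : ∀ t : C ⊗[k] C, der (cobarD k C) (susMul k C t) =
      susMul k C (TensorProduct.map (dd k C) LinearMap.id t + TensorProduct.map sig (dd k C) t) -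
      TensorProduct.lift ((conc k (Shift 1 C)).compl₁₂ (susMul k C) (sus k C))
        (TensorProduct.map (TensorProduct.map sig sig ∘ₗ Del k C) LinearMap.id t) +
      TensorProduct.lift ((conc k (Shift 1 C)).compl₁₂ (sus k C) (susMul k C))
        (TensorProduct.map LinearMap.id (Del k C) t) := by
    intro t
    induction t using TensorProduct.induction_on with
    | zero => simp
    | add x y hx hy => simp only [map_add, hx, hy]; abel
    | tmul x y =>
      have hk : Del k C (sig (k := k) x) = TensorProduct.map sig sig (Del k C x) := by
        have := comul_kap (k := k) 1 x
        rwa [kap_one] at this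
      rw [susMul_tmul, der_conc, hder, hder, hsig, sig_sig, hk, d_sig]
      simp [susMul_tmul, sig_sig]
      abel
  have h2 : ∀ t : (C ⊗[k] C) ⊗[k] C,
      TensorProduct.lift ((conc k (Shift 1 C)).compl₁₂ (susMul k C) (sus k C))
        (TensorProduct.map (TensorProduct.map sig sig) LinearMap.id t) =
      TensorProduct.lift ((conc k (Shift 1 C)).compl₁₂ (sus k C) (susMul k C))
        (TensorProduct.assoc k C C C t) := by
    intro t
    induction t using TensorProduct.induction_on with
    | zero => simp
    | add x y hx hy => simp only [map_add, hx, hy]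
    | tmul x z =>
      induction x using TensorProduct.induction_on with
      | zero => simp
      | add x y hx hy => simp only [map_add, TensorProduct.add_tmul, hx, hy]
      | tmul x y => simp [susMul_tmul, sig_sig, conc_assoc]
  rw [← toShift_ofShift (k := k) 1 c, cobarD_apply, map_sub, map_neg, hder, h1,
    ← DGC.coleibniz, ← DGC.coassoc, ← h2, TensorProduct.map_map, DGMod.d_d]
  simp

/-- The cobar construction `Ω C`: the free non-unital algebra on `(ΣC)_n = C_{n+1}` with
differential induced by `d + Δ`. -/
noncomputable def cobarObj (C : CoDGA k) : DGAlg k where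
  carrier := Wd k (Shift 1 C)
  alg := freeDGA (cobarD k C) cobarD_homDeg cobar_d_d

/-- The map `C → Ω C`, `c ↦ s c`, of degree `-1`. -/
noncomputable def cobarGen (C : CoDGA k) : C →ₗ[k] cobarObj C := sus k C

variable (k) in
/-- A linear map, regarded as a map between shifts. -/
def shiftMap {V W : Type u} [AddCommGroup V] [Module k V] [AddCommGroup W] [Module k W] (m : ℤ)
    (f : V →ₗ[k] W) : Shift m V →ₗ[k] Shift m W := toShift k m ∘ₗ f ∘ₗ ofShift k m

theorem shiftMap_homDeg {V W : Type u} [AddCommGroup V] [Module k V] [AddCommGroup W] [Module k W]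
    [GrMod k V] [GrMod k W] (m : ℤ) {f : V →ₗ[k] W} (hf : f ∈ homDeg k V W 0) :
    shiftMap k m f ∈ homDeg k (Shift m V) (Shift m W) 0 := fun n v hv =>
  toShift_mem (hf _ _ hv) (by omega)

variable (k) in
/-- The cobar construction as a functor. -/
noncomputable def cobar : CoDGA k ⥤ DGAlg k where
  obj := cobarObj
  map {C D} f :=
    { toLin := wmap k (shiftMap k 1 (CoDGA.Hom.toLin f))
      deg := fun n x hx => by
        have := wmap_homDeg (shiftMap_homDeg 1 (CoDGA.Hom.homDeg f)) n x hx
        rwa [add_zero] at this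
      comm_d := wmap_der (shiftMap_homDeg 1 (CoDGA.Hom.homDeg f)) _ _ fun c => by
        have hs : ∀ c : C, wmap k (shiftMap k 1 (CoDGA.Hom.toLin f)) (sus k C c) =
            sus k D (CoDGA.Hom.toLin f c) := fun c => wmap_letter _ _
        have hsm : ∀ t, wmap k (shiftMap k 1 (CoDGA.Hom.toLin f)) (susMul k C t) =
            susMul k D (TensorProduct.map (CoDGA.Hom.toLin f) (CoDGA.Hom.toLin f) t) := by
          intro t
          induction t using TensorProduct.induction_on with
          | zero => simp
          | add x y hx hy => simp only [map_add, hx, hy]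
          | tmul x y =>
            rw [susMul_tmul, wmap_conc, hs, hs, TensorProduct.map_tmul, susMul_tmul]
            congr 3
            exact degOp_comm (CoDGA.Hom.homDeg f) _ x
        rw [← toShift_ofShift (k := k) 1 c, cobarD_apply, map_sub, map_neg, hs, hsm]
        show _ = cobarD k D (toShift k 1 (CoDGA.Hom.toLin f (ofShift k 1 c)))
        rw [cobarD_apply, CoDGA.Hom.comm_d, CoDGA.Hom.map_comul]
      map_mul := wmap_conc _ }
  map_id C := by ext1; exact wmap_id
  map_comp f g := by ext1; exact wmap_comp (k := k) (shiftMap k 1 (CoDGA.Hom.toLin f)) (shiftMap k 1 (CoDGA.Hom.toLin g))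

end Cobar

/-! ### The bar construction -/

section Bar

variable {k : Type u} [Field k] {A : Type u} [AddCommGroup A] [Module k A] [DGA k A]

variable (k A) in
/-- `[a] ↦ -[d a]` -/
noncomputable def barD₁ : Shift (-1) A →ₗ[k] Shift (-1) A :=
  -(toShift k (-1) ∘ₗ dd k A ∘ₗ ofShift k (-1))

variable (k A) in
/-- `[a|a'] ↦ (-1)^{|a|} [a a']` -/
noncomputable def barB : Shift (-1) A →ₗ[k] Shift (-1) A →ₗ[k] Shift (-1) A :=
  (toShift k (-1)).compRight k ∘ₗ (mu k A).compl₁₂ (sig ∘ₗ ofShift k (-1)) (ofShift k (-1))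

theorem barD₁_apply (a : A) : barD₁ k A (toShift k (-1) a) = - toShift k (-1) (dd k A a) := rfl

theorem barB_apply (a b : A) : barB k A (toShift k (-1) a) (toShift k (-1) b) =
    toShift k (-1) (mu k A (sig (k := k) a) b) := rfl

theorem sig_mul (a b : A) : sig (k := k) (mu k A a b) = mu k A (sig (k := k) a) (sig (k := k) b) := by
  have := degOp_comm (mul_homDeg (k := k) (A := A)) (sgn k) (a ⊗ₜ b)
  change _ = sig _ at this
  change TensorProduct.lift (mu k A) (sig (k := k) (a ⊗ₜ[k] b)) = _ at this
  rw [sig_tmul] at this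
  exact this.symm

theorem barData : BarData (barD₁ k A) (barB k A) where
  d_deg n a ha := by
    have ha' : ofShift k (-1) a ∈ gr k A (n + -1) := ha
    exact Submodule.neg_mem _ (toShift_mem (DGMod.d_deg _ _ ha') (by omega))
  b_deg i j a ha b hb := by
    have ha' : ofShift k (-1) a ∈ gr k A (i + -1) := ha
    have hb' : ofShift k (-1) b ∈ gr k A (j + -1) := hb
    exact toShift_mem (DGA.mul_deg _ _ _ (sig_mem ha') _ hb') (by omega)
  d_d a := by
    rw [← toShift_ofShift (k := k) (-1) a, barD₁_apply, map_neg, barD₁_apply, DGMod.d_d]; simp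
  d_b a b := by
    rw [← toShift_ofShift (k := k) (-1) a, ← toShift_ofShift (k := k) (-1) b]
    generalize ofShift k (-1) a = a
    generalize ofShift k (-1) b = b
    rw [barB_apply, barD₁_apply, barD₁_apply, barD₁_apply, sig_toShift (by decide), map_neg,
      LinearMap.neg_apply, map_neg, map_neg, LinearMap.neg_apply, barB_apply, barB_apply, sig_sig,
      DGA.leibniz, d_sig, sig_sig]
    simp
  b_b a b c := by
    rw [← toShift_ofShift (k := k) (-1) a, ← toShift_ofShift (k := k) (-1) b,
      ← toShift_ofShift (k := k) (-1) c]
    generalize ofShift k (-1) a = a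
    generalize ofShift k (-1) b = b
    generalize ofShift k (-1) c = c
    rw [barB_apply, barB_apply, barB_apply, sig_toShift (by decide), map_neg,
      LinearMap.neg_apply, barB_apply, sig_mul, sig_sig, DGA.mul_assoc]
    simp

/-- The bar construction `B A`: the tensor coalgebra on `(Σ⁻¹A)_n = A_{n-1}` with differential
induced by `d + μ`. -/
noncomputable def barObj (A : DGAlg k) : CoDGA k where
  carrier := Wd k (Shift (-1) A)
  coalg := cofreeDGC (barData (k := k) (A := A))
  conil := cut_conil

/-- The projection `B A → A`, `[a] ↦ a`, of degree `-1`. -/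
noncomputable def barProj (A : DGAlg k) : barObj A →ₗ[k] A :=
  ofShift k (-1) ∘ₗ toLetter k (Shift (-1) A)

variable (k) in
/-- The bar construction as a functor. -/
noncomputable def bar : DGAlg k ⥤ CoDGA k where
  obj := barObj
  map {A B} f :=
    { toLin := wmap k (shiftMap k (-1) (DGAlg.Hom.toLin f))
      deg := fun n x hx => by
        have := wmap_homDeg (shiftMap_homDeg (-1) (DGAlg.Hom.homDeg f)) n x hx
        rwa [add_zero] at this
      comm_d := wmap_coder (shiftMap_homDeg (-1) (DGAlg.Hom.homDeg f)) _ _ _ _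
        (fun a => by
          rw [← toShift_ofShift (k := k) (-1) a, barD₁_apply, map_neg]
          show _ = barD₁ k B (toShift k (-1) (DGAlg.Hom.toLin f (ofShift k (-1) a)))
          rw [barD₁_apply, ← DGAlg.Hom.comm_d]; rfl)
        (fun a b => by
          show toShift k (-1) (DGAlg.Hom.toLin f (mu k A (sig (k := k) (ofShift k (-1) a))
            (ofShift k (-1) b))) = toShift k (-1) (mu k B (sig (k := k) (DGAlg.Hom.toLin f
              (ofShift k (-1) a))) (DGAlg.Hom.toLin f (ofShift k (-1) b)))
          rw [DGAlg.Hom.map_mul]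
          congr 3
          exact degOp_comm (DGAlg.Hom.homDeg f) _ _)
      map_comul := cut_wmap _ }
  map_id C := by ext1; exact wmap_id
  map_comp f g := by ext1; exact wmap_comp (k := k) (shiftMap k (-1) (DGAlg.Hom.toLin f)) (shiftMap k (-1) (DGAlg.Hom.toLin g))

end Bar

/-! ### The universal Maurer–Cartan algebra -/

section MC

variable (k : Type u) [Field k]

/-- The one-dimensional space `⟨x⟩` with `x` in degree `-1`. -/
def MCGen : Type u := k

instance : AddCommGroup (MCGen k) := inferInstanceAs (AddCommGroup k)
instance : Module k (MCGen k) := inferInstanceAs (Module k k)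

/-- The generator `x`. -/
def mcX : MCGen k := (1 : k)

noncomputable instance mcGrMod : GrMod k (MCGen k) where
  grade n := if n = -1 then ⊤ else ⊥
  internal := internal_of _ LinearMap.id Function.injective_id
    (fun n => if n = -1 then LinearMap.id else 0)
    (fun n v hv => by by_cases h : n = -1 <;> simp_all)
    (fun m n h v hv => by
      by_cases h1 : m = -1
      · have : n ≠ -1 := fun h2 => h (h1.trans h2.symm)
        simp_all
      · simp [h1])
    (top_le_iff.1 (le_trans (by simp) (le_iSup _ (-1 : ℤ))))

theorem mcX_mem : mcX k ∈ gr k (MCGen k) (-1) := by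
  show mcX k ∈ (if (-1 : ℤ) = -1 then (⊤ : Submodule k (MCGen k)) else ⊥)
  simp

/-- `x ↦ -x²` -/
noncomputable def mcD : MCGen k →ₗ[k] Wd k (MCGen k) :=
  LinearMap.toSpanSingleton k (Wd k (MCGen k))
    (-(conc k _ (letter k _ (mcX k)) (letter k _ (mcX k))))

theorem mcD_x : mcD k (mcX k) = -(conc k _ (letter k _ (mcX k)) (letter k _ (mcX k))) := by
  rw [mcD]; exact one_smul k _

theorem mc_span (v : MCGen k) : ∃ c : k, v = c • mcX k := ⟨v, (mul_one (M := k) v).symm⟩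

theorem mcD_homDeg : mcD k ∈ homDeg k (MCGen k) (Wd k (MCGen k)) (-1) := by
  intro n v hv
  by_cases h : n = -1
  · subst h
    obtain ⟨c, rfl⟩ := mc_span k v
    rw [map_smul, mcD_x]
    exact Submodule.smul_mem _ _ (Submodule.neg_mem _
      (conc_mem (letter_mem (mcX_mem k)) (letter_mem (mcX_mem k)) rfl))
  · have : v = 0 := by
      change v ∈ (if n = -1 then (⊤ : Submodule k (MCGen k)) else ⊥) at hv
      simpa [h] using hv
    simp [this]

theorem mc_d_d (v : MCGen k) : der (mcD k) (mcD k v) = 0 := by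
  obtain ⟨c, rfl⟩ := mc_span k v
  rw [map_smul, map_smul, mcD_x, map_neg, der_conc, der_letter, mcD_x, sig_letter,
    sig_of_mem (mcX_mem k), sgn_odd (by decide)]
  simp [conc_assoc]

/-- The universal Maurer–Cartan algebra: the free non-unital algebra on a generator `x` of
degree `-1` with differential determined by `d x = -x²`. -/
noncomputable def mc : DGAlg k where
  carrier := Wd k (MCGen k)
  alg := freeDGA (mcD k) (mcD_homDeg k) (mc_d_d k)

end MC

/-! ### The convolution algebra as a functor -/

section ConvFunctor

variable {k : Type u} [Field k]

section
variable {V W V' W' : Type u} [AddCommGroup V] [Module k V] [AddCommGroup W] [Module k W]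
  [AddCommGroup V'] [Module k V'] [AddCommGroup W'] [Module k W']

theorem degOp_comp_of [GrMod k V] [GrMod k W] {f : V →ₗ[k] W} (hf : f ∈ homDeg k V W 0)
    (c : ℤ → k) : f ∘ₗ degOp c = degOp c ∘ₗ f := LinearMap.ext fun v => degOp_comm hf c v

/-- `h ↦ f h g` on internal homs, for `f` and `g` of degree `0`. -/
noncomputable def iHomMap [GrMod k V] [GrMod k W] [GrMod k V'] [GrMod k W'] (f : W →ₗ[k] W')
    (g : V' →ₗ[k] V) (hf : f ∈ homDeg k W W' 0) (hg : g ∈ homDeg k V' V 0) :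
    IHom k V W →ₗ[k] IHom k V' W' :=
  ((LinearMap.llcomp k V' W W' f ∘ₗ LinearMap.lcomp k W g) ∘ₗ (iHomSub k V W).subtype).codRestrict
    (iHomSub k V' W') fun h => iHomSub_le_of (LinearMap.llcomp k V' W W' f ∘ₗ LinearMap.lcomp k W g)
      0 (fun _ _ hp => homDeg_comp hf (homDeg_comp hp hg (zero_add _)) rfl) h h.2

theorem coe_iHomMap [GrMod k V] [GrMod k W] [GrMod k V'] [GrMod k W'] (f : W →ₗ[k] W')
    (g : V' →ₗ[k] V) (hf : f ∈ homDeg k W W' 0) (hg : g ∈ homDeg k V' V 0) (h : IHom k V W) :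
    (iHomMap f g hf hg h : V' →ₗ[k] W') = f ∘ₗ (h : V →ₗ[k] W) ∘ₗ g := rfl

theorem iHomMap_mem [GrMod k V] [GrMod k W] [GrMod k V'] [GrMod k W'] (f : W →ₗ[k] W')
    (g : V' →ₗ[k] V) (hf : f ∈ homDeg k W W' 0) (hg : g ∈ homDeg k V' V 0) (n : ℤ)
    (h : IHom k V W) (hh : h ∈ gr k (IHom k V W) n) :
    iHomMap f g hf hg h ∈ gr k (IHom k V' W') n :=
  homDeg_comp hf (homDeg_comp (mem_gr_iHom.1 hh) hg (zero_add _)) (add_zero _)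

theorem iHomMap_d [DGMod k V] [DGMod k W] [DGMod k V'] [DGMod k W'] (f : W →ₗ[k] W')
    (g : V' →ₗ[k] V) (hf : f ∈ homDeg k W W' 0) (hg : g ∈ homDeg k V' V 0)
    (df : ∀ w, f (dd k W w) = dd k W' (f w)) (dg : ∀ v, g (dd k V' v) = dd k V (g v))
    (h : IHom k V W) : iHomMap f g hf hg (dd k (IHom k V W) h) =
      dd k (IHom k V' W') (iHomMap f g hf hg h) := by
  refine Subtype.ext (LinearMap.ext fun v => ?_)
  rw [coe_iHomMap, coe_d_iHom, coe_d_iHom, coe_iHomMap]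
  have h1 : ∀ v, g (sig (k := k) v) = sig (k := k) (g v) := fun v => degOp_comm hg _ v
  have h2 : ∀ v, f (sig (k := k) v) = sig (k := k) (f v) := fun v => degOp_comm hf _ v
  simp [dHom, df, dg, h1, h2]

end

/-- The convolution algebra `{C, A}`. -/
noncomputable def convObj (C : CoDGA k) (A : DGAlg k) : DGAlg k where
  carrier := IHom k C A

/-- The map `{f, g} : {D, A} → {C, B}`, `h ↦ g h f`. -/
noncomputable def convMap {C D : CoDGA k} {A B : DGAlg k} (f : C ⟶ D) (g : A ⟶ B) :
    convObj D A ⟶ convObj C B where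
  toLin := iHomMap (DGAlg.Hom.toLin g) (CoDGA.Hom.toLin f) (DGAlg.Hom.homDeg g)
    (CoDGA.Hom.homDeg f)
  deg := iHomMap_mem _ _ _ _
  comm_d := iHomMap_d _ _ _ _ (DGAlg.Hom.comm_d g) (CoDGA.Hom.comm_d f)
  map_mul h h' := by
    refine Subtype.ext (LinearMap.ext fun c => ?_)
    show DGAlg.Hom.toLin g (convMul k D A h.1 h'.1 (CoDGA.Hom.toLin f c)) =
      convMul k C B (DGAlg.Hom.toLin g ∘ₗ h.1 ∘ₗ CoDGA.Hom.toLin f)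
        (DGAlg.Hom.toLin g ∘ₗ h'.1 ∘ₗ CoDGA.Hom.toLin f) c
    simp only [convMul, LinearMap.mk₂_apply, LinearMap.comp_apply, CoDGA.Hom.map_comul]
    have h1 : ∀ c : ℤ → k, ∀ v, CoDGA.Hom.toLin f (degOp c v) = degOp c (CoDGA.Hom.toLin f v) :=
      fun c v => degOp_comm (CoDGA.Hom.homDeg f) c v
    have h2 : ∀ v, DGAlg.Hom.toLin g (sig (k := k) v) = sig (k := k) (DGAlg.Hom.toLin g v) :=
      fun v => degOp_comm (DGAlg.Hom.homDeg g) _ v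
    induction Del k C c using TensorProduct.induction_on with
    | zero => simp
    | add x y hx hy => simp only [map_add, hx, hy]
    | tmul x y =>
      simp only [TensorProduct.map_tmul, LinearMap.add_apply, LinearMap.comp_apply, map_add,
        TensorProduct.lift.tmul, DGAlg.Hom.map_mul, h2, ev, od, h1]
      simp only [sig, h1]

variable (k) in
/-- The functor `(C, A) ↦ {C, A}`. -/
noncomputable def conv : (CoDGA k)ᵒᵖ ⥤ DGAlg k ⥤ DGAlg k where
  obj C :=
    { obj := fun A => convObj C.unop A
      map := fun g => convMap (𝟙 C.unop) g
      map_id := fun _ => rfl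
      map_comp := fun _ _ => rfl }
  map f := { app := fun A => convMap f.unop (𝟙 A), naturality := fun _ _ _ => rfl }
  map_id _ := rfl
  map_comp _ _ := rfl

end ConvFunctor

/-! ### The tensor product of coalgebras -/

section TensorCoalg

variable {k : Type u} [Field k]

section Complex
variable {V W V' W' : Type u} [AddCommGroup V] [Module k V] [AddCommGroup W] [Module k W]
  [AddCommGroup V'] [Module k V'] [AddCommGroup W'] [Module k W']

/-- The tensor product of dg vector spaces, `d (v ⊗ w) = d v ⊗ w + (-1)^{|v|} v ⊗ d w`. -/
noncomputable instance tensorDGMod [DGMod k V] [DGMod k W] : DGMod k (V ⊗[k] W) where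
  toGrMod := tensorGrMod
  d := TensorProduct.map (dd k V) LinearMap.id + TensorProduct.map sig (dd k W)
  d_deg := tensor_homDeg (p := -1) fun i j v hv w hw => by
    simp only [LinearMap.add_apply, TensorProduct.map_tmul, LinearMap.id_apply]
    exact Submodule.add_mem _ (tmul_mem_gr (DGMod.d_deg i v hv) hw (by omega))
      (tmul_mem_gr (sig_mem hv) (DGMod.d_deg j w hw) (by omega))
  d_d t := by
    induction t using TensorProduct.induction_on with
    | zero => simp
    | add x y hx hy => simp only [map_add, hx, hy, add_zero]
    | tmul v w => simp [DGMod.d_d, d_sig, TensorProduct.neg_tmul]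

theorem d_tmul [DGMod k V] [DGMod k W] (v : V) (w : W) : dd k (V ⊗[k] W) (v ⊗ₜ w) =
    dd k V v ⊗ₜ w + sig (k := k) v ⊗ₜ dd k W w := rfl

theorem d_map [DGMod k V] [DGMod k W] [DGMod k V'] [DGMod k W'] {f : V →ₗ[k] V'} {g : W →ₗ[k] W'}
    (hf : f ∈ homDeg k V V' 0) (df : ∀ v, f (dd k V v) = dd k V' (f v))
    (dg : ∀ w, g (dd k W w) = dd k W' (g w)) (t : V ⊗[k] W) :
    TensorProduct.map f g (dd k (V ⊗[k] W) t) =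
      dd k (V' ⊗[k] W') (TensorProduct.map f g t) := by
  induction t using TensorProduct.induction_on with
  | zero => simp
  | add x y hx hy => simp only [map_add, hx, hy]
  | tmul v w =>
    have h : f (sig (k := k) v) = sig (k := k) (f v) := degOp_comm hf _ v
    simp [d_tmul, df, dg, h]

end Complex

section Shuffle
variable {V W V' W' V₁ W₁ V₁' W₁' : Type u} [AddCommGroup V] [Module k V] [AddCommGroup W]
  [Module k W] [AddCommGroup V'] [Module k V'] [AddCommGroup W'] [Module k W']
  [AddCommGroup V₁] [Module k V₁] [AddCommGroup W₁]
  [Module k W₁] [AddCommGroup V₁'] [Module k V₁'] [AddCommGroup W₁'] [Module k W₁']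

variable (k V W V' W') in
/-- The interchange map `(v ⊗ w) ⊗ (v' ⊗ w') ↦ (-1)^{|w||v'|} (v ⊗ v') ⊗ (w ⊗ w')`. -/
noncomputable def shuf [GrMod k W] [GrMod k V'] :
    (V ⊗[k] W) ⊗[k] (V' ⊗[k] W') →ₗ[k] (V ⊗[k] V') ⊗[k] (W ⊗[k] W') :=
  (TensorProduct.tensorTensorTensorComm k V W V' W').toLinearMap ∘ₗ
    (TensorProduct.map (TensorProduct.map LinearMap.id ev) LinearMap.id +
      TensorProduct.map (TensorProduct.map LinearMap.id od) (TensorProduct.map sig LinearMap.id))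

theorem shuf_tmul [GrMod k W] [GrMod k V'] (v : V) (w : W) (v' : V') (w' : W') :
    shuf k V W V' W' ((v ⊗ₜ w) ⊗ₜ (v' ⊗ₜ w')) =
      (v ⊗ₜ v') ⊗ₜ (ev (k := k) w ⊗ₜ w') + (v ⊗ₜ sig (k := k) v') ⊗ₜ (od (k := k) w ⊗ₜ w') := by
  simp [shuf]

theorem shuf_of_mem [GrMod k W] [GrMod k V'] {i j : ℤ} (v : V) {w : W} {v' : V'} (w' : W')
    (hw : w ∈ gr k W i) (hv' : v' ∈ gr k V' j) :
    shuf k V W V' W' ((v ⊗ₜ w) ⊗ₜ (v' ⊗ₜ w')) =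
      sgn k (i * j) • ((v ⊗ₜ v') ⊗ₜ (w ⊗ₜ w')) := by
  rw [shuf_tmul]
  by_cases hi : Even i
  · simp [ev_of_mem hw, od_of_mem hw, hi, sgn_even (hi.mul_right j)]
  · have : sgn k (i * j) = sgn k j := by
      by_cases hj : Even j
      · rw [sgn_even hj, sgn_even (hj.mul_left i)]
      · rw [sgn_odd hj, sgn_odd]; rw [Int.even_mul]; tauto
    simp [ev_of_mem hw, od_of_mem hw, hi, sig_of_mem hv', this, TensorProduct.smul_tmul']

theorem shuf_map [GrMod k W] [GrMod k V'] [GrMod k W₁] [GrMod k V₁'] (f : V →ₗ[k] V₁)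
    {g : W →ₗ[k] W₁} {f' : V' →ₗ[k] V₁'} (g' : W' →ₗ[k] W₁') (hg : g ∈ homDeg k W W₁ 0)
    (hf' : f' ∈ homDeg k V' V₁' 0) (t : (V ⊗[k] W) ⊗[k] (V' ⊗[k] W')) :
    shuf k V₁ W₁ V₁' W₁'
        (TensorProduct.map (TensorProduct.map f g) (TensorProduct.map f' g') t) =
      TensorProduct.map (TensorProduct.map f f') (TensorProduct.map g g')
        (shuf k V W V' W' t) := by
  have h1 : ∀ c : ℤ → k, ∀ x, g (degOp c x) = degOp c (g x) := degOp_comm hg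
  have h2 : ∀ c : ℤ → k, ∀ x, f' (degOp c x) = degOp c (f' x) := degOp_comm hf'
  have : shuf k V₁ W₁ V₁' W₁' ∘ₗ
      (TensorProduct.map (TensorProduct.map f g) (TensorProduct.map f' g')) =
      TensorProduct.map (TensorProduct.map f f') (TensorProduct.map g g') ∘ₗ
        (shuf k V W V' W') := by
    apply TensorProduct.ext_fourfold'
    intro v w v' w'
    simp only [LinearMap.comp_apply, TensorProduct.map_tmul, shuf_tmul, map_add, ev, od, sig, h1,
      h2]
  exact LinearMap.congr_fun this t

theorem ext_four [GrMod k V] [GrMod k W] [GrMod k V'] [GrMod k W'] {M : Type u} [AddCommGroup M]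
    [Module k M] {f g : (V ⊗[k] W) ⊗[k] (V' ⊗[k] W') →ₗ[k] M}
    (h : ∀ i j i' j', ∀ v ∈ gr k V i, ∀ w ∈ gr k W j, ∀ v' ∈ gr k V' i', ∀ w' ∈ gr k W' j',
      f ((v ⊗ₜ w) ⊗ₜ (v' ⊗ₜ w')) = g ((v ⊗ₜ w) ⊗ₜ (v' ⊗ₜ w'))) : f = g := by
  apply TensorProduct.ext
  apply ext_gr₂
  intro i j v hv w hw
  apply ext_gr₂
  intro i' j' v' hv' w' hw'
  exact h i j i' j' v hv w hw v' hv' w' hw'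

theorem shuf_homDeg [GrMod k V] [GrMod k W] [GrMod k V'] [GrMod k W'] :
    shuf k V W V' W' ∈
      homDeg k ((V ⊗[k] W) ⊗[k] (V' ⊗[k] W')) ((V ⊗[k] V') ⊗[k] (W ⊗[k] W')) 0 :=
  tensor_homDeg fun i j t ht t' ht' => by
    refine tensor_gr_le ((shuf k V W V' W').comp ((TensorProduct.mk k _ _).flip t')) _ i
      (fun a b hab v hv w hw => ?_) t ht
    refine tensor_gr_le ((shuf k V W V' W').comp (TensorProduct.mk k _ _ (v ⊗ₜ w))) _ j
      (fun a' b' hab' v' hv' w' hw' => ?_) t' ht'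
    simp only [LinearMap.comp_apply, TensorProduct.mk_apply]
    rw [shuf_of_mem v w' hw hv']
    exact Submodule.smul_mem _ _ (tmul_mem_gr (tmul_mem_gr hv hv' rfl) (tmul_mem_gr hw hw' rfl)
      (by omega))

theorem shuf_d [DGMod k V] [DGMod k W] [DGMod k V'] [DGMod k W']
    (t : (V ⊗[k] W) ⊗[k] (V' ⊗[k] W')) :
    shuf k V W V' W' (dd k _ t) = dd k _ (shuf k V W V' W' t) := by
  have : shuf k V W V' W' ∘ₗ dd k _ = dd k _ ∘ₗ shuf k V W V' W' := by
    apply ext_four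
    intro i j i' j' v hv w hw v' hv' w' hw'
    have e1 : sgn k ((j + -1) * i') = sgn k (j * i') * sgn k i' := by
      rw [add_mul, sgn_add, neg_one_mul, sgn_neg]
    have e2 : sgn k (j * (i' + -1)) = sgn k (j * i') * sgn k j := by
      rw [mul_add, sgn_add, mul_neg_one, sgn_neg]
    have dw : dd k W w ∈ gr k W (j + -1) := DGMod.d_deg (k := k) j w hw
    have dv' : dd k V' v' ∈ gr k V' (i' + -1) := DGMod.d_deg (k := k) i' v' hv'
    simp only [LinearMap.comp_apply, d_tmul, shuf_of_mem v w' hw hv', sig_tmul, map_add, map_smul,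
      TensorProduct.add_tmul, TensorProduct.tmul_add, sig_of_mem hv, sig_of_mem hw, sig_of_mem hv',
      ← TensorProduct.smul_tmul', TensorProduct.tmul_smul, shuf_of_mem _ w' hw hv',
      shuf_of_mem _ w' dw hv', shuf_of_mem _ w' hw dv', shuf_of_mem _ (dd k W' w') hw hv', e1, e2,
      smul_smul, smul_add]
    have q := sgn_mul_self (k := k) j
    rw [add_add_add_comm]
    congr 1
    · congr 1
      congr 1
      linear_combination (sgn k i * sgn k (j * i')) * q
    · congr 1
      · congr 1
        ring
      · congr 1
        ring
  exact LinearMap.congr_fun this t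

theorem ext_gr₃ {U M : Type u} [AddCommGroup U] [Module k U] [AddCommGroup M] [Module k M]
    [GrMod k V] [GrMod k W] [GrMod k U] {f g : (V ⊗[k] W) ⊗[k] U →ₗ[k] M}
    (h : ∀ i j l, ∀ v ∈ gr k V i, ∀ w ∈ gr k W j, ∀ u ∈ gr k U l,
      f ((v ⊗ₜ w) ⊗ₜ u) = g ((v ⊗ₜ w) ⊗ₜ u)) : f = g := by
  apply TensorProduct.ext
  apply ext_gr₂
  intro i j v hv w hw
  apply ext_gr
  intro l u hu
  exact h i j l v hv w hw u hu

theorem ext_gr₃₃ {U U' M : Type u} [AddCommGroup U] [Module k U] [AddCommGroup U'] [Module k U']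
    [AddCommGroup M] [Module k M] [GrMod k V] [GrMod k W] [GrMod k U] [GrMod k V'] [GrMod k W']
    [GrMod k U'] {f g : ((V ⊗[k] W) ⊗[k] U) ⊗[k] ((V' ⊗[k] W') ⊗[k] U') →ₗ[k] M}
    (h : ∀ i j l, ∀ v ∈ gr k V i, ∀ w ∈ gr k W j, ∀ u ∈ gr k U l,
      ∀ i' j' l', ∀ v' ∈ gr k V' i', ∀ w' ∈ gr k W' j', ∀ u' ∈ gr k U' l',
      f (((v ⊗ₜ w) ⊗ₜ u) ⊗ₜ ((v' ⊗ₜ w') ⊗ₜ u')) = g (((v ⊗ₜ w) ⊗ₜ u) ⊗ₜ ((v' ⊗ₜ w') ⊗ₜ u'))) :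
    f = g := by
  refine TensorProduct.ext' fun x y => ?_
  refine LinearMap.congr_fun (ext_gr₃ (f := f ∘ₗ (TensorProduct.mk k _ _).flip y)
    (g := g ∘ₗ (TensorProduct.mk k _ _).flip y) ?_) x
  intro i j l v hv w hw u hu
  refine LinearMap.congr_fun (ext_gr₃ (f := f ∘ₗ TensorProduct.mk k _ _ ((v ⊗ₜ w) ⊗ₜ u))
    (g := g ∘ₗ TensorProduct.mk k _ _ ((v ⊗ₜ w) ⊗ₜ u)) ?_) y
  intro i' j' l' v' hv' w' hw' u' hu'
  exact h i j l v hv w hw u hu i' j' l' v' hv' w' hw' u' hu'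

theorem ext_gr₄₂ {U U' M : Type u} [AddCommGroup U] [Module k U] [AddCommGroup U'] [Module k U']
    [AddCommGroup M] [Module k M] [GrMod k V] [GrMod k W] [GrMod k U] [GrMod k V'] [GrMod k W']
    [GrMod k U'] {f g : ((V ⊗[k] V') ⊗[k] (W ⊗[k] W')) ⊗[k] (U ⊗[k] U') →ₗ[k] M}
    (h : ∀ i i' j j', ∀ v ∈ gr k V i, ∀ v' ∈ gr k V' i', ∀ w ∈ gr k W j, ∀ w' ∈ gr k W' j',
      ∀ l l', ∀ u ∈ gr k U l, ∀ u' ∈ gr k U' l',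
      f (((v ⊗ₜ v') ⊗ₜ (w ⊗ₜ w')) ⊗ₜ (u ⊗ₜ u')) = g (((v ⊗ₜ v') ⊗ₜ (w ⊗ₜ w')) ⊗ₜ (u ⊗ₜ u'))) :
    f = g := by
  refine TensorProduct.ext' fun x y => ?_
  refine LinearMap.congr_fun (ext_four (f := f ∘ₗ (TensorProduct.mk k _ _).flip y)
    (g := g ∘ₗ (TensorProduct.mk k _ _).flip y) ?_) x
  intro i i' j j' v hv v' hv' w hw w' hw'
  refine LinearMap.congr_fun (ext_gr₂ (f := f ∘ₗ TensorProduct.mk k _ _ ((v ⊗ₜ v') ⊗ₜ (w ⊗ₜ w')))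
    (g := g ∘ₗ TensorProduct.mk k _ _ ((v ⊗ₜ v') ⊗ₜ (w ⊗ₜ w'))) ?_) y
  intro l l' u hu u' hu'
  exact h i i' j j' v hv v' hv' w hw w' hw' l l' u hu u' hu'

theorem shuf_hexagon {U U' : Type u} [AddCommGroup U] [Module k U] [AddCommGroup U'] [Module k U']
    [GrMod k V] [GrMod k W] [GrMod k U] [GrMod k V'] [GrMod k W'] [GrMod k U']
    (t : ((V ⊗[k] W) ⊗[k] U) ⊗[k] ((V' ⊗[k] W') ⊗[k] U')) :
    TensorProduct.assoc k _ _ _ (TensorProduct.map (shuf k V W V' W') LinearMap.id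
      (shuf k (V ⊗[k] W) U (V' ⊗[k] W') U' t)) =
    TensorProduct.map LinearMap.id (shuf k W U W' U') (shuf k V (W ⊗[k] U) V' (W' ⊗[k] U')
      (TensorProduct.map (TensorProduct.assoc k V W U).toLinearMap
        (TensorProduct.assoc k V' W' U').toLinearMap t)) := by
  have : (TensorProduct.assoc k _ _ _).toLinearMap ∘ₗ TensorProduct.map (shuf k V W V' W')
      LinearMap.id ∘ₗ (shuf k (V ⊗[k] W) U (V' ⊗[k] W') U') =
    TensorProduct.map LinearMap.id (shuf k W U W' U') ∘ₗ shuf k V (W ⊗[k] U) V' (W' ⊗[k] U') ∘ₗ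
      TensorProduct.map (TensorProduct.assoc k V W U).toLinearMap
        (TensorProduct.assoc k V' W' U').toLinearMap := by
    apply ext_gr₃₃
    intro i j l v hv w hw u hu
    intro i' j' l' v' hv' w' hw' u' hu'
    have hwu : w ⊗ₜ[k] u ∈ gr k (W ⊗[k] U) (j + l) := tmul_mem_gr hw hu rfl
    have hvw' : v' ⊗ₜ[k] w' ∈ gr k (V' ⊗[k] W') (i' + j') := tmul_mem_gr hv' hw' rfl
    simp only [ LinearMap.comp_apply,
      LinearEquiv.coe_coe, TensorProduct.map_tmul, TensorProduct.assoc_tmul, map_smul,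
      shuf_of_mem _ _ hu hvw', shuf_of_mem _ _ hw hv', shuf_of_mem _ _ hwu hv',
      shuf_of_mem _ _ hu hw', LinearMap.id_apply, TensorProduct.tmul_smul,
      ← TensorProduct.smul_tmul', smul_smul, ← sgn_add]
    congr 2
    ring
  exact LinearMap.congr_fun this t

theorem shuf_assoc {U U' : Type u} [AddCommGroup U] [Module k U] [AddCommGroup U'] [Module k U']
    [GrMod k V] [GrMod k W] [GrMod k U] [GrMod k V'] [GrMod k W'] [GrMod k U']
    (t : ((V ⊗[k] V') ⊗[k] (W ⊗[k] W')) ⊗[k] (U ⊗[k] U')) :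
    TensorProduct.map (TensorProduct.assoc k V W U).toLinearMap
        (TensorProduct.assoc k V' W' U').toLinearMap (shuf k (V ⊗[k] W) (V' ⊗[k] W') U U'
        (TensorProduct.map (shuf k V V' W W') LinearMap.id t)) =
    shuf k V V' (W ⊗[k] U) (W' ⊗[k] U') (TensorProduct.map LinearMap.id (shuf k W W' U U')
      (TensorProduct.assoc k _ _ _ t)) := by
  have : TensorProduct.map (TensorProduct.assoc k V W U).toLinearMap
        (TensorProduct.assoc k V' W' U').toLinearMap ∘ₗ shuf k (V ⊗[k] W) (V' ⊗[k] W') U U' ∘ₗ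
        TensorProduct.map (shuf k V V' W W') LinearMap.id =
      shuf k V V' (W ⊗[k] U) (W' ⊗[k] U') ∘ₗ TensorProduct.map LinearMap.id (shuf k W W' U U') ∘ₗ
      (TensorProduct.assoc k _ _ _).toLinearMap := by
    apply ext_gr₄₂
    intro i i' j j' v hv v' hv' w hw w' hw'
    intro l l' u hu u' hu'
    have hwu : w ⊗ₜ[k] u ∈ gr k (W ⊗[k] U) (j + l) := tmul_mem_gr hw hu rfl
    have hvw' : v' ⊗ₜ[k] w' ∈ gr k (V' ⊗[k] W') (i' + j') := tmul_mem_gr hv' hw' rfl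
    simp only [ LinearMap.comp_apply,
      LinearEquiv.coe_coe, TensorProduct.map_tmul, TensorProduct.assoc_tmul, map_smul,
      shuf_of_mem _ _ hv' hw, shuf_of_mem _ _ hvw' hu, shuf_of_mem _ _ hw' hu,
      shuf_of_mem _ _ hv' hwu, LinearMap.id_apply, TensorProduct.tmul_smul,
      ← TensorProduct.smul_tmul', smul_smul, ← sgn_add]
    congr 2
    ring
  exact LinearMap.congr_fun this t

end Shuffle

section Coalg
variable {C D E : Type u} [AddCommGroup C] [Module k C] [AddCommGroup D] [Module k D]
  [AddCommGroup E] [Module k E]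

theorem id_homDeg [GrMod k C] : (LinearMap.id : C →ₗ[k] C) ∈ homDeg k C C 0 :=
  fun n x hx => by rwa [add_zero]

theorem d_Del [DGC k C] (c : C) : Del k C (dd k C c) = dd k (C ⊗[k] C) (Del k C c) :=
  DGC.coleibniz c

theorem iterDel_tensor [GrMod k C] [GrMod k D] (Δ : C →ₗ[k] C ⊗[k] C) (Δ' : D →ₗ[k] D ⊗[k] D)
    (n : ℕ) : ∃ Φ : TPow k C n ⊗[k] D →ₗ[k] TPow k (C ⊗[k] D) n, ∀ t,
      iterDel k (C ⊗[k] D) (shuf k C C D D ∘ₗ TensorProduct.map Δ Δ') n t =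
        Φ (TensorProduct.map (iterDel k C Δ n) LinearMap.id t) := by
  induction n with
  | zero =>
    refine ⟨LinearMap.id, fun t => ?_⟩
    show t = TensorProduct.map (LinearMap.id : C →ₗ[k] C) (LinearMap.id : D →ₗ[k] D) t
    rw [TensorProduct.map_id]; rfl
  | succ n ih =>
    obtain ⟨Φ, h⟩ := ih
    refine ⟨TensorProduct.map Φ LinearMap.id ∘ₗ shuf k (TPow k C n) C D D ∘ₗ
      TensorProduct.map LinearMap.id Δ', fun t => ?_⟩
    have h' : iterDel k (C ⊗[k] D) (shuf k C C D D ∘ₗ TensorProduct.map Δ Δ') n =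
        Φ ∘ₗ TensorProduct.map (iterDel k C Δ n) LinearMap.id := LinearMap.ext h
    show TensorProduct.map (iterDel k (C ⊗[k] D) _ n) LinearMap.id (shuf k C C D D
      (TensorProduct.map Δ Δ' t)) = TensorProduct.map Φ LinearMap.id (shuf k (TPow k C n) C D D
        (TensorProduct.map LinearMap.id Δ' (TensorProduct.map
          (TensorProduct.map (iterDel k C Δ n) LinearMap.id ∘ₗ Δ) LinearMap.id t)))
    have e : TensorProduct.map LinearMap.id Δ' (TensorProduct.map
          (TensorProduct.map (iterDel k C Δ n) LinearMap.id ∘ₗ Δ) LinearMap.id t) =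
        TensorProduct.map (TensorProduct.map (iterDel k C Δ n) LinearMap.id)
          (TensorProduct.map LinearMap.id LinearMap.id) (TensorProduct.map Δ Δ' t) := by
      rw [TensorProduct.map_map, TensorProduct.map_map]; simp
    rw [e, shuf_map _ _ id_homDeg id_homDeg, TensorProduct.map_map, h']
    simp

theorem iterDel_succ (Δ : C →ₗ[k] C ⊗[k] C) (n : ℕ) :
    ∃ Ψ : TPow k C n →ₗ[k] TPow k C (n + 1), iterDel k C Δ (n + 1) = Ψ ∘ₗ iterDel k C Δ n := by
  induction n with
  | zero =>
    refine ⟨Δ, ?_⟩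
    show TensorProduct.map (LinearMap.id : C →ₗ[k] C) LinearMap.id ∘ₗ Δ = Δ
    rw [TensorProduct.map_id]; rfl
  | succ n ih =>
    obtain ⟨Ψ, h⟩ := ih
    refine ⟨TensorProduct.map Ψ LinearMap.id, ?_⟩
    show TensorProduct.map (iterDel k C Δ (n + 1)) LinearMap.id ∘ₗ Δ =
      TensorProduct.map Ψ LinearMap.id ∘ₗ TensorProduct.map (iterDel k C Δ n) LinearMap.id ∘ₗ Δ
    rw [← LinearMap.comp_assoc, ← TensorProduct.map_comp, h, LinearMap.id_comp]

theorem iterDel_le (Δ : C →ₗ[k] C ⊗[k] C) {m n : ℕ} (h : m ≤ n) {c : C}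
    (hc : iterDel k C Δ m c = 0) : iterDel k C Δ n c = 0 := by
  induction n, h using Nat.le_induction with
  | base => exact hc
  | succ n _ ih =>
    obtain ⟨Ψ, e⟩ := iterDel_succ (k := k) Δ n
    rw [e, LinearMap.comp_apply, ih, map_zero]

theorem tensor_coassoc [DGC k C] [DGC k D] (t : C ⊗[k] D) :
    TensorProduct.assoc k _ _ _ (TensorProduct.map
      (shuf k C C D D ∘ₗ TensorProduct.map (Del k C) (Del k D)) LinearMap.id
        (shuf k C C D D (TensorProduct.map (Del k C) (Del k D) t))) =
    TensorProduct.map LinearMap.id (shuf k C C D D ∘ₗ TensorProduct.map (Del k C) (Del k D))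
        (shuf k C C D D (TensorProduct.map (Del k C) (Del k D) t)) := by
  have e1 : ∀ x : (C ⊗[k] D) ⊗[k] (C ⊗[k] D),
      TensorProduct.map (shuf k C C D D ∘ₗ TensorProduct.map (Del k C) (Del k D))
        LinearMap.id x = TensorProduct.map (shuf k C C D D) LinearMap.id
        (TensorProduct.map (TensorProduct.map (Del k C) (Del k D))
          (TensorProduct.map LinearMap.id LinearMap.id) x) := fun x => by
    rw [TensorProduct.map_map, TensorProduct.map_id, LinearMap.id_comp]
  have e2 : ∀ x : (C ⊗[k] D) ⊗[k] (C ⊗[k] D), TensorProduct.map LinearMap.id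
        (shuf k C C D D ∘ₗ TensorProduct.map (Del k C) (Del k D)) x =
        TensorProduct.map LinearMap.id (shuf k C C D D)
        (TensorProduct.map (TensorProduct.map LinearMap.id LinearMap.id)
          (TensorProduct.map (Del k C) (Del k D)) x) := fun x => by
    rw [TensorProduct.map_map, TensorProduct.map_id, LinearMap.id_comp]
  have e3 : ∀ (X : Type u) [AddCommGroup X] [Module k X] [DGC k X],
      (TensorProduct.assoc k X X X).toLinearMap ∘ₗ
          TensorProduct.map (Del k X) LinearMap.id ∘ₗ Del k X =
        TensorProduct.map LinearMap.id (Del k X) ∘ₗ Del k X := fun X _ _ _ =>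
      LinearMap.ext fun x => DGC.coassoc x
  rw [e1, e2, ← shuf_map _ _ id_homDeg comul_homDeg, ← shuf_map _ _ comul_homDeg id_homDeg,
    shuf_hexagon, TensorProduct.map_map, TensorProduct.map_map, TensorProduct.map_map, LinearMap.comp_assoc,
    LinearMap.comp_assoc, e3, e3]

/-- The tensor product of dg coalgebras,
`Δ (c ⊗ d) = Σ (-1)^{|c''||d'|} (c' ⊗ d') ⊗ (c'' ⊗ d'')`. -/
noncomputable instance tensorDGC [DGC k C] [DGC k D] : DGC k (C ⊗[k] D) where
  toDGMod := tensorDGMod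
  comul := shuf k C C D D ∘ₗ TensorProduct.map (Del k C) (Del k D)
  comul_deg n t ht := by
    have := shuf_homDeg _ _ (map_homDeg comul_homDeg comul_homDeg (add_zero 0) n t ht)
    rwa [add_zero, add_zero] at this
  coleibniz t := by
    show shuf k C C D D (TensorProduct.map (Del k C) (Del k D) (dd k (C ⊗[k] D) t)) =
      dd k _ (shuf k C C D D (TensorProduct.map (Del k C) (Del k D) t))
    rw [d_map (f := Del k C) (g := Del k D) comul_homDeg d_Del d_Del, shuf_d]
  coassoc := tensor_coassoc

theorem tensor_conil [DGC k C] [DGC k D] (hC : Conil k C) : Conil k (C ⊗[k] D) := by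
  intro t
  induction t using TensorProduct.induction_on with
  | zero => exact ⟨0, map_zero _⟩
  | add x y hx hy =>
    obtain ⟨m, hm⟩ := hx
    obtain ⟨n, hn⟩ := hy
    exact ⟨max m n, by
      rw [map_add, iterDel_le _ (le_max_left m n) hm, iterDel_le _ (le_max_right m n) hn,
        add_zero]⟩
  | tmul c d =>
    obtain ⟨n, hn⟩ := hC c
    obtain ⟨Φ, h⟩ := iterDel_tensor (Del k C) (Del k D) n
    refine ⟨n, (h _).trans ?_⟩
    rw [TensorProduct.map_tmul, hn]; simp

end Coalg


end TensorCoalg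

/-! ### Semi-monoidal categories and their modules -/

section SemiModules

universe v₁ v₂ v₃ v₄ u₁ u₂ u₃ u₄

/-- The action `f ⊗ g` of a functor of two variables on a pair of morphisms. -/
abbrev bimap {𝒳 : Type u₁} [Category.{v₁} 𝒳] {𝒴 : Type u₂} [Category.{v₂} 𝒴] {𝒵 : Type u₃}
    [Category.{v₃} 𝒵] (T : 𝒳 ⥤ 𝒴 ⥤ 𝒵) {X X' : 𝒳} {Y Y' : 𝒴} (f : X ⟶ X') (g : Y ⟶ Y') :
    (T.obj X).obj Y ⟶ (T.obj X').obj Y' :=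
  (T.map f).app Y ≫ (T.obj X').map g

/-- A semi-monoidal category: a monoidal category without unit. -/
structure SemiMonoidal (𝒱 : Type u₁) [Category.{v₁} 𝒱] where
  tensor : 𝒱 ⥤ 𝒱 ⥤ 𝒱
  a : ∀ X Y Z : 𝒱, (tensor.obj ((tensor.obj X).obj Y)).obj Z ≅
    (tensor.obj X).obj ((tensor.obj Y).obj Z)
  a_naturality : ∀ {X X' Y Y' Z Z' : 𝒱} (f : X ⟶ X') (g : Y ⟶ Y') (h : Z ⟶ Z'),
    bimap tensor (bimap tensor f g) h ≫ (a X' Y' Z').hom =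
      (a X Y Z).hom ≫ bimap tensor f (bimap tensor g h)
  pentagon : ∀ X Y Z W : 𝒱,
    bimap tensor (a X Y Z).hom (𝟙 W) ≫ (a X ((tensor.obj Y).obj Z) W).hom ≫
        bimap tensor (𝟙 X) (a Y Z W).hom =
      (a ((tensor.obj X).obj Y) Z W).hom ≫ (a X Y ((tensor.obj Z).obj W)).hom

/-- A module category over a semi-monoidal category, with action functor `act`: the associativity
isomorphism `(X ⊗ Y) ▷ A ≅ X ▷ (Y ▷ A)`, natural and coherent. -/
structure SemiModule {𝒱 : Type u₁} [Category.{v₁} 𝒱] (S : SemiMonoidal 𝒱) {𝒞 : Type u₂}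
    [Category.{v₂} 𝒞] (act : 𝒱 ⥤ 𝒞 ⥤ 𝒞) where
  α : ∀ (X Y : 𝒱) (A : 𝒞), (act.obj ((S.tensor.obj X).obj Y)).obj A ≅
    (act.obj X).obj ((act.obj Y).obj A)
  α_naturality : ∀ {X X' Y Y' : 𝒱} {A A' : 𝒞} (f : X ⟶ X') (g : Y ⟶ Y') (h : A ⟶ A'),
    bimap act (bimap S.tensor f g) h ≫ (α X' Y' A').hom =
      (α X Y A).hom ≫ bimap act f (bimap act g h)
  coherence : ∀ (X Y Z : 𝒱) (A : 𝒞),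
    bimap act (S.a X Y Z).hom (𝟙 A) ≫ (α X ((S.tensor.obj Y).obj Z) A).hom ≫
        bimap act (𝟙 X) (α Y Z A).hom =
      (α ((S.tensor.obj X).obj Y) Z A).hom ≫ (α X Y ((act.obj Z).obj A)).hom

/-- A semi-monoidal category as a module over itself. -/
def SemiMonoidal.self {𝒱 : Type u₁} [Category.{v₁} 𝒱] (S : SemiMonoidal 𝒱) :
    SemiModule S S.tensor where
  α := S.a
  α_naturality := S.a_naturality
  coherence := S.pentagon

/-- The structure of a (strong) module functor on a functor between module categories: a coherent
natural isomorphism `X ▷ F A ≅ F (X ▷ A)`. -/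
structure ModuleFunctor {𝒱 : Type u₁} [Category.{v₁} 𝒱] {S : SemiMonoidal 𝒱} {𝒞 : Type u₂}
    [Category.{v₂} 𝒞] {act : 𝒱 ⥤ 𝒞 ⥤ 𝒞} (M : SemiModule S act) {𝒟 : Type u₃} [Category.{v₃} 𝒟]
    {act' : 𝒱 ⥤ 𝒟 ⥤ 𝒟} (M' : SemiModule S act') (F : 𝒞 ⥤ 𝒟) where
  m : ∀ (X : 𝒱) (A : 𝒞), (act'.obj X).obj (F.obj A) ≅ F.obj ((act.obj X).obj A)
  m_naturality : ∀ {X X' : 𝒱} {A A' : 𝒞} (f : X ⟶ X') (g : A ⟶ A'),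
    bimap act' f (F.map g) ≫ (m X' A').hom = (m X A).hom ≫ F.map (bimap act f g)
  coherence : ∀ (X Y : 𝒱) (A : 𝒞),
    (m ((S.tensor.obj X).obj Y) A).hom ≫ F.map (M.α X Y A).hom =
      (M'.α X Y (F.obj A)).hom ≫ bimap act' (𝟙 X) (m Y A).hom ≫ (m X ((act.obj Y).obj A)).hom

end SemiModules

/-! ### The semi-monoidal category of conilpotent coalgebras -/

section CoDGATensor

variable {k : Type u} [Field k]

theorem cmp_comm {V W : Type u} [AddCommGroup V] [Module k V] [AddCommGroup W] [Module k W]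
    [GrMod k V] [GrMod k W] {f : V →ₗ[k] W} (hf : f ∈ homDeg k V W 0) (n : ℤ) (v : V) :
    f (cmp (k := k) n v) = cmp (k := k) n (f v) := by
  have : f ∘ₗ cmp n = cmp n ∘ₗ f := ext_gr fun m v hv => by
    have h := hf m v hv
    rw [add_zero] at h
    by_cases e : n = m
    · subst e; simp [cmp_of_mem hv, cmp_of_mem h]
    · simp [cmp_of_ne e hv, cmp_of_ne e h]
  exact LinearMap.congr_fun this v

/-- A bijective morphism of dg coalgebras is an isomorphism. -/
noncomputable def CoDGA.isoOfEquiv {C D : CoDGA k} (f : C ⟶ D) (e : C ≃ₗ[k] D)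
    (h : ∀ c, e c = CoDGA.Hom.toLin f c) : C ≅ D where
  hom := f
  inv :=
    { toLin := e.symm.toLinearMap
      deg := fun n c hc => by
        have : e.symm c = cmp (k := k) n (e.symm c) := by
          apply e.injective
          rw [h (cmp n _), cmp_comm (CoDGA.Hom.homDeg f), ← h, e.apply_symm_apply, cmp_of_mem hc]
        exact this ▸ cmp_mem n _
      comm_d := fun c => by
        apply e.injective
        simp [h, CoDGA.Hom.comm_d f]
        simp [← h]
      map_comul := fun c => by
        obtain ⟨x, rfl⟩ := e.surjective c
        have h' : e.symm.toLinearMap ∘ₗ CoDGA.Hom.toLin f = LinearMap.id :=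
          LinearMap.ext fun c => by simp [← h]
        have h2 : e.symm.toLinearMap (e x) = x := e.symm_apply_apply x
        rw [h2, h, CoDGA.Hom.map_comul, TensorProduct.map_map, h', TensorProduct.map_id]
        rfl }
  hom_inv_id := by
    ext1; refine LinearMap.ext fun c => ?_
    show e.symm (CoDGA.Hom.toLin f c) = c
    rw [← h]; simp
  inv_hom_id := by
    ext1; refine LinearMap.ext fun c => ?_
    show CoDGA.Hom.toLin f (e.symm c) = c
    rw [← h]; simp

/-- The tensor product of conilpotent dg coalgebras. -/
noncomputable def tensorObj (C D : CoDGA k) : CoDGA k where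
  carrier := C ⊗[k] D
  conil := tensor_conil C.conil

/-- The tensor product of morphisms. -/
noncomputable def tensorMap {C C' D D' : CoDGA k} (f : C ⟶ C') (g : D ⟶ D') :
    tensorObj C D ⟶ tensorObj C' D' where
  toLin := TensorProduct.map (CoDGA.Hom.toLin f) (CoDGA.Hom.toLin g)
  deg n t ht := by
    have := map_homDeg (CoDGA.Hom.homDeg f) (CoDGA.Hom.homDeg g) (add_zero 0) n t ht
    rwa [add_zero] at this
  comm_d := d_map (CoDGA.Hom.homDeg f) (CoDGA.Hom.comm_d f) (CoDGA.Hom.comm_d g)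
  map_comul t := by
    have h : ∀ {X Y : CoDGA k} (f : X ⟶ Y), Del k Y ∘ₗ CoDGA.Hom.toLin f =
        TensorProduct.map (CoDGA.Hom.toLin f) (CoDGA.Hom.toLin f) ∘ₗ Del k X := fun f =>
      LinearMap.ext fun x => CoDGA.Hom.map_comul f x
    have key : ∀ t : C ⊗[k] D, shuf k C' C' D' D' (TensorProduct.map (Del k C') (Del k D')
        (TensorProduct.map (CoDGA.Hom.toLin f) (CoDGA.Hom.toLin g) t)) =
      TensorProduct.map (TensorProduct.map (CoDGA.Hom.toLin f) (CoDGA.Hom.toLin g))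
        (TensorProduct.map (CoDGA.Hom.toLin f) (CoDGA.Hom.toLin g))
        (shuf k C C D D (TensorProduct.map (Del k C) (Del k D) t)) := fun t => by
      rw [← shuf_map _ _ (CoDGA.Hom.homDeg f) (CoDGA.Hom.homDeg g), TensorProduct.map_map,
        TensorProduct.map_map, h, h]
    exact key t

/-- The associativity isomorphism `(C ⊗ D) ⊗ E ≅ C ⊗ (D ⊗ E)`. -/
noncomputable def tensorAssoc (C D E : CoDGA k) :
    tensorObj (tensorObj C D) E ≅ tensorObj C (tensorObj D E) :=
  CoDGA.isoOfEquiv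
    { toLin := (TensorProduct.assoc k C D E).toLinearMap
      deg := by
        have : (TensorProduct.assoc k C D E).toLinearMap ∈
            homDeg k ((C ⊗[k] D) ⊗[k] E) (C ⊗[k] (D ⊗[k] E)) 0 :=
          tensor_homDeg fun i j t ht e he => by
            refine tensor_gr_le ((TensorProduct.assoc k C D E).toLinearMap ∘ₗ
              (TensorProduct.mk k (C ⊗[k] D) E).flip e) _ i (fun a b hab c hc d hd => ?_) t ht
            exact tmul_mem_gr hc (tmul_mem_gr hd he rfl) (by omega)
        intro n t ht
        have := this n t ht
        rwa [add_zero] at this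
      comm_d := fun t => by
        have : (TensorProduct.assoc k C D E).toLinearMap ∘ₗ dd k ((C ⊗[k] D) ⊗[k] E) =
            dd k (C ⊗[k] (D ⊗[k] E)) ∘ₗ (TensorProduct.assoc k C D E).toLinearMap := by
          apply TensorProduct.ext_threefold
          intro c d e
          simp [d_tmul, sig_tmul, TensorProduct.add_tmul, TensorProduct.tmul_add, add_assoc]
        exact LinearMap.congr_fun this t
      map_comul := fun t => by
        have : shuf k C C (D ⊗[k] E) (D ⊗[k] E) ∘ₗ TensorProduct.map (Del k C)
              (shuf k D D E E ∘ₗ TensorProduct.map (Del k D) (Del k E)) ∘ₗ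
              (TensorProduct.assoc k C D E).toLinearMap =
            TensorProduct.map (TensorProduct.assoc k C D E).toLinearMap
              (TensorProduct.assoc k C D E).toLinearMap ∘ₗ
              shuf k (C ⊗[k] D) (C ⊗[k] D) E E ∘ₗ TensorProduct.map
                (shuf k C C D D ∘ₗ TensorProduct.map (Del k C) (Del k D)) (Del k E) := by
          apply TensorProduct.ext_threefold
          intro c d e
          have := shuf_assoc (k := k) ((Del k C c ⊗ₜ Del k D d) ⊗ₜ Del k E e)
          simpa using this.symm
        exact LinearMap.congr_fun this t }
    (TensorProduct.assoc k C D E) (fun _ => rfl)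

theorem tensor_hom_ext {C D E : CoDGA k} {f g : tensorObj C D ⟶ E}
    (h : ∀ (c : C) (d : D), CoDGA.Hom.toLin f (c ⊗ₜ[k] d) = CoDGA.Hom.toLin g (c ⊗ₜ[k] d)) :
    f = g :=
  CoDGA.hom_ext (TensorProduct.ext' h)

variable (k) in
/-- The tensor product of conilpotent dg coalgebras as a functor. -/
noncomputable def tensorFunctor : CoDGA k ⥤ CoDGA k ⥤ CoDGA k where
  obj C :=
    { obj := fun D => tensorObj C D
      map := fun g => tensorMap (𝟙 C) g
      map_id := fun D => tensor_hom_ext fun _ _ => rfl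
      map_comp := fun f g => tensor_hom_ext fun _ _ => rfl }
  map f :=
    { app := fun D => tensorMap f (𝟙 D)
      naturality := fun D D' g => tensor_hom_ext fun _ _ => rfl }
  map_id C := by ext D : 2; exact tensor_hom_ext fun _ _ => rfl
  map_comp f g := by ext D : 2; exact tensor_hom_ext fun _ _ => rfl

theorem tensor_hom_ext₃ {C D E F : CoDGA k} {f g : tensorObj (tensorObj C D) E ⟶ F}
    (h : ∀ (c : C) (d : D) (e : E), CoDGA.Hom.toLin f ((c ⊗ₜ[k] d) ⊗ₜ[k] e) =
      CoDGA.Hom.toLin g ((c ⊗ₜ[k] d) ⊗ₜ[k] e)) : f = g :=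
  CoDGA.hom_ext (TensorProduct.ext_threefold (M := C) (N := D) (P := E) h)

theorem tensor_hom_ext₄ {C D E F G : CoDGA k}
    {f g : tensorObj (tensorObj (tensorObj C D) E) F ⟶ G}
    (h : ∀ (c : C) (d : D) (e : E) (x : F), CoDGA.Hom.toLin f (((c ⊗ₜ[k] d) ⊗ₜ[k] e) ⊗ₜ[k] x) =
      CoDGA.Hom.toLin g (((c ⊗ₜ[k] d) ⊗ₜ[k] e) ⊗ₜ[k] x)) : f = g :=
  CoDGA.hom_ext (TensorProduct.ext_fourfold (M := C) (N := D) (P := E) (Q := F) h)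

variable (k) in
/-- The semi-monoidal category of conilpotent dg coalgebras. -/
noncomputable def coalgTensor : SemiMonoidal (CoDGA k) where
  tensor := tensorFunctor k
  a := tensorAssoc
  a_naturality f g h := tensor_hom_ext₃ fun _ _ _ => rfl
  pentagon X Y Z W := tensor_hom_ext₄ fun _ _ _ _ => rfl

end CoDGATensor

/-! ### Free algebras, dg ideals and quotients -/

section Quot

variable {k : Type u} [Field k]

theorem wd_ext {V M : Type u} [AddCommGroup V] [Module k V] [AddCommGroup M] [Module k M]
    {f g : Wd k V →ₗ[k] M} (m : M →ₗ[k] M →ₗ[k] M)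
    (hf : ∀ x y, f (conc k V x y) = m (f x) (f y)) (hg : ∀ x y, g (conc k V x y) = m (g x) (g y))
    (h : ∀ v, f (letter k V v) = g (letter k V v)) : f = g := by
  have key : ∀ w : TA k V, ∀ v, f (v ⊗ₜ w) = g (v ⊗ₜ w) := by
    intro w
    let S : Submodule k (TA k V) :=
      { carrier := {w | ∀ v, f (v ⊗ₜ w) = g (v ⊗ₜ w)}
        add_mem' := fun {x y} hx hy v => by rw [TensorProduct.tmul_add, map_add, map_add, hx, hy]
        zero_mem' := fun v => by simp
        smul_mem' := fun c x hx v => by rw [TensorProduct.tmul_smul, map_smul, map_smul, hx] }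
    refine left_induction S h ?_ w
    intro u w hw v
    have e : v ⊗ₜ[k] (TensorAlgebra.ι k u * w) = conc k V (letter k V v) (u ⊗ₜ w) := by
      rw [conc_apply, letter_apply, rmul_tmul, inc_tmul, one_mul]
    rw [e, hf, hg, h, hw]
  exact TensorProduct.ext' fun v w => key w v

theorem free_d_d {V : Type u} [AddCommGroup V] [Module k V] [DGMod k V] (v : V) :
    der (letter k V ∘ₗ dd k V) ((letter k V ∘ₗ dd k V) v) = 0 := by
  rw [LinearMap.comp_apply, der_letter, LinearMap.comp_apply, DGMod.d_d, map_zero]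

variable (k) in
/-- The free non-unital dg algebra `T₀ V` on a dg vector space. -/
noncomputable def freeAlg (V : Type u) [AddCommGroup V] [Module k V] [DGMod k V] :
    DGAlg k where
  carrier := Wd k V
  alg := freeDGA (letter k V ∘ₗ dd k V)
    (homDeg_comp (fun n v hv => by rw [add_zero]; exact letter_mem hv) d_homDeg (add_zero _))
    free_d_d

variable (k) in
/-- The inclusion of the generators `V → T₀ V`. -/
noncomputable def freeGen (V : Type u) [AddCommGroup V] [Module k V] [DGMod k V] :
    V →ₗ[k] freeAlg k V := letter k V

theorem free_hom_ext {V : Type u} [AddCommGroup V] [Module k V] [DGMod k V] {B : DGAlg k}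
    {f g : freeAlg k V ⟶ B}
    (h : ∀ v, DGAlg.Hom.toLin f (freeGen k V v) = DGAlg.Hom.toLin g (freeGen k V v)) : f = g :=
  DGAlg.hom_ext (wd_ext (mu k B) (DGAlg.Hom.map_mul f) (DGAlg.Hom.map_mul g) h)

/-- Two-sided, graded ideals that are stable under the differential. -/
structure IsDGIdeal (A : DGAlg k) (I : Submodule k A) : Prop where
  graded : ∀ x ∈ I, ∀ n, cmp (k := k) n x ∈ I
  d_mem : ∀ x ∈ I, dd k A x ∈ I
  mul_left : ∀ a, ∀ x ∈ I, mu k A a x ∈ I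
  mul_right : ∀ a, ∀ x ∈ I, mu k A x a ∈ I

/-- The dg ideal generated by a set. -/
def dgSpan (A : DGAlg k) (R : Set A) : Submodule k A := sInf {I | IsDGIdeal A I ∧ R ⊆ I}

theorem subset_dgSpan (A : DGAlg k) (R : Set A) : R ⊆ dgSpan A R := fun x hx => by
  rw [SetLike.mem_coe, dgSpan, Submodule.mem_sInf]
  exact fun I hI => hI.2 hx

theorem dgSpan_isDGIdeal (A : DGAlg k) (R : Set A) : IsDGIdeal A (dgSpan A R) where
  graded x hx n := Submodule.mem_sInf.2 fun I hI =>
    hI.1.graded x (Submodule.mem_sInf.1 hx I hI) n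
  d_mem x hx := Submodule.mem_sInf.2 fun I hI => hI.1.d_mem x (Submodule.mem_sInf.1 hx I hI)
  mul_left a x hx := Submodule.mem_sInf.2 fun I hI =>
    hI.1.mul_left a x (Submodule.mem_sInf.1 hx I hI)
  mul_right a x hx := Submodule.mem_sInf.2 fun I hI =>
    hI.1.mul_right a x (Submodule.mem_sInf.1 hx I hI)

theorem IsDGIdeal.comap {A B : DGAlg k} (f : A ⟶ B) {I : Submodule k B} (hI : IsDGIdeal B I) :
    IsDGIdeal A (I.comap (DGAlg.Hom.toLin f)) where
  graded x hx n := by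
    rw [Submodule.mem_comap, cmp_comm (DGAlg.Hom.homDeg f)]
    exact hI.graded _ hx n
  d_mem x hx := by
    rw [Submodule.mem_comap, DGAlg.Hom.comm_d]
    exact hI.d_mem _ hx
  mul_left a x hx := by
    rw [Submodule.mem_comap, DGAlg.Hom.map_mul]
    exact hI.mul_left _ _ hx
  mul_right a x hx := by
    rw [Submodule.mem_comap, DGAlg.Hom.map_mul]
    exact hI.mul_right _ _ hx

section
variable (A : DGAlg k) (I : Submodule k A)

@[reducible] noncomputable def quotGrMod (hI : IsDGIdeal A I) : GrMod k (A ⧸ I) where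
  grade n := (gr k A n).map I.mkQ
  internal := internal_of _ LinearMap.id Function.injective_id
    (fun n => I.mapQ I (cmp n) fun x hx => hI.graded x hx n)
    (fun n v hv => by
      obtain ⟨x, hx, rfl⟩ := hv
      simp [cmp_of_mem hx])
    (fun m n h v hv => by
      obtain ⟨x, hx, rfl⟩ := hv
      simp [cmp_of_ne h hx])
    (by rw [← Submodule.map_iSup, iSup_gr, Submodule.map_top, Submodule.range_mkQ])

/-- The multiplication of the quotient algebra, `[a] [b] = [a b]`. -/
noncomputable def quotMul (hI : IsDGIdeal A I) : (A ⧸ I) →ₗ[k] (A ⧸ I) →ₗ[k] (A ⧸ I) :=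
  I.liftQ
    { toFun := fun a => I.mapQ I (mu k A a) (hI.mul_left a)
      map_add' := fun a b => Submodule.linearMap_qext _ (by ext x; simp)
      map_smul' := fun c a => Submodule.linearMap_qext _ (by ext x; simp) }
    (fun a ha => Submodule.linearMap_qext _ (LinearMap.ext fun x =>
      (Submodule.Quotient.mk_eq_zero I).2 (hI.mul_right x a ha)))

/-- The quotient of a dg algebra by a dg ideal. -/
noncomputable def quotAlg (hI : IsDGIdeal A I) : DGAlg k where
  carrier := A ⧸ I
  alg :=
    { toGrMod := quotGrMod A I hI
      d := I.mapQ I (dd k A) hI.d_mem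
      d_deg := by
        rintro n _ ⟨x, hx, rfl⟩
        exact ⟨dd k A x, DGMod.d_deg n x hx, rfl⟩
      d_d := by
        intro v
        obtain ⟨x, rfl⟩ := I.mkQ_surjective v
        show I.mkQ (dd k A (dd k A x)) = 0
        rw [DGMod.d_d, map_zero]
      mul := quotMul A I hI
      mul_assoc := by
        intro a b c
        obtain ⟨a, rfl⟩ := I.mkQ_surjective a
        obtain ⟨b, rfl⟩ := I.mkQ_surjective b
        obtain ⟨c, rfl⟩ := I.mkQ_surjective c
        exact congrArg I.mkQ (DGA.mul_assoc a b c)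
      mul_deg := by
        rintro i j _ ⟨a, ha, rfl⟩ _ ⟨b, hb, rfl⟩
        exact ⟨mu k A a b, DGA.mul_deg i j a ha b hb, rfl⟩
      leibniz := by
        intro a b
        obtain ⟨a, rfl⟩ := I.mkQ_surjective a
        obtain ⟨b, rfl⟩ := I.mkQ_surjective b
        let _ := quotGrMod A I hI
        have h : I.mkQ ∈ homDeg k A (A ⧸ I) 0 := fun n x hx => by
          rw [add_zero]; exact ⟨x, hx, rfl⟩
        have h' : sig (k := k) (I.mkQ a) = I.mkQ (sig (k := k) a) := (degOp_comm h _ a).symm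
        rw [h']
        exact (congrArg I.mkQ (DGA.leibniz a b)).trans (map_add _ _ _) }

/-- The projection onto the quotient. -/
noncomputable def quotMk (hI : IsDGIdeal A I) : A ⟶ quotAlg A I hI where
  toLin := I.mkQ
  deg _ a ha := ⟨a, ha, rfl⟩
  comm_d _ := rfl
  map_mul _ _ := rfl

variable {A I}

/-- The universal property of the quotient. -/
noncomputable def quotLift (hI : IsDGIdeal A I) {B : DGAlg k} (f : A ⟶ B)
    (h : ∀ x ∈ I, DGAlg.Hom.toLin f x = 0) : quotAlg A I hI ⟶ B where
  toLin := I.liftQ (DGAlg.Hom.toLin f) h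
  deg := by
    rintro n _ ⟨a, ha, rfl⟩
    exact DGAlg.Hom.deg f n a ha
  comm_d a := by
    obtain ⟨a, rfl⟩ := I.mkQ_surjective a
    exact DGAlg.Hom.comm_d f a
  map_mul a b := by
    obtain ⟨a, rfl⟩ := I.mkQ_surjective a
    obtain ⟨b, rfl⟩ := I.mkQ_surjective b
    exact DGAlg.Hom.map_mul f a b

end

end Quot

/-! ### Measurings -/

section Measuring

variable {k : Type u} [Field k]

section
variable {C A B : Type u} [AddCommGroup C] [Module k C] [AddCommGroup A] [Module k A]
  [AddCommGroup B] [Module k B]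

/-- For a linear map `u : C ⊗ A → B`, the map
`c ↦ Σ (-1)^{|a||c''|} u (c' ⊗ a) u (c'' ⊗ a')`, where `Δ c = Σ c' ⊗ c''`. A morphism `u` of dg
vector spaces is a measuring if `u (c ⊗ a a') = measMul u a a' c`, or in other words if the adjoint
map `A → {C, B}`, `a ↦ (c ↦ (-1)^{|a||c|} u (c ⊗ a))`, is a morphism of dg algebras. -/
noncomputable def measMul [DGC k C] [GrMod k A] [DGA k B] (u : C ⊗[k] A →ₗ[k] B) (a a' : A) :
    C →ₗ[k] B :=
  TensorProduct.lift (mu k B) ∘ₗ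
    (TensorProduct.map ((TensorProduct.curry u).flip (ev (k := k) a))
        ((TensorProduct.curry u).flip a') +
      TensorProduct.map ((TensorProduct.curry u).flip (od (k := k) a))
        ((TensorProduct.curry u).flip a' ∘ₗ sig)) ∘ₗ Del k C

/-- Compatibility of `measMul` with a coalgebra map `f`, an algebra map `g` and a degree-preserving
map `h`. -/
theorem measMul_map [DGC k C] [GrMod k A] [DGA k B] {C' A' B' : Type u} [AddCommGroup C']
    [Module k C'] [AddCommGroup A'] [Module k A'] [AddCommGroup B'] [Module k B'] [DGC k C']
    [GrMod k A'] [DGA k B'] {f : C →ₗ[k] C'} (hf : f ∈ homDeg k C C' 0)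
    (hf' : ∀ c, Del k C' (f c) = TensorProduct.map f f (Del k C c)) {h : A →ₗ[k] A'}
    (hh : h ∈ homDeg k A A' 0) {g : B →ₗ[k] B'}
    (hg : ∀ b b', g (mu k B b b') = mu k B' (g b) (g b')) {u : C ⊗[k] A →ₗ[k] B}
    {u' : C' ⊗[k] A' →ₗ[k] B'} (hu : ∀ c a, g (u (c ⊗ₜ a)) = u' (f c ⊗ₜ h a)) (a a' : A) (c : C) :
    g (measMul u a a' c) = measMul u' (h a) (h a') (f c) := by
  have h1 : ∀ s : ℤ → k, ∀ x, f (degOp s x) = degOp s (f x) := degOp_comm hf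
  have h2 : ∀ s : ℤ → k, ∀ x, h (degOp s x) = degOp s (h x) := degOp_comm hh
  simp only [measMul, LinearMap.comp_apply, hf']
  induction Del k C c using TensorProduct.induction_on with
  | zero => simp
  | add x y hx hy => simp only [map_add, hx, hy]
  | tmul x y =>
    simp only [LinearMap.add_apply, TensorProduct.map_tmul, LinearMap.flip_apply,
      TensorProduct.curry_apply, LinearMap.comp_apply, map_add, TensorProduct.lift.tmul, hg, hu,
      ev, od, sig, h1, h2]

theorem measMul_comap [DGC k C] [GrMod k A] [DGA k B] {C' A' B' : Type u} [AddCommGroup C']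
    [Module k C'] [AddCommGroup A'] [Module k A'] [AddCommGroup B'] [Module k B'] [DGC k C']
    [GrMod k A'] [DGA k B'] {f : C →ₗ[k] C'} (hf : f ∈ homDeg k C C' 0)
    (hf' : ∀ c, Del k C' (f c) = TensorProduct.map f f (Del k C c)) {h : A' →ₗ[k] A}
    (hh : h ∈ homDeg k A' A 0) {g : B →ₗ[k] B'}
    (hg : ∀ b b', g (mu k B b b') = mu k B' (g b) (g b')) {u : C ⊗[k] A →ₗ[k] B}
    {u' : C' ⊗[k] A' →ₗ[k] B'} (hu : ∀ c a, g (u (c ⊗ₜ h a)) = u' (f c ⊗ₜ a)) (a a' : A') (c : C) :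
    g (measMul u (h a) (h a') c) = measMul u' a a' (f c) := by
  have h1 : ∀ s : ℤ → k, ∀ x, f (degOp s x) = degOp s (f x) := degOp_comm hf
  have h2 : ∀ s : ℤ → k, ∀ x, h (degOp s x) = degOp s (h x) := degOp_comm hh
  simp only [measMul, LinearMap.comp_apply, hf']
  induction Del k C c using TensorProduct.induction_on with
  | zero => simp
  | add x y hx hy => simp only [map_add, hx, hy]
  | tmul x y =>
    simp only [LinearMap.add_apply, TensorProduct.map_tmul, LinearMap.flip_apply,
      TensorProduct.curry_apply, LinearMap.comp_apply, map_add, TensorProduct.lift.tmul, hg,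
      ev, od, sig, h1, ← h2, hu]

end

/-! ### The tensoring -/

/-- The relations that turn the inclusion of the letters `C ⊗ A → T₀(C ⊗ A)` into a measuring. -/
def tenRel (C : CoDGA k) (A : DGAlg k) : Set (freeAlg k (C ⊗[k] A)) :=
  {x | ∃ (c : C) (a a' : A), x = freeGen k (C ⊗[k] A) (c ⊗ₜ mu k A a a') -
    measMul (freeGen k (C ⊗[k] A)) a a' c}

/-- The tensoring `C ▷ A`: the free algebra on `C ⊗ A` modulo the relations
`c ⊗ a a' = Σ (-1)^{|a||c''|} (c' ⊗ a) (c'' ⊗ a')`. -/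
noncomputable def tenObj (C : CoDGA k) (A : DGAlg k) : DGAlg k :=
  quotAlg (freeAlg k (C ⊗[k] A)) (dgSpan _ (tenRel C A)) (dgSpan_isDGIdeal _ _)

/-- The universal measuring `u : C ⊗ A → C ▷ A`. -/
noncomputable def tenU (C : CoDGA k) (A : DGAlg k) : C ⊗[k] A →ₗ[k] tenObj C A :=
  DGAlg.Hom.toLin (quotMk _ _ (dgSpan_isDGIdeal _ (tenRel C A))) ∘ₗ freeGen k (C ⊗[k] A)

theorem ten_hom_ext {C : CoDGA k} {A B : DGAlg k} {f g : tenObj C A ⟶ B}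
    (h : ∀ (c : C) (a : A), DGAlg.Hom.toLin f (tenU C A (c ⊗ₜ a)) =
      DGAlg.Hom.toLin g (tenU C A (c ⊗ₜ a))) : f = g := by
  have key : quotMk _ _ (dgSpan_isDGIdeal _ (tenRel C A)) ≫ f =
      quotMk _ _ (dgSpan_isDGIdeal _ (tenRel C A)) ≫ g := by
    refine free_hom_ext fun t => ?_
    have h' : DGAlg.Hom.toLin f ∘ₗ tenU C A = DGAlg.Hom.toLin g ∘ₗ tenU C A :=
      TensorProduct.ext' h
    exact LinearMap.congr_fun h' t
  ext1
  exact Submodule.linearMap_qext _ (congrArg DGAlg.Hom.toLin key)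

/-- The map of free algebras induced by a map of dg vector spaces. -/
noncomputable def freeMap {V W : Type u} [AddCommGroup V] [Module k V] [DGMod k V]
    [AddCommGroup W] [Module k W] [DGMod k W] (f : V →ₗ[k] W) (hf : f ∈ homDeg k V W 0)
    (df : ∀ v, f (dd k V v) = dd k W (f v)) : freeAlg k V ⟶ freeAlg k W where
  toLin := wmap k f
  deg n x hx := by
    have := wmap_homDeg hf n x hx
    rwa [add_zero] at this
  comm_d := wmap_der hf _ _ fun v => by
    rw [LinearMap.comp_apply, wmap_letter, df]; rfl
  map_mul := wmap_conc f

theorem freeMap_gen {V W : Type u} [AddCommGroup V] [Module k V] [DGMod k V]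
    [AddCommGroup W] [Module k W] [DGMod k W] (f : V →ₗ[k] W) (hf : f ∈ homDeg k V W 0)
    (df : ∀ v, f (dd k V v) = dd k W (f v)) (v : V) :
    DGAlg.Hom.toLin (freeMap f hf df) (freeGen k V v) = freeGen k W (f v) := wmap_letter f v

/-- The map `T₀(C ⊗ A) → T₀(D ⊗ B)` induced by `C → D` and `A → B`. -/
noncomputable def tenFreeMap {C D : CoDGA k} {A B : DGAlg k} (f : C ⟶ D) (g : A ⟶ B) :
    freeAlg k (C ⊗[k] A) ⟶ freeAlg k (D ⊗[k] B) :=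
  freeMap (TensorProduct.map (CoDGA.Hom.toLin f) (DGAlg.Hom.toLin g))
    (map_homDeg (CoDGA.Hom.homDeg f) (DGAlg.Hom.homDeg g) (add_zero 0))
    (d_map (CoDGA.Hom.homDeg f) (CoDGA.Hom.comm_d f) (DGAlg.Hom.comm_d g))

theorem tenFreeMap_gen {C D : CoDGA k} {A B : DGAlg k} (f : C ⟶ D) (g : A ⟶ B) (c : C) (a : A) :
    DGAlg.Hom.toLin (tenFreeMap f g) (freeGen k (C ⊗[k] A) (c ⊗ₜ a)) =
      freeGen k (D ⊗[k] B) (CoDGA.Hom.toLin f c ⊗ₜ DGAlg.Hom.toLin g a) := freeMap_gen _ _ _ _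

theorem tenFreeMap_rel {C D : CoDGA k} {A B : DGAlg k} (f : C ⟶ D) (g : A ⟶ B)
    (x : freeAlg k (C ⊗[k] A)) (hx : x ∈ dgSpan _ (tenRel C A)) :
    DGAlg.Hom.toLin (tenFreeMap f g) x ∈ dgSpan _ (tenRel D B) := by
  refine Submodule.mem_sInf.1 hx _ ⟨(dgSpan_isDGIdeal _ (tenRel D B)).comap (tenFreeMap f g), ?_⟩
  rintro _ ⟨c, a, a', rfl⟩
  refine subset_dgSpan _ _ ⟨CoDGA.Hom.toLin f c, DGAlg.Hom.toLin g a, DGAlg.Hom.toLin g a', ?_⟩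
  rw [map_sub, tenFreeMap_gen, DGAlg.Hom.map_mul g, measMul_map (CoDGA.Hom.homDeg f)
    (CoDGA.Hom.map_comul f) (DGAlg.Hom.homDeg g) (DGAlg.Hom.map_mul _) (tenFreeMap_gen f g)]

/-- Functoriality of `C ▷ A`. -/
noncomputable def tenMap {C D : CoDGA k} {A B : DGAlg k} (f : C ⟶ D) (g : A ⟶ B) :
    tenObj C A ⟶ tenObj D B :=
  quotLift (dgSpan_isDGIdeal _ _)
    (tenFreeMap f g ≫ quotMk _ _ (dgSpan_isDGIdeal _ (tenRel D B)))
    (fun x hx => (Submodule.Quotient.mk_eq_zero _).2 (tenFreeMap_rel f g x hx))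

theorem tenMap_u {C D : CoDGA k} {A B : DGAlg k} (f : C ⟶ D) (g : A ⟶ B) (c : C) (a : A) :
    DGAlg.Hom.toLin (tenMap f g) (tenU C A (c ⊗ₜ a)) =
      tenU D B (CoDGA.Hom.toLin f c ⊗ₜ DGAlg.Hom.toLin g a) := by
  exact congrArg (dgSpan _ (tenRel D B)).mkQ (tenFreeMap_gen f g c a)

variable (k) in
/-- The tensoring as a functor. -/
noncomputable def tensoring : CoDGA k ⥤ DGAlg k ⥤ DGAlg k where
  obj C :=
    { obj := fun A => tenObj C A
      map := fun g => tenMap (𝟙 C) g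
      map_id := fun A => ten_hom_ext fun c a => by rw [tenMap_u]; rfl
      map_comp := fun f g => ten_hom_ext fun c a => by
        
        simp only [DGAlg.toLin_comp, LinearMap.comp_apply, tenMap_u]; rfl }
  map f :=
    { app := fun A => tenMap f (𝟙 A)
      naturality := fun A B g => ten_hom_ext fun c a => by
        simp only [DGAlg.toLin_comp, LinearMap.comp_apply, tenMap_u]; rfl }
  map_id C := by
    ext A : 2
    exact ten_hom_ext fun c a => by rw [tenMap_u]; rfl
  map_comp f g := by
    ext A : 2
    refine ten_hom_ext fun c a => ?_
    rw [NatTrans.comp_app, tenMap_u, DGAlg.toLin_comp, LinearMap.comp_apply, tenMap_u, tenMap_u]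
    rfl

end Measuring

/-! ### Cofree conilpotent coalgebras and dg subcoalgebras -/

section Sub

variable {k : Type u} [Field k]

theorem cofreeData {V : Type u} [AddCommGroup V] [Module k V] [DGMod k V] :
    BarData (dd k V) (0 : V →ₗ[k] V →ₗ[k] V) where
  d_deg := d_homDeg
  b_deg _ _ _ _ _ _ := Submodule.zero_mem _
  d_d := DGMod.d_d
  d_b v w := by simp
  b_b u v w := by simp

variable (k) in
/-- The conilpotent cofree coalgebra `Tᶜᵒ V` on a dg vector space. -/
noncomputable def cofreeCoalg (V : Type u) [AddCommGroup V] [Module k V] [DGMod k V] :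
    CoDGA k where
  carrier := Wd k V
  coalg := cofreeDGC cofreeData
  conil := cut_conil

variable (k) in
/-- The projection `Tᶜᵒ V → V`. -/
noncomputable def cofreeProj (V : Type u) [AddCommGroup V] [Module k V] [DGMod k V] :
    cofreeCoalg k V →ₗ[k] V := toLetter k V

theorem toLetter_wmap {V W : Type u} [AddCommGroup V] [Module k V]
    [AddCommGroup W] [Module k W] (f : V →ₗ[k] W) (x : Wd k V) :
    toLetter k W (wmap k f x) = f (toLetter k V x) := by
  have h : (TensorAlgebra.algebraMapInv (R := k) (M := W)).comp (tmap k f) =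
      TensorAlgebra.algebraMapInv := by
    ext v; simp [tmap_ι, TensorAlgebra.algebraMapInv]
  induction x using TensorProduct.induction_on with
  | zero => simp
  | add x y hx hy => simp only [map_add, hx, hy]
  | tmul v w =>
    have := AlgHom.congr_fun h w
    simp only [AlgHom.comp_apply] at this
    simp [toLetter, wmap_tmul, this]

/-- The map of cofree coalgebras induced by a map of dg vector spaces. -/
noncomputable def cofreeMap {V W : Type u} [AddCommGroup V] [Module k V] [DGMod k V]
    [AddCommGroup W] [Module k W] [DGMod k W] (f : V →ₗ[k] W) (hf : f ∈ homDeg k V W 0)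
    (df : ∀ v, f (dd k V v) = dd k W (f v)) : cofreeCoalg k V ⟶ cofreeCoalg k W where
  toLin := wmap k f
  deg n x hx := by
    have := wmap_homDeg hf n x hx
    rwa [add_zero] at this
  comm_d := wmap_coder hf _ _ _ _ df fun _ _ => map_zero f
  map_comul := cut_wmap f

/-- Graded subcoalgebras that are stable under the differential. -/
structure IsDGSub (C : CoDGA k) (S : Submodule k C) : Prop where
  graded : ∀ x ∈ S, ∀ n, cmp (k := k) n x ∈ S
  d_mem : ∀ x ∈ S, dd k C x ∈ S
  comul_mem : ∀ x ∈ S, Del k C x ∈ LinearMap.range (TensorProduct.map S.subtype S.subtype)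

theorem range_map_mono {C : Type u} [AddCommGroup C] [Module k C] {S T : Submodule k C}
    (h : S ≤ T) : LinearMap.range (TensorProduct.map S.subtype S.subtype) ≤
      LinearMap.range (TensorProduct.map T.subtype T.subtype) := by
  have : TensorProduct.map S.subtype S.subtype = TensorProduct.map T.subtype T.subtype ∘ₗ
      TensorProduct.map (Submodule.inclusion h) (Submodule.inclusion h) := by
    rw [← TensorProduct.map_comp, Submodule.subtype_comp_inclusion]
  rw [this]
  exact LinearMap.range_comp_le_range _ _

/-- The largest dg subcoalgebra that is contained in a subspace. -/
def dgCore (C : CoDGA k) (K : Submodule k C) : Submodule k C := sSup {S | IsDGSub C S ∧ S ≤ K}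

theorem le_dgCore {C : CoDGA k} {K S : Submodule k C} (h : IsDGSub C S) (h' : S ≤ K) :
    S ≤ dgCore C K := le_sSup ⟨h, h'⟩

theorem dgCore_le (C : CoDGA k) (K : Submodule k C) : dgCore C K ≤ K := sSup_le fun _ h => h.2

theorem dgCore_isDGSub (C : CoDGA k) (K : Submodule k C) : IsDGSub C (dgCore C K) where
  graded x hx n := by
    have : dgCore C K ≤ (dgCore C K).comap (cmp n) :=
      sSup_le fun S hS x hx => le_dgCore hS.1 hS.2 (hS.1.graded x hx n)
    exact this hx
  d_mem x hx := by
    have : dgCore C K ≤ (dgCore C K).comap (dd k C) :=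
      sSup_le fun S hS x hx => le_dgCore hS.1 hS.2 (hS.1.d_mem x hx)
    exact this hx
  comul_mem x hx := by
    have : dgCore C K ≤ (LinearMap.range (TensorProduct.map (dgCore C K).subtype
        (dgCore C K).subtype)).comap (Del k C) :=
      sSup_le fun S hS x hx => range_map_mono (le_dgCore hS.1 hS.2) (hS.1.comul_mem x hx)
    exact this hx

theorem IsDGSub.map {C D : CoDGA k} (f : C ⟶ D) {S : Submodule k C} (hS : IsDGSub C S) :
    IsDGSub D (S.map (CoDGA.Hom.toLin f)) where
  graded := by
    rintro _ ⟨x, hx, rfl⟩ n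
    exact ⟨cmp n x, hS.graded x hx n, cmp_comm (CoDGA.Hom.homDeg f) n x⟩
  d_mem := by
    rintro _ ⟨x, hx, rfl⟩
    exact ⟨dd k C x, hS.d_mem x hx, CoDGA.Hom.comm_d f x⟩
  comul_mem := by
    rintro _ ⟨x, hx, rfl⟩
    obtain ⟨t, ht⟩ := hS.comul_mem x hx
    refine ⟨TensorProduct.map ((CoDGA.Hom.toLin f).submoduleMap S)
      ((CoDGA.Hom.toLin f).submoduleMap S) t, ?_⟩
    rw [CoDGA.Hom.map_comul, ← ht, TensorProduct.map_map, TensorProduct.map_map]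
    rfl

section
variable (C : CoDGA k) (S : Submodule k C)

@[reducible] noncomputable def subGrMod (hS : IsDGSub C S) : GrMod k S where
  grade n := (gr k C n).comap S.subtype
  internal := internal_of _ S.subtype S.subtype_injective (fun n => cmp n ∘ₗ S.subtype)
    (fun n v hv => cmp_of_mem hv) (fun m n h v hv => cmp_of_ne h hv) (by
      rw [eq_top_iff]
      intro x _
      have : x = ∑ n ∈ (dec (k := k) (x : C)).support,
          (⟨cmp (k := k) n (x : C), hS.graded x x.2 n⟩ : S) := by
        apply Subtype.ext
        rw [AddSubmonoidClass.coe_finsetSum]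
        exact (sum_cmp (k := k) (x : C)).symm
      rw [this]
      refine Submodule.sum_mem _ fun n _ => ?_
      refine le_iSup (fun n => (gr k C n).comap S.subtype) n ?_
      exact cmp_mem (k := k) n (x : C))

theorem map_subtype_injective :
    Function.Injective (TensorProduct.map S.subtype S.subtype) :=
  TensorProduct.map_injective_of_flat_flat _ _ S.subtype_injective S.subtype_injective

/-- The restriction of the comultiplication to a subcoalgebra. -/
noncomputable def subComul (hS : IsDGSub C S) : S →ₗ[k] S ⊗[k] S :=
  (LinearEquiv.ofInjective _ (map_subtype_injective C S)).symm.toLinearMap ∘ₗ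
    (Del k C ∘ₗ S.subtype).codRestrict _ fun x => hS.comul_mem x x.2

theorem map_subComul (hS : IsDGSub C S) (x : S) :
    TensorProduct.map S.subtype S.subtype (subComul C S hS x) = Del k C x :=
  congrArg Subtype.val ((LinearEquiv.ofInjective _ (map_subtype_injective C S)).apply_symm_apply
    ⟨Del k C x, hS.comul_mem x x.2⟩)

/-- The map `f^{⊗ (n+1)}`. -/
noncomputable def tpowMap {V W : Type u} [AddCommGroup V] [Module k V] [AddCommGroup W]
    [Module k W] (f : V →ₗ[k] W) : ∀ n, TPow k V n →ₗ[k] TPow k W n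
  | 0 => f
  | n + 1 => TensorProduct.map (tpowMap f n) f

theorem tpowMap_injective {V W : Type u} [AddCommGroup V] [Module k V] [AddCommGroup W]
    [Module k W] {f : V →ₗ[k] W} (hf : Function.Injective f) (n : ℕ) :
    Function.Injective (tpowMap f n) := by
  induction n with
  | zero => exact hf
  | succ n ih => exact TensorProduct.map_injective_of_flat_flat _ _ ih hf

theorem tpowMap_iterDel {V W : Type u} [AddCommGroup V] [Module k V] [AddCommGroup W]
    [Module k W] (f : V →ₗ[k] W) (Δ : V →ₗ[k] V ⊗[k] V) (Δ' : W →ₗ[k] W ⊗[k] W)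
    (h : ∀ v, TensorProduct.map f f (Δ v) = Δ' (f v)) (n : ℕ) :
    tpowMap f n ∘ₗ iterDel k V Δ n = iterDel k W Δ' n ∘ₗ f := by
  induction n with
  | zero => rfl
  | succ n ih =>
    show TensorProduct.map (tpowMap f n) f ∘ₗ TensorProduct.map (iterDel k V Δ n) LinearMap.id ∘ₗ Δ
      = (TensorProduct.map (iterDel k W Δ' n) LinearMap.id ∘ₗ Δ') ∘ₗ f
    have h' : Δ' ∘ₗ f = TensorProduct.map f f ∘ₗ Δ := LinearMap.ext fun v => (h v).symm
    rw [LinearMap.comp_assoc, h', ← LinearMap.comp_assoc, ← LinearMap.comp_assoc,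
      ← TensorProduct.map_comp, ← TensorProduct.map_comp, ih]
    rfl

theorem subComul_coassoc (hS : IsDGSub C S) (x : S) :
    TensorProduct.assoc k S S S
        (TensorProduct.map (subComul C S hS) LinearMap.id (subComul C S hS x)) =
      TensorProduct.map LinearMap.id (subComul C S hS) (subComul C S hS x) := by
  apply TensorProduct.map_injective_of_flat_flat _ _ S.subtype_injective
    (map_subtype_injective C S)
  have h : TensorProduct.map S.subtype S.subtype ∘ₗ subComul C S hS = Del k C ∘ₗ S.subtype :=
    LinearMap.ext (map_subComul C S hS)
  have e : ∀ t : (S ⊗[k] S) ⊗[k] S,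
      TensorProduct.map S.subtype (TensorProduct.map S.subtype S.subtype)
        (TensorProduct.assoc k S S S t) = TensorProduct.assoc k C C C
          (TensorProduct.map (TensorProduct.map S.subtype S.subtype) S.subtype t) := fun t =>
    LinearMap.congr_fun (TensorProduct.ext_threefold (g := TensorProduct.map S.subtype
      (TensorProduct.map S.subtype S.subtype) ∘ₗ (TensorProduct.assoc k S S S).toLinearMap)
      (h := (TensorProduct.assoc k C C C).toLinearMap ∘ₗ
        TensorProduct.map (TensorProduct.map S.subtype S.subtype) S.subtype)
      fun _ _ _ => rfl) t
  have e1 : TensorProduct.map (Del k C ∘ₗ S.subtype) S.subtype =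
      TensorProduct.map (Del k C) LinearMap.id ∘ₗ TensorProduct.map S.subtype S.subtype := by
    rw [← TensorProduct.map_comp, LinearMap.id_comp]
  have e2 : TensorProduct.map S.subtype (Del k C ∘ₗ S.subtype) =
      TensorProduct.map LinearMap.id (Del k C) ∘ₗ TensorProduct.map S.subtype S.subtype := by
    rw [← TensorProduct.map_comp, LinearMap.id_comp]
  rw [e, TensorProduct.map_map, TensorProduct.map_map, h, LinearMap.comp_id,
    e1, e2, LinearMap.comp_apply, LinearMap.comp_apply, map_subComul, DGC.coassoc]

theorem subComul_deg (hS : IsDGSub C S) (n : ℤ) (x : S) (hx : (x : C) ∈ gr k C n) :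
    let _ := subGrMod C S hS
    subComul C S hS x ∈ gr k (S ⊗[k] S) n := by
  intro _
  have h0 : S.subtype ∈ homDeg k S C 0 := fun m y hy => by rw [add_zero]; exact hy
  have h : subComul C S hS x = cmp (k := k) n (subComul C S hS x) := by
    apply map_subtype_injective C S
    rw [cmp_comm (map_homDeg h0 h0 (add_zero 0)), map_subComul,
      cmp_of_mem (DGC.comul_deg n _ hx)]
  rw [h]
  exact cmp_mem n _

theorem subComul_coleibniz (hS : IsDGSub C S) (x : S) :
    let _ := subGrMod C S hS
    subComul C S hS ((dd k C).restrict hS.d_mem x) =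
      TensorProduct.map ((dd k C).restrict hS.d_mem) LinearMap.id (subComul C S hS x) +
      TensorProduct.map (sig (k := k)) ((dd k C).restrict hS.d_mem) (subComul C S hS x) := by
  intro _
  have h0 : S.subtype ∈ homDeg k S C 0 := fun m y hy => by rw [add_zero]; exact hy
  have hs : S.subtype ∘ₗ sig = sig ∘ₗ S.subtype := degOp_comp_of h0 _
  have hd : S.subtype ∘ₗ (dd k C).restrict hS.d_mem = dd k C ∘ₗ S.subtype := rfl
  apply map_subtype_injective C S
  rw [map_subComul, map_add, TensorProduct.map_map, TensorProduct.map_map, hs, hd,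
    LinearMap.comp_id]
  have e1 : TensorProduct.map (dd k C ∘ₗ S.subtype) S.subtype =
      TensorProduct.map (dd k C) LinearMap.id ∘ₗ TensorProduct.map S.subtype S.subtype := by
    rw [← TensorProduct.map_comp, LinearMap.id_comp]
  rw [e1, TensorProduct.map_comp sig (dd k C), LinearMap.comp_apply, LinearMap.comp_apply,
    map_subComul]
  exact DGC.coleibniz (k := k) (x : C)

/-- A dg subcoalgebra as a conilpotent dg coalgebra. -/
noncomputable def subCoalg (hS : IsDGSub C S) : CoDGA k where
  carrier := S
  coalg :=
    { toGrMod := subGrMod C S hS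
      d := (dd k C).restrict hS.d_mem
      d_deg := fun n x hx => DGMod.d_deg (k := k) n (x : C) hx
      d_d := fun x => Subtype.ext (DGMod.d_d (k := k) (x : C))
      comul := subComul C S hS
      coassoc := subComul_coassoc C S hS
      comul_deg := subComul_deg C S hS
      coleibniz := subComul_coleibniz C S hS }
  conil := by
    intro x
    obtain ⟨n, hn⟩ := C.conil x
    refine ⟨n, tpowMap_injective S.subtype_injective n ?_⟩
    have := LinearMap.congr_fun (tpowMap_iterDel S.subtype (subComul C S hS) (Del k C)
      (map_subComul C S hS) n) x
    refine this.trans ?_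
    rw [map_zero]
    exact hn

/-- The inclusion of a dg subcoalgebra. -/
noncomputable def subIncl (hS : IsDGSub C S) : subCoalg C S hS ⟶ C where
  toLin := S.subtype
  deg _ _ hx := hx
  comm_d _ := rfl
  map_comul x := (map_subComul C S hS x).symm

variable {C S}

theorem subMap_comul (hS : IsDGSub C S) {D : CoDGA k} {T : Submodule k D} (hT : IsDGSub D T)
    (f : C ⟶ D) (h : ∀ x ∈ S, CoDGA.Hom.toLin f x ∈ T) (x : S) :
    subComul D T hT ((CoDGA.Hom.toLin f).restrict h x) =
      TensorProduct.map ((CoDGA.Hom.toLin f).restrict h) ((CoDGA.Hom.toLin f).restrict h)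
        (subComul C S hS x) := by
  apply map_subtype_injective D T
  have e : T.subtype ∘ₗ (CoDGA.Hom.toLin f).restrict h = CoDGA.Hom.toLin f ∘ₗ S.subtype := rfl
  rw [map_subComul, TensorProduct.map_map, e, TensorProduct.map_comp, LinearMap.comp_apply,
    map_subComul]
  exact CoDGA.Hom.map_comul f x

/-- Restriction of a morphism to subcoalgebras. -/
noncomputable def subMap (hS : IsDGSub C S) {D : CoDGA k} {T : Submodule k D} (hT : IsDGSub D T)
    (f : C ⟶ D) (h : ∀ x ∈ S, CoDGA.Hom.toLin f x ∈ T) :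
    subCoalg C S hS ⟶ subCoalg D T hT where
  toLin := (CoDGA.Hom.toLin f).restrict h
  deg n x hx := CoDGA.Hom.deg f n (S.subtype x) hx
  comm_d x := Subtype.ext (CoDGA.Hom.comm_d f (S.subtype x))
  map_comul := subMap_comul hS hT f h

end

end Sub

/-! ### The enrichment -/

section Enrich

variable {k : Type u} [Field k]

/-- The evaluation `Tᶜᵒ[A, B] ⊗ A → B`, `w ⊗ a ↦ p(w)(a)`, where `p` is the projection of the cofree
coalgebra to `[A, B]`. -/
noncomputable def evalMap (A B : DGAlg k) : cofreeCoalg k (IHom k A B) ⊗[k] A →ₗ[k] B :=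
  TensorProduct.lift ((iHomSub k A B).subtype ∘ₗ cofreeProj k (IHom k A B))

/-- The subspace of all `w` with `ev (w ⊗ a a') = Σ (-1)^{|a||w''|} ev (w' ⊗ a) ev (w'' ⊗ a')` for
all `a`, `a'`. -/
def measSub (A B : DGAlg k) : Submodule k (cofreeCoalg k (IHom k A B)) where
  carrier := {w | ∀ a a' : A, evalMap A B (w ⊗ₜ mu k A a a') = measMul (evalMap A B) a a' w}
  add_mem' hx hy a a' := by rw [TensorProduct.add_tmul, map_add, map_add, hx, hy]
  zero_mem' a a' := by simp
  smul_mem' c x hx a a' := by rw [← TensorProduct.smul_tmul', map_smul, map_smul, hx]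

/-- The enrichment: the largest dg subcoalgebra of the cofree conilpotent coalgebra on the internal
hom `[A, B]` on which the evaluation is a measuring. -/
noncomputable def enrObj (A B : DGAlg k) : CoDGA k :=
  subCoalg _ (dgCore (cofreeCoalg k (IHom k A B)) (measSub A B)) (dgCore_isDGSub _ _)

/-- The map of cofree coalgebras induced by `h ↦ g h f`. -/
noncomputable def enrFreeMap {A A' B B' : DGAlg k} (f : A' ⟶ A) (g : B ⟶ B') :
    cofreeCoalg k (IHom k A B) ⟶ cofreeCoalg k (IHom k A' B') :=
  cofreeMap (iHomMap (DGAlg.Hom.toLin g) (DGAlg.Hom.toLin f) (DGAlg.Hom.homDeg g)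
      (DGAlg.Hom.homDeg f))
    (fun n h hh => by rw [add_zero]; exact iHomMap_mem _ _ _ _ n h hh)
    (iHomMap_d _ _ _ _ (DGAlg.Hom.comm_d g) (DGAlg.Hom.comm_d f))

theorem evalMap_enr {A A' B B' : DGAlg k} (f : A' ⟶ A) (g : B ⟶ B')
    (w : cofreeCoalg k (IHom k A B)) (a : A') :
    DGAlg.Hom.toLin g (evalMap A B (w ⊗ₜ DGAlg.Hom.toLin f a)) =
      evalMap A' B' (CoDGA.Hom.toLin (enrFreeMap f g) w ⊗ₜ a) := by
  have := toLetter_wmap (iHomMap (DGAlg.Hom.toLin g) (DGAlg.Hom.toLin f) (DGAlg.Hom.homDeg g)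
      (DGAlg.Hom.homDeg f)) w
  exact (congrArg (fun h : IHom k A' B' => (h : A' →ₗ[k] B') a) this).symm

theorem enrFreeMap_mem {A A' B B' : DGAlg k} (f : A' ⟶ A) (g : B ⟶ B')
    (w : cofreeCoalg k (IHom k A B)) (hw : w ∈ dgCore _ (measSub A B)) :
    CoDGA.Hom.toLin (enrFreeMap f g) w ∈ dgCore _ (measSub A' B') := by
  refine le_dgCore ((dgCore_isDGSub _ (measSub A B)).map (enrFreeMap f g)) ?_ ⟨w, hw, rfl⟩
  rintro _ ⟨w, hw, rfl⟩ a a'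
  rw [← evalMap_enr, DGAlg.Hom.map_mul, dgCore_le _ _ hw]
  exact measMul_comap (CoDGA.Hom.homDeg (enrFreeMap f g)) (CoDGA.Hom.map_comul _)
    (DGAlg.Hom.homDeg f) (DGAlg.Hom.map_mul g) (evalMap_enr f g) a a' w

/-- Functoriality of the enrichment. -/
noncomputable def enrMap {A A' B B' : DGAlg k} (f : A' ⟶ A) (g : B ⟶ B') :
    enrObj A B ⟶ enrObj A' B' :=
  subMap (dgCore_isDGSub _ _) (dgCore_isDGSub _ _) (enrFreeMap f g) (enrFreeMap_mem f g)

theorem enrFreeMap_id (A B : DGAlg k) (w : cofreeCoalg k (IHom k A B)) :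
    CoDGA.Hom.toLin (enrFreeMap (𝟙 A) (𝟙 B)) w = w := LinearMap.congr_fun wmap_id w

theorem enrFreeMap_comp {A A' A'' B B' B'' : DGAlg k} (f : A' ⟶ A) (f' : A'' ⟶ A') (g : B ⟶ B')
    (g' : B' ⟶ B'') (w : cofreeCoalg k (IHom k A B)) :
    CoDGA.Hom.toLin (enrFreeMap (f' ≫ f) (g ≫ g')) w =
      CoDGA.Hom.toLin (enrFreeMap f' g') (CoDGA.Hom.toLin (enrFreeMap f g) w) :=
  LinearMap.congr_fun (wmap_comp (k := k)
    (iHomMap (DGAlg.Hom.toLin g) (DGAlg.Hom.toLin f) (DGAlg.Hom.homDeg g) (DGAlg.Hom.homDeg f))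
    (iHomMap (DGAlg.Hom.toLin g') (DGAlg.Hom.toLin f') (DGAlg.Hom.homDeg g')
      (DGAlg.Hom.homDeg f'))) w

theorem enrMap_id (A B : DGAlg k) : enrMap (𝟙 A) (𝟙 B) = 𝟙 (enrObj A B) :=
  CoDGA.hom_ext (LinearMap.ext fun _ => Subtype.ext (enrFreeMap_id A B _))

theorem enrMap_comp {A A' A'' B B' B'' : DGAlg k} (f : A' ⟶ A) (f' : A'' ⟶ A') (g : B ⟶ B')
    (g' : B' ⟶ B'') : enrMap (f' ≫ f) (g ≫ g') = enrMap f g ≫ enrMap f' g' :=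
  CoDGA.hom_ext (LinearMap.ext fun _ => Subtype.ext (enrFreeMap_comp f f' g g' _))

variable (k) in
/-- The enrichment as a functor. -/
noncomputable def enrichment : (DGAlg k)ᵒᵖ ⥤ DGAlg k ⥤ CoDGA k where
  obj A :=
    { obj := fun B => enrObj A.unop B
      map := fun g => enrMap (𝟙 A.unop) g
      map_id := fun B => enrMap_id _ _
      map_comp := fun g g' => enrMap_comp (𝟙 A.unop) (𝟙 A.unop) g g' }
  map f :=
    { app := fun B => enrMap f.unop (𝟙 B)
      naturality := fun B B' g => by
        rw [← enrMap_comp, ← enrMap_comp]; simp }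
  map_id A := by ext B : 2; exact enrMap_id _ _
  map_comp f f' := by ext B : 2; exact enrMap_comp f.unop f'.unop (𝟙 B) (𝟙 B)

end Enrich

section ModuleAdjunctions

universe v₁ v₂ v₃ u₁ u₂ u₃

/-- A module adjunction: an adjunction whose left adjoint is a (strong) module functor. -/
structure ModuleAdjunction {𝒱 : Type u₁} [Category.{v₁} 𝒱] {S : SemiMonoidal 𝒱} {𝒞 : Type u₂}
    [Category.{v₂} 𝒞] {act : 𝒱 ⥤ 𝒞 ⥤ 𝒞} (M : SemiModule S act) {𝒟 : Type u₃} [Category.{v₃} 𝒟]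
    {act' : 𝒱 ⥤ 𝒟 ⥤ 𝒟} (M' : SemiModule S act') (F : 𝒞 ⥤ 𝒟) (U : 𝒟 ⥤ 𝒞) where
  adj : F ⊣ U
  str : ModuleFunctor M M' F

end ModuleAdjunctions

end Koszul

namespace Koszul

/-! ### Maps out of free algebras -/

section FreeLift

variable {k : Type u} [Field k] {V B : Type u} [AddCommGroup V] [Module k V]
  [AddCommGroup B] [Module k B] [DGA k B]

/-! All the adjunctions are ways of representing one functor, the set of measurings `C ⊗ A → B`. By
construction `C ▷ A` represents it in the variable `B` (`tenLift`, `ten_hom_ext`). It remains to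
represent it in `A` and in `C`.

In `A`: the sign-twisted adjoint `a ↦ (c ↦ (-1)^{|a||c|} u(c ⊗ a))` of a degree-zero map `u` takes
values in the internal hom. It is a chain map exactly when `u` is one, and it is multiplicative for
the convolution product when the measuring identity holds. This is the content of `adj_d`, `adj_mul`
and `isMeas_of_adj`, and it gives `convEquiv`.

In `C`: a chain map `C ⊗ A → B` is a chain map `C → [A, B]`, and since `C` is conilpotent it extends
uniquely to a morphism into the cofree conilpotent coalgebra (`cofreeLift`, `cofree_hom_ext`). The
image of that morphism is a dg subcoalgebra. If `u` is a measuring, the evaluation is a measuring on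
the image, so the image lies in the largest such subcoalgebra. This gives `enrEquiv`. The extension
is the sum over `n` of the maps `φ^{⊗(n+1)} Δ^n`. Its properties are proved from a fixed-point
equation (`liftWd_fix`) and from induction over conilpotent coalgebras (`conil_induction`,
`conil_ext`).

Associativity: composing two universal measurings gives a measuring out of `(C ⊗ D) ⊗ A`, hence a
morphism `(C ⊗ D) ▷ A → C ▷ (D ▷ A)`. Currying the universal measuring of `(C ⊗ D) ▷ A`
(`IsMeas.curry`) gives its inverse. Both are explicit on generators, so naturality and coherence are
checked there.

Bar and cobar: a twisting map `C → A` is the same thing as a morphism `Ω C → A`, a morphism `C → B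
A`, or a Maurer–Cartan element of `{C, A}`. The last is a morphism `mc → {C, A}`, and hence a
morphism `C ▷ mc → A`. So `Ω C ≅ C ▷ mc`, with `s c` going to `(-1)^{|c|} u(c ⊗ x)`. The isomorphism
for `B` follows from uniqueness of right adjoints.

Finally, any functor isomorphic to `- ▷ A` is a module functor: conjugate `α⁻¹` by the isomorphism.
Its coherence is then the pentagon of the module structure with `A` in the last place
(`actIso_coherence`), and the asserted relation between `m`, `e` and `α` holds by construction
(`actIso_comp`). -/

theorem mem_of_gr [GrMod k V] (S : Submodule k V) (h : ∀ n, ∀ v ∈ gr k V n, v ∈ S) (v : V) :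
    v ∈ S :=
  mem_of_cmp S v fun n => h n _ (cmp_mem n v)

theorem conc_letter (v u : V) (w : TA k V) :
    conc k V (letter k V v) (u ⊗ₜ w) = v ⊗ₜ (TensorAlgebra.ι k u * w) := by
  rw [conc_apply, letter_apply, rmul_tmul, inc_tmul, one_mul]

/-- Induction on nonempty words. -/
theorem wd_induction (S : Submodule k (Wd k V)) (h1 : ∀ v, letter k V v ∈ S)
    (h : ∀ v, ∀ x ∈ S, conc k V (letter k V v) x ∈ S) (x : Wd k V) : x ∈ S := by
  have key : ∀ w : TA k V, ∀ v, v ⊗ₜ w ∈ S := by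
    intro w
    let T : Submodule k (TA k V) :=
      { carrier := {w | ∀ v, v ⊗ₜ w ∈ S}
        add_mem' := fun hx hy v => by rw [TensorProduct.tmul_add]; exact S.add_mem (hx v) (hy v)
        zero_mem' := fun v => by rw [TensorProduct.tmul_zero]; exact S.zero_mem
        smul_mem' := fun c x hx v => by rw [TensorProduct.tmul_smul]; exact S.smul_mem c (hx v) }
    refine left_induction T h1 ?_ w
    intro u w hw v
    rw [← conc_letter]
    exact h v _ (hw u)
  induction x using TensorProduct.induction_on with
  | zero => exact S.zero_mem
  | add x y hx hy => exact S.add_mem hx hy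
  | tmul v w => exact key w v

/-- Peeling off first letters asks nothing of `f` and `g` beyond linearity. It therefore applies to
composites with derivations as well as to multiplicative maps. -/
theorem wd_ext_left {M : Type u} [AddCommGroup M] [Module k M] {f g : Wd k V →ₗ[k] M}
    (h1 : ∀ v, f (letter k V v) = g (letter k V v))
    (h : ∀ v x, f x = g x → f (conc k V (letter k V v) x) = g (conc k V (letter k V v) x)) :
    f = g :=
  LinearMap.ext fun x => wd_induction (LinearMap.eqLocus f g) h1 h x

/-- Right multiplication by the product of the images of the letters of a word. -/
noncomputable def wordAct (f : V →ₗ[k] B) : TA k V →ₗ[k] B →ₗ[k] B :=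
  para 0 ((LinearMap.llcomp k B B B).flip ∘ₗ (mu k B).flip ∘ₗ f) LinearMap.id

theorem wordAct_one (f : V →ₗ[k] B) (b : B) : wordAct f 1 b = b := by
  rw [wordAct, para_one]; rfl

theorem wordAct_ι_mul (f : V →ₗ[k] B) (v : V) (w : TA k V) (b : B) :
    wordAct f (TensorAlgebra.ι k v * w) b = wordAct f w (mu k B b (f v)) := by
  rw [wordAct, para_ι_mul]; simp

/-- Left and right multiplications commute by associativity. This is the reason the extension
`wlift` is multiplicative. -/
theorem wordAct_mul (f : V →ₗ[k] B) (w : TA k V) (a b : B) :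
    wordAct f w (mu k B a b) = mu k B a (wordAct f w b) := by
  let S : Submodule k (TA k V) :=
    { carrier := {w | ∀ b, wordAct f w (mu k B a b) = mu k B a (wordAct f w b)}
      add_mem' := fun hx hy b => by simp only [map_add, LinearMap.add_apply, hx b, hy b]
      zero_mem' := fun b => by simp
      smul_mem' := fun c x hx b => by simp only [map_smul, LinearMap.smul_apply, hx b] }
  refine left_induction S (fun b => ?_) (fun v w hw b => ?_) w b
  · rw [wordAct_one, wordAct_one]
  · rw [wordAct_ι_mul, wordAct_ι_mul, DGA.mul_assoc, hw]

/-- The multiplicative extension of a linear map to the nonempty words. -/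
noncomputable def wlift (f : V →ₗ[k] B) : Wd k V →ₗ[k] B :=
  TensorProduct.lift ((wordAct f).flip ∘ₗ f)

theorem wlift_tmul (f : V →ₗ[k] B) (v : V) (w : TA k V) :
    wlift f (v ⊗ₜ w) = wordAct f w (f v) := rfl

theorem wlift_letter (f : V →ₗ[k] B) (v : V) : wlift f (letter k V v) = f v := by
  rw [letter_apply, wlift_tmul, wordAct_one]

theorem wlift_conc_letter (f : V →ₗ[k] B) (v : V) (x : Wd k V) :
    wlift f (conc k V (letter k V v) x) = mu k B (f v) (wlift f x) := by
  induction x using TensorProduct.induction_on with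
  | zero => simp
  | add x y hx hy => simp only [map_add, hx, hy]
  | tmul u w => rw [conc_letter, wlift_tmul, wordAct_ι_mul, wordAct_mul, wlift_tmul]

theorem wlift_conc (f : V →ₗ[k] B) (x y : Wd k V) :
    wlift f (conc k V x y) = mu k B (wlift f x) (wlift f y) := by
  have : wlift f ∘ₗ (conc k V).flip y = (mu k B).flip (wlift f y) ∘ₗ wlift f :=
    wd_ext_left (fun v => by simp [wlift_conc_letter, wlift_letter]) fun v x h => by
      simp only [LinearMap.comp_apply, LinearMap.flip_apply] at h ⊢
      rw [conc_assoc, wlift_conc_letter, h, wlift_conc_letter, DGA.mul_assoc]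
  exact LinearMap.congr_fun this x

/-- Proved first for monomials, for all `j` and `b` at once: the action absorbs the first letter
into `b` before the tail acts, so the induction hypothesis is needed for a different `b`. -/
theorem wordAct_mem [GrMod k V] {f : V →ₗ[k] B} (hf : f ∈ homDeg k V B 0) {n : ℤ} {w : TA k V}
    (hw : w ∈ gr k (TA k V) n) {j : ℤ} {b : B} (hb : b ∈ gr k B j) :
    wordAct f w b ∈ gr k B (j + n) := by
  have h1 : ∀ n, ∀ w : TA k V, IsMono k n w → ∀ j, ∀ b ∈ gr k B j,
      wordAct f w b ∈ gr k B (j + n) := by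
    intro n w hw
    induction hw with
    | one => intro j b hb; rwa [wordAct_one, add_zero]
    | cons hv hw ih =>
      intro j b hb
      rw [wordAct_ι_mul, ← add_assoc]
      have := hf _ _ hv
      rw [add_zero] at this
      exact ih _ _ (DGA.mul_deg _ _ _ hb _ this)
  have h2 : Submodule.span k {w : TA k V | IsMono k n w} ≤
      (gr k B (j + n)).comap ((wordAct f).flip b) :=
    Submodule.span_le.2 fun w hw => h1 n w hw j b hb
  exact h2 hw

theorem wlift_homDeg [GrMod k V] {f : V →ₗ[k] B} (hf : f ∈ homDeg k V B 0) :
    wlift f ∈ homDeg k (Wd k V) B 0 :=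
  tensor_homDeg fun i j v hv w hw => by
    rw [wlift_tmul]
    have := wordAct_mem hf hw (hf i v hv)
    rwa [show i + 0 + j = i + j + 0 by omega] at this

/-- Both composites obey the same Leibniz rule along the multiplicative map `wlift f`, so it
suffices to compare them on letters. Degree zero of `f` is what makes the sign operators match. -/
theorem wlift_der [GrMod k V] {f : V →ₗ[k] B} (hf : f ∈ homDeg k V B 0) (δ : V →ₗ[k] Wd k V)
    (h : ∀ v, wlift f (δ v) = dd k B (f v)) (x : Wd k V) :
    wlift f (der δ x) = dd k B (wlift f x) := by
  have : wlift f ∘ₗ der δ = dd k B ∘ₗ wlift f :=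
    wd_ext_left (fun v => by simp [der_letter, wlift_letter, h]) fun v x e => by
      have hs : f (sig (k := k) v) = sig (k := k) (f v) := degOp_comm hf _ v
      simp only [LinearMap.comp_apply] at e ⊢
      rw [der_conc, map_add, wlift_conc, wlift_conc, wlift_conc, der_letter, sig_letter,
        wlift_letter, wlift_letter, h, e, DGA.leibniz, hs]
  exact LinearMap.congr_fun this x

end FreeLift

/-! ### Measurings -/

section Meas

variable {k : Type u} [Field k]

/-- Signs depend only on the parity of the exponent. The parameter `l` lets each sign computation
state by which even number its two exponents differ. -/
theorem sgn_congr {m n : ℤ} (l : ℤ) (h : m = n + 2 * l) : sgn k m = sgn k n := by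
  rw [h, sgn_add, sgn_even (even_two_mul l), mul_one]

theorem kap_congr {V : Type u} [AddCommGroup V] [Module k V] [GrMod k V] {m n : ℤ} (l : ℤ)
    (h : m = n + 2 * l) (v : V) : kap (k := k) m v = kap (k := k) n v := by
  have : (kap m : V →ₗ[k] V) = kap n := ext_gr fun i v hv => by
    rw [kap_of_mem _ hv, kap_of_mem _ hv, sgn_congr (l * i)]
    rw [h]; ring
  rw [this]

section
variable {C A B : Type u} [AddCommGroup C] [Module k C] [AddCommGroup A] [Module k A]
  [AddCommGroup B] [Module k B]

/-- Measurings `C ⊗ A → B`. -/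
structure IsMeas [DGC k C] [DGA k A] [DGA k B] (u : C ⊗[k] A →ₗ[k] B) : Prop where
  deg : u ∈ homDeg k (C ⊗[k] A) B 0
  comm_d : ∀ t, u (dd k (C ⊗[k] A) t) = dd k B (u t)
  meas : ∀ c a a', u (c ⊗ₜ mu k A a a') = measMul u a a' c

/-- For homogeneous `a` only one of the even and odd summands survives, and the sign
`(-1)^{|a||c''|}` becomes the operator `kap i` on the second tensor factor. All sign computations
with measurings go through this form. -/
theorem measMul_of_mem [DGC k C] [GrMod k A] [DGA k B] (u : C ⊗[k] A →ₗ[k] B) {i : ℤ} {a : A}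
    (ha : a ∈ gr k A i) (a' : A) (c : C) :
    measMul u a a' c = TensorProduct.lift (mu k B)
      (TensorProduct.map ((TensorProduct.curry u).flip a)
        ((TensorProduct.curry u).flip a' ∘ₗ kap i) (Del k C c)) := by
  have h : (kap i : C →ₗ[k] C) = ev (k := k) + sgn k i • od := (ev_add_od i).symm
  rw [measMul, LinearMap.comp_apply, LinearMap.comp_apply, ev_of_mem ha, od_of_mem ha]
  by_cases hi : Even i
  · have : (kap i : C →ₗ[k] C) = LinearMap.id := ext_gr fun n v hv => by
      rw [kap_of_mem _ hv, sgn_even (hi.mul_right n)]; simp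
    simp [hi, this]
  · have : (kap i : C →ₗ[k] C) = sig := by
      rw [← kap_one]
      obtain ⟨l, hl⟩ := Int.not_even_iff_odd.1 hi
      exact LinearMap.ext fun v => kap_congr l (by omega) v
    simp [hi, this]

/-- Both sides are bilinear in `(a, a')`, and the algebra is spanned by homogeneous elements. Since
`measMul` is not packaged as a linear map in its algebra arguments, its additivity and homogeneity
are checked by hand in each variable. -/
theorem measMul_ext [DGC k C] [GrMod k A] [DGA k B] {u : C ⊗[k] A →ₗ[k] B}
    {m : A →ₗ[k] A →ₗ[k] A}
    (h : ∀ i j, ∀ a ∈ gr k A i, ∀ a' ∈ gr k A j, ∀ c, u (c ⊗ₜ m a a') = measMul u a a' c)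
    (c : C) (a a' : A) : u (c ⊗ₜ m a a') = measMul u a a' c := by
  let S (c : C) (a' : A) : Submodule k A :=
    { carrier := {a | u (c ⊗ₜ m a a') = measMul u a a' c}
      add_mem' := fun {x y} hx hy => by
        have : measMul u (x + y) a' = measMul u x a' + measMul u y a' := by
          ext c
          simp only [measMul, map_add, TensorProduct.map_add_left, LinearMap.add_apply,
            LinearMap.comp_apply]
          abel
        simp only [Set.mem_ofPred_eq] at hx hy ⊢
        rw [this, LinearMap.add_apply, ← hx, ← hy]
        simp [TensorProduct.tmul_add]
      zero_mem' := by simp [measMul]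
      smul_mem' := fun r x hx => by
        simp only [Set.mem_ofPred_eq] at hx ⊢
        rw [map_smul, LinearMap.smul_apply, TensorProduct.tmul_smul, map_smul, hx]
        simp [measMul, TensorProduct.map_smul_left] }
  let T (c : C) (a : A) : Submodule k A :=
    { carrier := {a' | u (c ⊗ₜ m a a') = measMul u a a' c}
      add_mem' := fun {x y} hx hy => by
        have : measMul u a (x + y) = measMul u a x + measMul u a y := by
          ext c
          simp only [measMul, map_add, TensorProduct.map_add_right, LinearMap.add_apply,
            LinearMap.comp_apply, LinearMap.add_comp]
          abel
        simp only [Set.mem_ofPred_eq] at hx hy ⊢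
        rw [this, LinearMap.add_apply, ← hx, ← hy]
        simp [TensorProduct.tmul_add]
      zero_mem' := by simp [measMul]
      smul_mem' := fun r x hx => by
        simp only [Set.mem_ofPred_eq] at hx ⊢
        rw [map_smul, TensorProduct.tmul_smul, map_smul, hx]
        simp [measMul, TensorProduct.map_smul_right, LinearMap.smul_comp] }
  exact mem_of_gr (S c a') (fun i a ha =>
    mem_of_gr (T c a) (fun j a' ha' => h i j a ha a' ha' c) a') a

end

/-! ### Measurings and maps out of the tensoring -/

theorem quotMk_eq {A : DGAlg k} {I : Submodule k A} (hI : IsDGIdeal A I) {x y : A}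
    (h : x - y ∈ I) : DGAlg.Hom.toLin (quotMk A I hI) x = DGAlg.Hom.toLin (quotMk A I hI) y :=
  (Submodule.Quotient.eq I).2 h

theorem measMul_comp {C : CoDGA k} {A B B' : DGAlg k} (u : C ⊗[k] A →ₗ[k] B) (g : B ⟶ B')
    (a a' : A) (c : C) : DGAlg.Hom.toLin g (measMul u a a' c) =
      measMul (DGAlg.Hom.toLin g ∘ₗ u) a a' c :=
  measMul_map (f := LinearMap.id) (h := LinearMap.id) id_homDeg (fun c => by simp)
    id_homDeg (DGAlg.Hom.map_mul g) (fun _ _ => rfl) a a' c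

theorem freeGen_homDeg {V : Type u} [AddCommGroup V] [Module k V] [DGMod k V] :
    freeGen k V ∈ homDeg k V (freeAlg k V) 0 := fun n v hv => by
  rw [add_zero]; exact letter_mem hv

theorem d_freeGen {V : Type u} [AddCommGroup V] [Module k V] [DGMod k V] (v : V) :
    dd k (freeAlg k V) (freeGen k V v) = freeGen k V (dd k V v) :=
  der_letter (letter k V ∘ₗ dd k V) v

/-- The projection of the free algebra onto `C ▷ A`. -/
noncomputable def tenMk (C : CoDGA k) (A : DGAlg k) : freeAlg k (C ⊗[k] A) ⟶ tenObj C A :=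
  quotMk _ _ (dgSpan_isDGIdeal _ (tenRel C A))

theorem tenU_eq (C : CoDGA k) (A : DGAlg k) :
    tenU C A = DGAlg.Hom.toLin (tenMk C A) ∘ₗ freeGen k (C ⊗[k] A) := rfl

theorem tenMk_eq {C : CoDGA k} {A : DGAlg k} {x y : freeAlg k (C ⊗[k] A)}
    (h : x - y ∈ tenRel C A) :
    DGAlg.Hom.toLin (tenMk C A) x = DGAlg.Hom.toLin (tenMk C A) y :=
  quotMk_eq _ (subset_dgSpan _ _ h)

/-- The generating relations of the ideal are precisely the defects of the measuring identity for
the inclusion of generators, so the identity holds after projection. -/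
theorem tenU_isMeas (C : CoDGA k) (A : DGAlg k) : IsMeas (tenU C A) where
  deg := by
    rw [tenU_eq]
    exact homDeg_comp (DGAlg.Hom.homDeg _) freeGen_homDeg (add_zero 0)
  comm_d t := by
    rw [tenU_eq, LinearMap.comp_apply, LinearMap.comp_apply, ← d_freeGen, DGAlg.Hom.comm_d]
  meas c a a' := by
    rw [tenU_eq, LinearMap.comp_apply, ← measMul_comp]
    exact tenMk_eq ⟨c, a, a', rfl⟩

theorem IsMeas.comp {C : CoDGA k} {A B B' : DGAlg k} {u : C ⊗[k] A →ₗ[k] B} (hu : IsMeas u)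
    (g : B ⟶ B') : IsMeas (DGAlg.Hom.toLin g ∘ₗ u) where
  deg := homDeg_comp (DGAlg.Hom.homDeg g) hu.deg (add_zero 0)
  comm_d t := by rw [LinearMap.comp_apply, hu.comm_d, DGAlg.Hom.comm_d]; rfl
  meas c a a' := by
    rw [LinearMap.comp_apply, hu.meas, measMul_comp]

/-- The map from a free algebra that extends a map of dg vector spaces. -/
noncomputable def freeLift {V : Type u} [AddCommGroup V] [Module k V] [DGMod k V] {B : DGAlg k}
    (f : V →ₗ[k] B) (hf : f ∈ homDeg k V B 0) (df : ∀ v, f (dd k V v) = dd k B (f v)) :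
    freeAlg k V ⟶ B where
  toLin := wlift f
  deg n x hx := by have := wlift_homDeg hf n x hx; rwa [add_zero] at this
  comm_d := wlift_der hf _ fun v => by rw [LinearMap.comp_apply, wlift_letter, df]
  map_mul := wlift_conc f

theorem freeLift_gen {V : Type u} [AddCommGroup V] [Module k V] [DGMod k V] {B : DGAlg k}
    (f : V →ₗ[k] B) (hf : f ∈ homDeg k V B 0) (df : ∀ v, f (dd k V v) = dd k B (f v)) (v : V) :
    DGAlg.Hom.toLin (freeLift f hf df) (freeGen k V v) = f v := wlift_letter f v

/-- Kernels of morphisms are dg ideals. -/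
theorem ker_isDGIdeal {A B : DGAlg k} (f : A ⟶ B) :
    IsDGIdeal A (LinearMap.ker (DGAlg.Hom.toLin f)) where
  graded x hx n := by
    rw [LinearMap.mem_ker] at hx ⊢
    rw [cmp_comm (DGAlg.Hom.homDeg f), hx, map_zero]
  d_mem x hx := by
    rw [LinearMap.mem_ker] at hx ⊢
    rw [DGAlg.Hom.comm_d, hx, map_zero]
  mul_left a x hx := by
    rw [LinearMap.mem_ker] at hx ⊢
    rw [DGAlg.Hom.map_mul, hx, map_zero]
  mul_right a x hx := by
    rw [LinearMap.mem_ker] at hx ⊢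
    rw [DGAlg.Hom.map_mul, hx, map_zero, LinearMap.zero_apply]

/-- The universal property of `C ▷ A`. -/
noncomputable def tenLift {C : CoDGA k} {A B : DGAlg k} {u : C ⊗[k] A →ₗ[k] B} (hu : IsMeas u) :
    tenObj C A ⟶ B :=
  quotLift (dgSpan_isDGIdeal _ _) (freeLift u hu.deg hu.comm_d) fun x hx => by
    -- The ideal of relations is the intersection of all dg ideals containing the relations. It
    -- suffices that the kernel of the free extension is one of these, and this is the measuring
    -- identity for `u`.
    refine Submodule.mem_sInf.1 hx _ ⟨ker_isDGIdeal (freeLift u hu.deg hu.comm_d), ?_⟩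
    rintro _ ⟨c, a, a', rfl⟩
    rw [SetLike.mem_coe, LinearMap.mem_ker, map_sub, freeLift_gen, hu.meas, sub_eq_zero]
    exact (measMul_map (f := LinearMap.id) (h := LinearMap.id) id_homDeg (fun c => by simp)
      id_homDeg (DGAlg.Hom.map_mul (freeLift u hu.deg hu.comm_d))
      (fun _ _ => freeLift_gen _ _ _ _) a a' c).symm

theorem tenLift_u {C : CoDGA k} {A B : DGAlg k} {u : C ⊗[k] A →ₗ[k] B} (hu : IsMeas u)
    (t : C ⊗[k] A) : DGAlg.Hom.toLin (tenLift hu) (tenU C A t) = u t :=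
  freeLift_gen u hu.deg hu.comm_d t

end Meas

/-! ### Measurings and the convolution algebra -/

section Adjoint

variable {k : Type u} [Field k]

-- Splitting both factors of a pure tensor into homogeneous components, every tensor is a sum of
-- homogeneous pure ones. `P` only has to be additive, so that an equation of linear expressions can
-- be used as it stands, without building a submodule.
@[elab_as_elim]
theorem tensor_gr_induction {V W : Type u} [AddCommGroup V] [Module k V] [AddCommGroup W]
    [Module k W] [GrMod k V] [GrMod k W] {P : V ⊗[k] W → Prop} (zero : P 0)
    (add : ∀ s t, P s → P t → P (s + t))
    (tmul : ∀ i j, ∀ v ∈ gr k V i, ∀ w ∈ gr k W j, P (v ⊗ₜ w)) (t : V ⊗[k] W) : P t := by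
  let S : AddSubmonoid (V ⊗[k] W) :=
    { carrier := {t | P t}, add_mem' := fun hs ht => add _ _ hs ht, zero_mem' := zero }
  induction t using TensorProduct.induction_on with
  | zero => exact zero
  | add x y hx hy => exact add _ _ hx hy
  | tmul v w =>
    show v ⊗ₜ[k] w ∈ S
    rw [← sum_cmp (k := k) v, ← sum_cmp (k := k) w, Finsupp.sum, Finsupp.sum,
      TensorProduct.sum_tmul]
    refine S.sum_mem fun i _ => ?_
    rw [TensorProduct.tmul_sum]
    exact S.sum_mem fun j _ => tmul i j _ (cmp_mem i v) _ (cmp_mem j w)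

/-! ### The sign-twisted adjoint of a map out of a tensor product -/

section
variable {C V B : Type u} [AddCommGroup C] [Module k C] [AddCommGroup V] [Module k V]
  [AddCommGroup B] [Module k B]

variable (k C V) in
/-- The sign operator `c ⊗ v ↦ (-1)^{|v||c|} c ⊗ v`. -/
noncomputable def bsgn [GrMod k C] [GrMod k V] : C ⊗[k] V →ₗ[k] C ⊗[k] V :=
  TensorProduct.map LinearMap.id ev + TensorProduct.map sig od

theorem bsgn_of_mem [GrMod k C] [GrMod k V] (c : C) {i : ℤ} {v : V} (hv : v ∈ gr k V i) :
    bsgn k C V (c ⊗ₜ v) = kap (k := k) i c ⊗ₜ v := by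
  have h : (kap i : C →ₗ[k] C) = ev (k := k) + sgn k i • od := (ev_add_od i).symm
  rw [bsgn, LinearMap.add_apply, TensorProduct.map_tmul, TensorProduct.map_tmul, ev_of_mem hv,
    od_of_mem hv]
  by_cases hi : Even i
  · have : (kap i : C →ₗ[k] C) = LinearMap.id := ext_gr fun n v hv => by
      rw [kap_of_mem _ hv, sgn_even (hi.mul_right n)]; simp
    simp [hi, this]
  · have : (kap i : C →ₗ[k] C) = sig := by
      rw [← kap_one]
      obtain ⟨l, hl⟩ := Int.not_even_iff_odd.1 hi
      exact LinearMap.ext fun v => kap_congr l (by omega) v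
    simp [hi, this]

/-- The sign `(-1)^{|v||c|}` squares to one. Hence passing to the twisted adjoint is reversible,
which is what makes `convEquiv` a bijection. -/
theorem bsgn_bsgn [GrMod k C] [GrMod k V] (t : C ⊗[k] V) : bsgn k C V (bsgn k C V t) = t := by
  refine tensor_gr_induction (by simp) (fun s t hs ht => by rw [map_add, map_add, hs, ht]) ?_ t
  intro i j c hc v hv
  rw [bsgn_of_mem c hv, bsgn_of_mem _ hv, kap_kap, kap_of_mem _ hc, sgn_even, one_smul]
  exact (Even.add_self j).mul_right i

theorem kap_mem [GrMod k V] (q : ℤ) {n : ℤ} {v : V} (hv : v ∈ gr k V n) :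
    kap (k := k) q v ∈ gr k V n := degOp_mem _ hv

theorem d_mem [DGMod k V] {n : ℤ} {v : V} (hv : v ∈ gr k V n) : dd k V v ∈ gr k V (n - 1) :=
  DGMod.d_deg n v hv

/-- The adjoint `v ↦ (c ↦ (-1)^{|v||c|} u (c ⊗ v))` of `u : C ⊗ V → B`. -/
noncomputable def adjLin [GrMod k C] [GrMod k V] (u : C ⊗[k] V →ₗ[k] B) : V →ₗ[k] C →ₗ[k] B :=
  (TensorProduct.curry (u ∘ₗ bsgn k C V)).flip

theorem adjLin_apply [GrMod k C] [GrMod k V] (u : C ⊗[k] V →ₗ[k] B) (v : V) (c : C) :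
    adjLin u v c = u (bsgn k C V (c ⊗ₜ v)) := rfl

theorem adjLin_of_mem [GrMod k C] [GrMod k V] (u : C ⊗[k] V →ₗ[k] B) {i : ℤ} {v : V}
    (hv : v ∈ gr k V i) (c : C) : adjLin u v c = u (kap (k := k) i c ⊗ₜ v) := by
  rw [adjLin_apply, bsgn_of_mem c hv]

theorem adjLin_homDeg [GrMod k C] [GrMod k V] [GrMod k B] {u : C ⊗[k] V →ₗ[k] B}
    (hu : u ∈ homDeg k (C ⊗[k] V) B 0) {i : ℤ} {v : V} (hv : v ∈ gr k V i) :
    adjLin u v ∈ homDeg k C B i := fun n c hc => by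
  rw [adjLin_of_mem u hv]
  have := hu _ _ (tmul_mem_gr (kap_mem i hc) hv rfl)
  rwa [add_zero] at this

/-- The adjoint of a map of degree `0`, with values in the internal hom. -/
noncomputable def adj [GrMod k C] [GrMod k V] [GrMod k B] (u : C ⊗[k] V →ₗ[k] B)
    (hu : u ∈ homDeg k (C ⊗[k] V) B 0) : V →ₗ[k] IHom k C B :=
  (adjLin u).codRestrict (iHomSub k C B) fun v =>
    mem_of_gr ((iHomSub k C B).comap (adjLin u))
      (fun i _ hv => homDeg_le i (adjLin_homDeg hu hv)) v

theorem coe_adj [GrMod k C] [GrMod k V] [GrMod k B] (u : C ⊗[k] V →ₗ[k] B)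
    (hu : u ∈ homDeg k (C ⊗[k] V) B 0) (v : V) : (adj u hu v : C →ₗ[k] B) = adjLin u v := rfl

theorem adj_mem [GrMod k C] [GrMod k V] [GrMod k B] {u : C ⊗[k] V →ₗ[k] B}
    (hu : u ∈ homDeg k (C ⊗[k] V) B 0) {i : ℤ} {v : V} (hv : v ∈ gr k V i) :
    adj u hu v ∈ gr k (IHom k C B) i := adjLin_homDeg hu hv

/-- The twist is responsible for the signs: lowering the degree of `v` by one changes `kap i` to
`sig ∘ kap i`, which is the sign of `1 ⊗ d` on the tensor product. Moving `d` past `kap i` costs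
`(-1)^i`, which cancels the sign in the differential `d f - (-1)^{|f|} f d` of the internal hom. -/
theorem adj_d [DGMod k C] [DGMod k V] [DGMod k B] {u : C ⊗[k] V →ₗ[k] B}
    (hu : u ∈ homDeg k (C ⊗[k] V) B 0) (du : ∀ t, u (dd k (C ⊗[k] V) t) = dd k B (u t)) (v : V) :
    adj u hu (dd k V v) = dd k (IHom k C B) (adj u hu v) := by
  have : adj u hu ∘ₗ dd k V = dd k (IHom k C B) ∘ₗ adj u hu := ext_gr fun i v hv => by
    refine Subtype.ext (LinearMap.ext fun c => ?_)
    have h1 : kap (k := k) (i - 1) c = sig (k := k) (kap (k := k) i c) := by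
      rw [← kap_one, kap_kap]
      exact kap_congr (-1) (by omega) c
    rw [LinearMap.comp_apply, LinearMap.comp_apply, coe_d_iHom, coe_adj, coe_adj,
      dHom_of_mem (adjLin_homDeg hu hv), adjLin_of_mem u (d_mem hv)]
    simp only [LinearMap.sub_apply, LinearMap.comp_apply, LinearMap.smul_apply,
      adjLin_of_mem u hv, ← du, d_tmul, map_add, d_kap, h1, ← TensorProduct.smul_tmul', map_smul,
      smul_smul, sgn_mul_self, one_smul]
    abel
  exact LinearMap.congr_fun this v

end

section
variable {C D A B E : Type u} [AddCommGroup C] [Module k C] [AddCommGroup A] [Module k A]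
  [AddCommGroup B] [Module k B] [AddCommGroup D] [Module k D] [AddCommGroup E] [Module k E]

/-- The comultiplication preserves degrees, so `kap n` is distributed over both tensor factors. On
the second one it merges with the sign `kap i` of the measuring identity. -/
theorem measMul_kap [DGC k C] [GrMod k A] [DGA k B] (u : C ⊗[k] A →ₗ[k] B) {i : ℤ} {a : A}
    (ha : a ∈ gr k A i) (a' : A) (n : ℤ) (c : C) :
    measMul u a a' (kap (k := k) n c) = TensorProduct.lift (mu k B)
      (TensorProduct.map ((TensorProduct.curry u).flip a ∘ₗ kap n)
        ((TensorProduct.curry u).flip a' ∘ₗ kap (i + n)) (Del k C c)) := by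
  have h : (kap (i + n) : C →ₗ[k] C) = kap i ∘ₗ kap n :=
    LinearMap.ext fun c => (kap_kap i n c).symm
  rw [measMul_of_mem u ha, comul_kap, TensorProduct.map_map, h]
  rfl

/-- The adjoint of `a a'` carries the twist `kap (i + j)`. On the first factor this is the twist of
`a` times the Koszul sign `kap j` of the convolution product. On the second factor it combines with
the measuring sign to `kap (2i + j)`, which is the twist of `a'`. -/
theorem adj_mul [DGC k C] [DGA k A] [DGA k B] {u : C ⊗[k] A →ₗ[k] B} (hu : IsMeas u)
    (a a' : A) : adj u hu.deg (mu k A a a') =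
      mu k (IHom k C B) (adj u hu.deg a) (adj u hu.deg a') := by
  have : adj u hu.deg ∘ₗ TensorProduct.lift (mu k A) = TensorProduct.lift
      ((mu k (IHom k C B)).compl₁₂ (adj u hu.deg) (adj u hu.deg)) := ext_gr₂ fun i j a ha a' ha' => by
    refine Subtype.ext (LinearMap.ext fun c => ?_)
    show adjLin u (mu k A a a') c = convMul k C B (adjLin u a) (adjLin u a') c
    rw [adjLin_of_mem u (DGA.mul_deg i j a ha a' ha'), hu.meas, measMul_kap u ha,
      convMul_of_mem _ (adjLin_homDeg hu.deg ha')]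
    have h1 : (TensorProduct.curry u).flip a ∘ₗ kap (i + j) = adjLin u a ∘ₗ kap j := by
      ext c; simp [adjLin_of_mem u ha, kap_kap]
    have h2 : (TensorProduct.curry u).flip a' ∘ₗ kap (i + (i + j)) = adjLin u a' := by
      ext c; simp [adjLin_of_mem u ha', kap_congr (k := k) i (by omega : i + (i + j) = j + 2 * i)]
    rw [h1, h2]; rfl
  exact LinearMap.congr_fun this (a ⊗ₜ a')

/-- A morphism of algebras `A → {C, B}` gives a measuring `C ⊗ A → B`. -/
theorem isMeas_of_adj [DGC k C] [DGA k A] [DGA k B] {u : C ⊗[k] A →ₗ[k] B}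
    (hu : u ∈ homDeg k (C ⊗[k] A) B 0)
    (hd : ∀ a, adj u hu (dd k A a) = dd k (IHom k C B) (adj u hu a))
    (hm : ∀ a a', adj u hu (mu k A a a') = mu k (IHom k C B) (adj u hu a) (adj u hu a')) :
    IsMeas u where
  deg := hu
  comm_d t := by
    -- The adjoint of `a` involves `u` at `kap i c`. Evaluating the chain map identity at `kap i c`
    -- instead of `c` undoes this twist, since `kap i` is an involution.
    have key : ∀ i, ∀ a ∈ gr k A i, ∀ c, adjLin u (dd k A a) (kap (k := k) i c) =
        dHom k C B (adjLin u a) (kap (k := k) i c) := fun i a _ c =>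
      LinearMap.congr_fun (congrArg Subtype.val (hd a)) _
    refine tensor_gr_induction (by simp) (fun s t hs ht => by simp only [map_add, hs, ht]) ?_ t
    intro j i c hc a ha
    have h := key i a ha c
    have h0 : kap (k := k) (i + i) c = c := by
      rw [kap_of_mem _ hc, sgn_even ((Even.add_self i).mul_right j), one_smul]
    have h0' : kap (k := k) (i + i) (dd k C c) = dd k C c := by
      rw [d_kap, h0, sgn_even (Even.add_self i), one_smul]
    have h1 : kap (k := k) (i - 1 + i) c = sig (k := k) c := by
      rw [← kap_one]
      exact kap_congr (i - 1) (by omega) c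
    rw [adjLin_of_mem u (d_mem ha), kap_kap, h1, dHom_of_mem (adjLin_homDeg hu ha)] at h
    simp only [LinearMap.sub_apply, LinearMap.comp_apply, LinearMap.smul_apply,
      adjLin_of_mem u ha, kap_kap, h0] at h
    have h2 : sgn k i • u (kap (k := k) i (dd k C (kap (k := k) i c)) ⊗ₜ[k] a) =
        u (dd k C c ⊗ₜ a) := by
      rw [d_kap, kap_kap, h0, ← TensorProduct.smul_tmul', map_smul, smul_smul, sgn_mul_self,
        one_smul]
    rw [h2] at h
    rw [d_tmul, map_add, h]
    abel
  meas c a a' := by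
    refine measMul_ext (fun i j a ha a' ha' c => ?_) c a a'
    have h0 : ∀ c : C, kap (k := k) (i + j + (i + j)) c = c := fun c => by
      rw [kap_congr (k := k) (n := 0) (i + j) (by omega) c]
      have : (kap 0 : C →ₗ[k] C) = LinearMap.id := ext_gr fun n v hv => by
        rw [kap_of_mem _ hv, zero_mul, sgn_even Even.zero, one_smul]; rfl
      rw [this]; rfl
    -- Again the twist is undone, now with `kap (i + j)` because the product has degree `i + j`.
    have h : adjLin u (mu k A a a') (kap (k := k) (i + j) c) =
        convMul k C B (adjLin u a) (adjLin u a') (kap (k := k) (i + j) c) :=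
      LinearMap.congr_fun (congrArg Subtype.val (hm a a')) _
    rw [adjLin_of_mem u (DGA.mul_deg i j a ha a' ha'), kap_kap, h0] at h
    rw [h, measMul_of_mem u ha, convMul_of_mem _ (adjLin_homDeg hu ha'), LinearMap.comp_apply,
      LinearMap.comp_apply, comul_kap, TensorProduct.map_map]
    have h1 : (adjLin u a ∘ₗ kap j) ∘ₗ kap (i + j) = (TensorProduct.curry u).flip a := by
      ext c
      simp [adjLin_of_mem u ha, kap_kap, ← add_assoc]
      rw [kap_congr (k := k) (n := i + j + (i + j)) 0 (by omega), h0]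
    have h2 : adjLin u a' ∘ₗ kap (i + j) = (TensorProduct.curry u).flip a' ∘ₗ kap i := by
      ext c
      simp [adjLin_of_mem u ha', kap_kap, kap_congr (k := k) j (by omega : j + (i + j) = i + 2 * j)]
    rw [h1, h2]

/-! ### Composition and currying of measurings -/

theorem assoc_homDeg [GrMod k C] [GrMod k D] [GrMod k A] :
    (TensorProduct.assoc k C D A).toLinearMap ∈
      homDeg k ((C ⊗[k] D) ⊗[k] A) (C ⊗[k] (D ⊗[k] A)) 0 :=
  tensor_homDeg fun i j t ht e he => by
    refine tensor_gr_le ((TensorProduct.assoc k C D A).toLinearMap ∘ₗ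
      (TensorProduct.mk k (C ⊗[k] D) A).flip e) _ i (fun a b hab c hc d hd => ?_) t ht
    exact tmul_mem_gr hc (tmul_mem_gr hd he rfl) (by omega)

theorem assoc_d [DGMod k C] [DGMod k D] [DGMod k A] (t : (C ⊗[k] D) ⊗[k] A) :
    TensorProduct.assoc k C D A (dd k ((C ⊗[k] D) ⊗[k] A) t) =
      dd k (C ⊗[k] (D ⊗[k] A)) (TensorProduct.assoc k C D A t) := by
  have : (TensorProduct.assoc k C D A).toLinearMap ∘ₗ dd k ((C ⊗[k] D) ⊗[k] A) =
      dd k (C ⊗[k] (D ⊗[k] A)) ∘ₗ (TensorProduct.assoc k C D A).toLinearMap := by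
    apply TensorProduct.ext_threefold
    intro c d e
    simp [d_tmul, sig_tmul, TensorProduct.add_tmul, TensorProduct.tmul_add, add_assoc]
  exact LinearMap.congr_fun this t

/-- The composite `(c ⊗ d) ⊗ a ↦ u (c ⊗ v (d ⊗ a))`. -/
noncomputable def measComp (u : C ⊗[k] B →ₗ[k] E) (v : D ⊗[k] A →ₗ[k] B) :
    (C ⊗[k] D) ⊗[k] A →ₗ[k] E :=
  u ∘ₗ TensorProduct.map LinearMap.id v ∘ₗ (TensorProduct.assoc k C D A).toLinearMap

theorem measComp_tmul (u : C ⊗[k] B →ₗ[k] E) (v : D ⊗[k] A →ₗ[k] B) (c : C) (d : D) (a : A) :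
    measComp u v ((c ⊗ₜ d) ⊗ₜ a) = u (c ⊗ₜ v (d ⊗ₜ a)) := rfl

theorem Del_tmul [DGC k C] [DGC k D] (c : C) (d : D) :
    Del k (C ⊗[k] D) (c ⊗ₜ d) = shuf k C C D D (Del k C c ⊗ₜ Del k D d) := rfl

/-- The identity for `v` turns `v(d ⊗ a a')` into a sum of products, to which the identity for `u`
applies. The resulting double sum over `Δ c` and `Δ d` is the sum over the comultiplication of `c ⊗
d`, and the sign of the interchange map in the latter is exactly the one that appears. -/
theorem IsMeas.measComp [DGC k C] [DGC k D] [DGA k A] [DGA k B] [DGA k E]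
    {u : C ⊗[k] B →ₗ[k] E} {v : D ⊗[k] A →ₗ[k] B} (hu : IsMeas u) (hv : IsMeas v) :
    IsMeas (measComp u v) where
  deg := homDeg_comp hu.deg (homDeg_comp (map_homDeg id_homDeg hv.deg (add_zero 0)) assoc_homDeg
    (add_zero 0)) (add_zero 0)
  comm_d t := by
    show u (TensorProduct.map LinearMap.id v (TensorProduct.assoc k C D A _)) = _
    rw [assoc_d, d_map id_homDeg (fun _ => rfl) hv.comm_d, hu.comm_d]; rfl
  meas t a a' := by
    refine measMul_ext (fun i j a ha a' ha' t => ?_) t a a'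
    induction t using TensorProduct.induction_on with
    | zero => simp
    | add x y hx hy => rw [TensorProduct.add_tmul, map_add, map_add, hx, hy]
    | tmul c d =>
      rw [measComp_tmul, hv.meas, measMul_of_mem v ha, measMul_of_mem _ ha, Del_tmul]
      generalize Del k D d = s
      refine tensor_gr_induction (by simp)
        (fun s t hs ht => by simp only [map_add, TensorProduct.tmul_add, hs, ht]) ?_ s
      intro p q x hx y hy
      -- Here `v(x ⊗ a)` has degree `p + i`, not `i`. In the measuring identity for `u` the extra
      -- `p` contributes `(-1)^{|c''||x|}`, the interchange sign of `Δ(c ⊗ d)`.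
      have hva := hv.deg _ _ (tmul_mem_gr hx ha rfl)
      rw [add_zero] at hva
      rw [TensorProduct.map_tmul, TensorProduct.lift.tmul, hu.meas]
      change measMul u (v (x ⊗ₜ a)) _ c = _
      rw [measMul_of_mem u hva]
      generalize Del k C c = t
      refine tensor_gr_induction (by simp)
        (fun s t hs ht => by simp only [map_add, TensorProduct.add_tmul, hs, ht]) ?_ t
      intro r s c' _ c'' hc''
      rw [shuf_of_mem _ _ hc'' hx]
      simp only [map_smul, TensorProduct.map_tmul, TensorProduct.lift.tmul, LinearMap.comp_apply,
        LinearMap.flip_apply, TensorProduct.curry_apply, measComp_tmul, kap_tmul, LinearMap.smul_apply,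
        kap_of_mem _ hc'', kap_of_mem _ hy, TensorProduct.tmul_smul, ← TensorProduct.smul_tmul',
        smul_smul, ← sgn_add]
      congr 2
      ring

end

end Adjoint

/-! ### Currying a measuring out of a tensor product of coalgebras -/

section Curry

variable {k : Type u} [Field k] {C D A E : Type u} [AddCommGroup C] [Module k C] [AddCommGroup A]
  [Module k A] [AddCommGroup D] [Module k D] [AddCommGroup E] [Module k E]

variable (k C E) in
/-- The evaluation `f ↦ f c` on the internal hom. -/
noncomputable def evalAt [GrMod k C] [GrMod k E] (c : C) : IHom k C E →ₗ[k] E :=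
  LinearMap.applyₗ c ∘ₗ (iHomSub k C E).subtype

/-- This is the sign computation behind `IsMeas.curry`. A product in `{C, E}` evaluated at `c` is a
sum over `Δ c`, and together with `s` it becomes a sum over the interchanged tensor in `(C ⊗ D) ⊗ (C
⊗ D)`. The twist `kap (l + (i + j))` records the total degree of everything that `c` is moved past.
The map `m` enters only through `hm1` and `hm2`, so the adjoint need not be unfolded. -/
theorem measMul_curry [DGC k C] [DGC k D] [DGA k A] [DGA k E]
    {w : (C ⊗[k] D) ⊗[k] A →ₗ[k] E} (m : D ⊗[k] A →ₗ[k] IHom k C E)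
    (hm1 : ∀ {l : ℤ} {t : D ⊗[k] A}, t ∈ gr k (D ⊗[k] A) l → ∀ c, (m t : C →ₗ[k] E) c =
        w ((TensorProduct.assoc k C D A).symm (kap (k := k) l c ⊗ₜ t)))
    (hm2 : ∀ {l : ℤ} {t : D ⊗[k] A}, t ∈ gr k (D ⊗[k] A) l →
        (m t : C →ₗ[k] E) ∈ homDeg k C E l) {i j l : ℤ} {a a' : A} (ha : a ∈ gr k A i)
    (ha' : a' ∈ gr k A j) {s : D ⊗[k] D} (hs : s ∈ gr k (D ⊗[k] D) l) (c : C) :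
    evalAt k C E c (TensorProduct.lift (mu k (IHom k C E)) (TensorProduct.map
        ((TensorProduct.curry m).flip a) ((TensorProduct.curry m).flip a' ∘ₗ kap i) s)) =
      TensorProduct.lift (mu k E) (TensorProduct.map ((TensorProduct.curry w).flip a)
        ((TensorProduct.curry w).flip a' ∘ₗ kap i)
          (shuf k C C D D (Del k C (kap (k := k) (l + (i + j)) c) ⊗ₜ s))) := by
  -- Both sides are regarded as linear maps in `s`. Their difference vanishes in degree `l` once it
  -- does so on `x ⊗ y` with `|x| + |y| = l`. The degree of `s` must stay fixed because it occurs in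
  -- the twist on the right.
  let F : D ⊗[k] D →ₗ[k] E := evalAt k C E c ∘ₗ TensorProduct.lift (mu k (IHom k C E)) ∘ₗ
    TensorProduct.map ((TensorProduct.curry m).flip a) ((TensorProduct.curry m).flip a' ∘ₗ kap i)
  let G : D ⊗[k] D →ₗ[k] E := TensorProduct.lift (mu k E) ∘ₗ
    TensorProduct.map ((TensorProduct.curry w).flip a) ((TensorProduct.curry w).flip a' ∘ₗ kap i) ∘ₗ
      shuf k C C D D ∘ₗ TensorProduct.mk k _ _ (Del k C (kap (k := k) (l + (i + j)) c))
  have key := tensor_gr_le (F - G) ⊥ l ?_ s hs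
  · exact sub_eq_zero.1 key
  intro p q hpq x hx y hy
  rw [Submodule.mem_bot, LinearMap.sub_apply, sub_eq_zero]
  have e : F (x ⊗ₜ y) =
      convMul k C E (m (x ⊗ₜ a) : C →ₗ[k] E) (m (kap (k := k) i y ⊗ₜ a') : C →ₗ[k] E) c := rfl
  have e' : G (x ⊗ₜ y) = TensorProduct.lift (mu k E)
      (TensorProduct.map ((TensorProduct.curry w).flip a)
        ((TensorProduct.curry w).flip a' ∘ₗ kap i)
          (shuf k C C D D (Del k C (kap (k := k) (l + (i + j)) c) ⊗ₜ (x ⊗ₜ y)))) := rfl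
  clear_value F G
  rw [e, e', convMul_of_mem _ (hm2 (tmul_mem_gr (kap_mem i hy) ha' rfl)), comul_kap]
  simp only [LinearMap.comp_apply]
  generalize Del k C c = t
  refine tensor_gr_induction (by simp)
    (fun s t hs ht => by simp only [map_add, TensorProduct.add_tmul, hs, ht]) ?_ t
  intro r s c' hc' c'' hc''
  rw [TensorProduct.map_tmul, TensorProduct.map_tmul, shuf_of_mem _ _ (kap_mem _ hc'') hx]
  simp only [map_smul, TensorProduct.map_tmul, TensorProduct.lift.tmul, LinearMap.comp_apply,
    LinearMap.flip_apply, TensorProduct.curry_apply, kap_tmul,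
    hm1 (tmul_mem_gr hx ha rfl), hm1 (tmul_mem_gr hy ha' rfl), Submodule.coe_smul,
    TensorProduct.assoc_symm_tmul, LinearMap.smul_apply,
    kap_of_mem _ hc'', kap_of_mem _ hc', kap_of_mem _ hy, TensorProduct.tmul_smul,
    ← TensorProduct.smul_tmul', smul_smul, ← sgn_add]
  congr 1
  subst hpq
  -- On the right the twist contributes `s(p + i)` to the exponent, and the interchange together
  -- with the measuring sign contributes `sp + is` once more. On the left these terms are absent, so
  -- the exponents differ by twice `sp + si`.
  refine sgn_congr (-(s * p + s * i)) ?_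
  ring

/-- The measuring `D ⊗ A → {C, E}` adjoint to a measuring `(C ⊗ D) ⊗ A → E`. -/
theorem IsMeas.curry [DGC k C] [DGC k D] [DGA k A] [DGA k E]
    {w : (C ⊗[k] D) ⊗[k] A →ₗ[k] E} (hw : IsMeas w)
    (hw' : w ∘ₗ (TensorProduct.assoc k C D A).symm.toLinearMap ∈
      homDeg k (C ⊗[k] (D ⊗[k] A)) E 0) :
    IsMeas (adj (w ∘ₗ (TensorProduct.assoc k C D A).symm.toLinearMap) hw') where
  deg n t ht := by rw [add_zero]; exact adj_mem hw' ht
  comm_d := adj_d hw' fun t => by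
    obtain ⟨t, rfl⟩ := (TensorProduct.assoc k C D A).surjective t
    simp [← assoc_d, hw.comm_d]
  meas d a a' := by
    refine measMul_ext (fun i j a ha a' ha' d => ?_) d a a'
    -- From here on the adjoint is used only through its values on homogeneous tensors and its
    -- degree.
    generalize hm : adj (w ∘ₗ (TensorProduct.assoc k C D A).symm.toLinearMap) hw' = m
    have hm1 : ∀ {l : ℤ} {t : D ⊗[k] A}, t ∈ gr k (D ⊗[k] A) l → ∀ c, (m t : C →ₗ[k] E) c =
        w ((TensorProduct.assoc k C D A).symm (kap (k := k) l c ⊗ₜ t)) := fun ht c => by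
      rw [← hm, coe_adj, adjLin_of_mem _ ht]; rfl
    have hm2 : ∀ {l : ℤ} {t : D ⊗[k] A}, t ∈ gr k (D ⊗[k] A) l →
        (m t : C →ₗ[k] E) ∈ homDeg k C E l := fun ht => by
      rw [← hm]; exact adj_mem hw' ht
    -- The identity is linear in `d`, so `d` may be taken homogeneous. Its degree is needed to know
    -- the twist of the adjoint at `d ⊗ a a'`.
    let S : Submodule k D := LinearMap.eqLocus
      (m ∘ₗ (TensorProduct.mk k D A).flip (mu k A a a')) (measMul m a a')
    refine mem_of_gr S (fun l d hd => ?_) d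
    refine Subtype.ext (LinearMap.ext fun c => ?_)
    have hs := comul_homDeg (k := k) l d hd
    rw [add_zero] at hs
    have h1 : (m (d ⊗ₜ mu k A a a') : C →ₗ[k] E) c =
        evalAt k C E c (measMul m a a' d) := by
      rw [hm1 (tmul_mem_gr hd (DGA.mul_deg i j a ha a' ha') rfl), TensorProduct.assoc_symm_tmul,
        hw.meas, measMul_of_mem w ha, measMul_of_mem m ha, Del_tmul,
        measMul_curry m hm1 hm2 ha ha' hs]
    exact h1

end Curry

/-! ### The adjunction between tensoring and convolution -/

section ConvAdj

variable {k : Type u} [Field k] {C D : CoDGA k} {A A' B B' : DGAlg k}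

/-- The morphism `A → {C, B}` adjoint to a measuring. -/
noncomputable def convLift {u : C ⊗[k] A →ₗ[k] B} (hu : IsMeas u) : A ⟶ convObj C B where
  toLin := adj u hu.deg
  deg _ _ ha := adj_mem hu.deg ha
  comm_d := adj_d hu.deg hu.comm_d
  map_mul := adj_mul hu

/-- The underlying linear map `C → B` of an element of the image of `A → {C, B}`. -/
noncomputable def convCoe (f : A ⟶ convObj C B) : A →ₗ[k] C →ₗ[k] B :=
  (iHomSub k C B).subtype ∘ₗ DGAlg.Hom.toLin f

theorem conv_hom_ext {f g : A ⟶ convObj C B} (h : convCoe f = convCoe g) : f = g :=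
  DGAlg.hom_ext (LinearMap.ext fun a => Subtype.ext (LinearMap.congr_fun h a))

theorem convCoe_convLift {u : C ⊗[k] A →ₗ[k] B} (hu : IsMeas u) :
    convCoe (convLift hu) = adjLin u := rfl

/-- The map `C ⊗ A → B` adjoint to `A → {C, B}`. -/
noncomputable def convU (f : A ⟶ convObj C B) : C ⊗[k] A →ₗ[k] B :=
  TensorProduct.lift (convCoe f).flip ∘ₗ bsgn k C A

theorem adjLin_convU (f : A ⟶ convObj C B) : adjLin (convU f) = convCoe f :=
  LinearMap.ext fun a => LinearMap.ext fun c => by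
    rw [adjLin_apply, convU, LinearMap.comp_apply, bsgn_bsgn]; rfl

theorem convU_homDeg (f : A ⟶ convObj C B) : convU f ∈ homDeg k (C ⊗[k] A) B 0 :=
  tensor_homDeg fun i j c hc a ha => by
    rw [convU, LinearMap.comp_apply, bsgn_of_mem c ha, add_zero]
    have := DGAlg.Hom.deg f j a ha i _ (kap_mem j hc)
    exact this

theorem adj_convU (f : A ⟶ convObj C B) (a : A) :
    adj (convU f) (convU_homDeg f) a = DGAlg.Hom.toLin f a :=
  Subtype.ext (LinearMap.congr_fun (adjLin_convU f) a)

theorem convU_isMeas (f : A ⟶ convObj C B) : IsMeas (convU f) :=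
  isMeas_of_adj (convU_homDeg f)
    (fun a => by rw [adj_convU, adj_convU]; exact DGAlg.Hom.comm_d f a)
    (fun a a' => by rw [adj_convU, adj_convU, adj_convU]; exact DGAlg.Hom.map_mul f a a')

/-- The twist in passing to the adjoint and the twist in passing back compose to `bsgn ∘ bsgn`,
which is the identity. -/
theorem convU_eq (f : A ⟶ convObj C B) {u : C ⊗[k] A →ₗ[k] B} (h : convCoe f = adjLin u) :
    convU f = u := LinearMap.ext fun t => by
  have e : ∀ t, TensorProduct.lift (adjLin u).flip t = u (bsgn k C A t) := fun t =>
    LinearMap.congr_fun (TensorProduct.ext' (g := TensorProduct.lift (adjLin u).flip)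
      (h := u ∘ₗ bsgn k C A) fun _ _ => rfl) t
  rw [convU, h, LinearMap.comp_apply, e, bsgn_bsgn]

/-- `DGA₀(C ▷ A, B) ≅ DGA₀(A, {C, B})` -/
noncomputable def convEquiv (C : CoDGA k) (A B : DGAlg k) :
    (tenObj C A ⟶ B) ≃ (A ⟶ convObj C B) where
  toFun g := convLift ((tenU_isMeas C A).comp g)
  invFun f := tenLift (convU_isMeas f)
  left_inv g := ten_hom_ext fun c a => by
    rw [tenLift_u, convU_eq _ (convCoe_convLift ((tenU_isMeas C A).comp g))]; rfl
  right_inv f := conv_hom_ext (by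
    have h : DGAlg.Hom.toLin (tenLift (convU_isMeas f)) ∘ₗ tenU C A = convU f :=
      LinearMap.ext (tenLift_u (convU_isMeas f))
    have h' := convCoe_convLift ((tenU_isMeas C A).comp (tenLift (convU_isMeas f)))
    exact h'.trans ((congrArg adjLin h).trans (adjLin_convU f)))

theorem convEquiv_comp (g : tenObj C A ⟶ B) (h : B ⟶ B') :
    convEquiv C A B' (g ≫ h) = convEquiv C A B g ≫ convMap (𝟙 C) h := rfl

/-- Naturality in the coalgebra and in the algebra at once. It rests on `tenMap` being determined by
its effect on the universal measuring and on morphisms, being of degree zero, commuting with the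
sign operators. -/
theorem convEquiv_tenMap (f : C ⟶ D) (g : A ⟶ A') (h : tenObj D A' ⟶ B) :
    convEquiv C A B (tenMap f g ≫ h) = g ≫ convEquiv D A' B h ≫ convMap f (𝟙 B) := by
  refine conv_hom_ext (LinearMap.ext fun a => LinearMap.ext fun c => ?_)
  have e : ∀ t : C ⊗[k] A, DGAlg.Hom.toLin (tenMap f g) (tenU C A t) =
      tenU D A' (TensorProduct.map (CoDGA.Hom.toLin f) (DGAlg.Hom.toLin g) t) := fun t =>
    LinearMap.congr_fun (TensorProduct.ext' (g := DGAlg.Hom.toLin (tenMap f g) ∘ₗ tenU C A)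
      (h := tenU D A' ∘ₗ TensorProduct.map (CoDGA.Hom.toLin f) (DGAlg.Hom.toLin g))
      fun c a => tenMap_u f g c a) t
  -- The operators `ev`, `od` and `sig` act on each degree by a scalar, so they commute with
  -- degree-preserving maps.
  have hb : ∀ (c : C) (a : A),
      TensorProduct.map (CoDGA.Hom.toLin f) (DGAlg.Hom.toLin g) (bsgn k C A (c ⊗ₜ a)) =
      bsgn k D A' (CoDGA.Hom.toLin f c ⊗ₜ DGAlg.Hom.toLin g a) := fun c a => by
    have h1 : ∀ s : ℤ → k, ∀ x, CoDGA.Hom.toLin f (degOp s x) = degOp s (CoDGA.Hom.toLin f x) :=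
      degOp_comm (CoDGA.Hom.homDeg f)
    have h2 : ∀ s : ℤ → k, ∀ x, DGAlg.Hom.toLin g (degOp s x) = degOp s (DGAlg.Hom.toLin g x) :=
      degOp_comm (DGAlg.Hom.homDeg g)
    simp [bsgn, ev, od, sig, h1, h2]
  show DGAlg.Hom.toLin h (DGAlg.Hom.toLin (tenMap f g) (tenU C A (bsgn k C A (c ⊗ₜ a)))) =
    DGAlg.Hom.toLin h (tenU D A' (bsgn k D A' (CoDGA.Hom.toLin f c ⊗ₜ DGAlg.Hom.toLin g a)))
  rw [e, hb]

theorem convEquiv_symm_comp (g : A ⟶ A') (h : A' ⟶ convObj C B) :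
    (convEquiv C A B).symm (g ≫ h) = tenMap (𝟙 C) g ≫ (convEquiv C A' B).symm h := by
  rw [Equiv.symm_apply_eq, convEquiv_tenMap, Equiv.apply_symm_apply]; rfl

/-- Tensoring with `C` is left adjoint to `{C, -}`. -/
noncomputable def convAdj (C : CoDGA k) :
    (tensoring k).obj C ⊣ (conv k).obj (Opposite.op C) :=
  Adjunction.mkOfHomEquiv
    { homEquiv := convEquiv C
      homEquiv_naturality_left_symm := convEquiv_symm_comp
      homEquiv_naturality_right := convEquiv_comp }

variable (k) in
/-- The tensoring is left adjoint to the convolution algebra, naturally in the coalgebra. -/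
noncomputable def convAdj₂ : tensoring k ⊣₂ conv k :=
  ParametrizedAdjunction.mk' convAdj fun {X Y} f {A B} g => by
    rw [convAdj, convAdj, Adjunction.mkOfHomEquiv_homEquiv, Adjunction.mkOfHomEquiv_homEquiv]
    exact convEquiv_tenMap f (𝟙 A) g

end ConvAdj

/-! ### The module structure -/

section Assoc

variable {k : Type u} [Field k]

theorem kap_kap_self {V : Type u} [AddCommGroup V] [Module k V] [GrMod k V] (q : ℤ) (v : V) :
    kap (k := k) q (kap (k := k) q v) = v := by
  have : (kap q ∘ₗ kap q : V →ₗ[k] V) = LinearMap.id := ext_gr fun n v hv => by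
    rw [LinearMap.comp_apply, kap_kap, kap_of_mem _ hv, sgn_even ((Even.add_self q).mul_right n),
      one_smul]; rfl
  exact LinearMap.congr_fun this v

/-- The elements `u(c ⊗ u(d ⊗ a))` do not visibly generate: `u(c ⊗ b)` for a product `b` in `D ▷ A`
has first to be expanded by the measuring identity. The adjunction does this implicitly, since a
morphism out of `C ▷ (D ▷ A)` is an algebra morphism `D ▷ A → {C, B}`, and such a morphism is
determined by its values on `u(d ⊗ a)`. -/
theorem ten_hom_ext₂ {C D : CoDGA k} {A B : DGAlg k} {f g : tenObj C (tenObj D A) ⟶ B}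
    (h : ∀ (c : C) (d : D) (a : A),
      DGAlg.Hom.toLin f (tenU C (tenObj D A) (c ⊗ₜ tenU D A (d ⊗ₜ a))) =
        DGAlg.Hom.toLin g (tenU C (tenObj D A) (c ⊗ₜ tenU D A (d ⊗ₜ a)))) : f = g := by
  apply (convEquiv C (tenObj D A) B).injective
  have H : ∀ (c : C) (t : D ⊗[k] A), DGAlg.Hom.toLin f (tenU C (tenObj D A) (c ⊗ₜ tenU D A t)) =
      DGAlg.Hom.toLin g (tenU C (tenObj D A) (c ⊗ₜ tenU D A t)) := fun c t => by
    induction t using TensorProduct.induction_on with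
    | zero => simp
    | add x y hx hy => simp only [map_add, TensorProduct.tmul_add, hx, hy]
    | tmul d a => exact h c d a
  -- The twist depends on the degree, and the universal measuring preserves degrees. On homogeneous
  -- `t` both adjoints therefore carry the same explicit sign and `H` applies.
  have hP : adjLin (DGAlg.Hom.toLin f ∘ₗ tenU C (tenObj D A)) ∘ₗ tenU D A =
      adjLin (DGAlg.Hom.toLin g ∘ₗ tenU C (tenObj D A)) ∘ₗ tenU D A :=
    ext_gr fun i t ht => LinearMap.ext fun c => by
      have h0 := (tenU_isMeas D A).deg i t ht
      rw [add_zero] at h0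
      rw [LinearMap.comp_apply, LinearMap.comp_apply, adjLin_of_mem _ h0, adjLin_of_mem _ h0]
      exact H _ t
  exact ten_hom_ext fun d a => Subtype.ext (LinearMap.congr_fun hP (d ⊗ₜ a))

theorem tenTensor_hom_ext {C D : CoDGA k} {A B : DGAlg k} {f g : tenObj (tensorObj C D) A ⟶ B}
    (h : ∀ (c : C) (d : D) (a : A),
      DGAlg.Hom.toLin f (tenU (tensorObj C D) A ((c ⊗ₜ[k] d) ⊗ₜ[k] a)) =
        DGAlg.Hom.toLin g (tenU (tensorObj C D) A ((c ⊗ₜ[k] d) ⊗ₜ[k] a))) : f = g := by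
  have e : DGAlg.Hom.toLin f ∘ₗ tenU (tensorObj C D) A =
      DGAlg.Hom.toLin g ∘ₗ tenU (tensorObj C D) A :=
    TensorProduct.ext_threefold (M := C) (N := D) (P := A) h
  exact ten_hom_ext fun t a => LinearMap.congr_fun e (t ⊗ₜ a)

theorem tenTensor_hom_ext₂ {C D E : CoDGA k} {A B : DGAlg k}
    {f g : tenObj (tensorObj (tensorObj C D) E) A ⟶ B}
    (h : ∀ (c : C) (d : D) (e : E) (a : A),
      DGAlg.Hom.toLin f (tenU (tensorObj (tensorObj C D) E) A (((c ⊗ₜ[k] d) ⊗ₜ[k] e) ⊗ₜ[k] a)) =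
        DGAlg.Hom.toLin g (tenU (tensorObj (tensorObj C D) E) A
          (((c ⊗ₜ[k] d) ⊗ₜ[k] e) ⊗ₜ[k] a))) : f = g := by
  have e : DGAlg.Hom.toLin f ∘ₗ tenU (tensorObj (tensorObj C D) E) A =
      DGAlg.Hom.toLin g ∘ₗ tenU (tensorObj (tensorObj C D) E) A :=
    TensorProduct.ext_fourfold (M := C) (N := D) (P := E) (Q := A) h
  exact ten_hom_ext fun t a => LinearMap.congr_fun e (t ⊗ₜ a)

/-- `(C ⊗ D) ▷ A → C ▷ (D ▷ A)` -/
noncomputable def alphaHom (C D : CoDGA k) (A : DGAlg k) :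
    tenObj (tensorObj C D) A ⟶ tenObj C (tenObj D A) :=
  tenLift (C := tensorObj C D) ((tenU_isMeas C (tenObj D A)).measComp (tenU_isMeas D A))

theorem alphaHom_u (C D : CoDGA k) (A : DGAlg k) (c : C) (d : D) (a : A) :
    DGAlg.Hom.toLin (alphaHom C D A) (tenU (tensorObj C D) A ((c ⊗ₜ[k] d) ⊗ₜ[k] a)) =
      tenU C (tenObj D A) (c ⊗ₜ[k] tenU D A (d ⊗ₜ[k] a)) := tenLift_u _ _

theorem assoc_symm_comp_homDeg (C D : CoDGA k) (A : DGAlg k) :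
    tenU (tensorObj C D) A ∘ₗ (TensorProduct.assoc k C D A).symm.toLinearMap ∈
      homDeg k (C ⊗[k] (D ⊗[k] A)) (tenObj (tensorObj C D) A) 0 :=
  homDeg_comp (tenU_isMeas (tensorObj C D) A).deg assoc_symm_homDeg (add_zero 0)

/-- `D ▷ A → {C, (C ⊗ D) ▷ A}` -/
noncomputable def alphaInvAdj (C D : CoDGA k) (A : DGAlg k) :
    tenObj D A ⟶ convObj C (tenObj (tensorObj C D) A) :=
  tenLift (B := convObj C (tenObj (tensorObj C D) A))
    ((tenU_isMeas (tensorObj C D) A).curry (C := C) (D := D) (assoc_symm_comp_homDeg C D A))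

/-- `C ▷ (D ▷ A) → (C ⊗ D) ▷ A` -/
noncomputable def alphaInv (C D : CoDGA k) (A : DGAlg k) :
    tenObj C (tenObj D A) ⟶ tenObj (tensorObj C D) A :=
  (convEquiv _ _ _).symm (alphaInvAdj C D A)

/-- Two twists occur: one from currying and one from undoing the convolution adjunction. Both are
`kap i` with the same `i`, because `u(d ⊗ a)` has the degree of `d ⊗ a`, so they cancel and no sign
remains. -/
theorem alphaInv_u (C D : CoDGA k) (A : DGAlg k) (c : C) (d : D) (a : A) :
    DGAlg.Hom.toLin (alphaInv C D A) (tenU C (tenObj D A) (c ⊗ₜ[k] tenU D A (d ⊗ₜ[k] a))) =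
      tenU (tensorObj C D) A ((c ⊗ₜ[k] d) ⊗ₜ[k] a) := by
  have h1 : DGAlg.Hom.toLin (alphaInv C D A) (tenU C (tenObj D A) (c ⊗ₜ[k] tenU D A (d ⊗ₜ[k] a))) =
      convU (alphaInvAdj C D A) (c ⊗ₜ[k] tenU D A (d ⊗ₜ[k] a)) :=
    tenLift_u (convU_isMeas (alphaInvAdj C D A)) _
  have h2 : convU (alphaInvAdj C D A) ∘ₗ TensorProduct.mk k C (tenObj D A) c ∘ₗ tenU D A =
      tenU (tensorObj C D) A ∘ₗ (TensorProduct.assoc k C D A).symm.toLinearMap ∘ₗ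
        TensorProduct.mk k C (D ⊗[k] A) c := ext_gr fun i t ht => by
    have h0 := (tenU_isMeas D A).deg i t ht
    rw [add_zero] at h0
    have h3 : convCoe (alphaInvAdj C D A) (tenU D A t) =
        adjLin (tenU (tensorObj C D) A ∘ₗ (TensorProduct.assoc k C D A).symm.toLinearMap) t :=
      congrArg (iHomSub k C (tenObj (tensorObj C D) A)).subtype
        (tenLift_u (B := convObj C (tenObj (tensorObj C D) A)) ((tenU_isMeas (tensorObj C D) A).curry
          (C := C) (D := D) (assoc_symm_comp_homDeg C D A)) t)
    have h4 : convU (alphaInvAdj C D A) (c ⊗ₜ tenU D A t) =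
        convCoe (alphaInvAdj C D A) (tenU D A t) (kap (k := k) i c) := by
      rw [convU, LinearMap.comp_apply, bsgn_of_mem _ h0]; rfl
    rw [h3, adjLin_of_mem _ ht, kap_kap_self] at h4
    exact h4
  exact h1.trans (LinearMap.congr_fun h2 (d ⊗ₜ a))

/-- The associativity isomorphism `(C ⊗ D) ▷ A ≅ C ▷ (D ▷ A)`. -/
noncomputable def alpha (C D : CoDGA k) (A : DGAlg k) :
    tenObj (tensorObj C D) A ≅ tenObj C (tenObj D A) where
  hom := alphaHom C D A
  inv := alphaInv C D A
  hom_inv_id := tenTensor_hom_ext fun c d a => by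
    rw [DGAlg.toLin_comp, LinearMap.comp_apply, alphaHom_u, alphaInv_u]; rfl
  inv_hom_id := ten_hom_ext₂ fun c d a => by
    rw [DGAlg.toLin_comp, LinearMap.comp_apply, alphaInv_u, alphaHom_u]; rfl

theorem bimap_tensoring_u {C C' : CoDGA k} {A A' : DGAlg k} (f : C ⟶ C') (g : A ⟶ A') (c : C)
    (a : A) : DGAlg.Hom.toLin (bimap (tensoring k) f g) (tenU C A (c ⊗ₜ a)) =
      tenU C' A' (CoDGA.Hom.toLin f c ⊗ₜ DGAlg.Hom.toLin g a) := by
  show DGAlg.Hom.toLin (tenMap f (𝟙 A) ≫ tenMap (𝟙 C') g) _ = _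
  rw [DGAlg.toLin_comp, LinearMap.comp_apply, tenMap_u, tenMap_u]; rfl

variable (k) in
/-- The module structure on dg algebras over the semi-monoidal category of coalgebras. -/
noncomputable def tensoringModule : SemiModule (coalgTensor k) (tensoring k) where
  α := alpha
  -- On generators no product and no sign is involved, since every map in the square acts letter by
  -- letter.
  α_naturality {X X' Y Y' A A'} f g h := tenTensor_hom_ext fun c d a => by
    have e1 : DGAlg.Hom.toLin (bimap (tensoring k) (bimap (coalgTensor k).tensor f g) h)
        (tenU (tensorObj X Y) A ((c ⊗ₜ[k] d) ⊗ₜ[k] a)) =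
        tenU (tensorObj X' Y') A' ((CoDGA.Hom.toLin f c ⊗ₜ[k] CoDGA.Hom.toLin g d) ⊗ₜ[k]
          DGAlg.Hom.toLin h a) := bimap_tensoring_u _ _ _ _
    have e2 : DGAlg.Hom.toLin (bimap (tensoring k) f (bimap (tensoring k) g h))
        (tenU X (tenObj Y A) (c ⊗ₜ[k] tenU Y A (d ⊗ₜ[k] a))) =
        tenU X' (tenObj Y' A') (CoDGA.Hom.toLin f c ⊗ₜ[k] tenU Y' A' (CoDGA.Hom.toLin g d ⊗ₜ[k]
          DGAlg.Hom.toLin h a)) := by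
      rw [← bimap_tensoring_u g h]
      exact bimap_tensoring_u _ _ _ _
    refine (congrArg (DGAlg.Hom.toLin (alphaHom X' Y' A')) e1).trans
      ((alphaHom_u _ _ _ _ _ _).trans (e2.symm.trans ?_))
    exact congrArg (DGAlg.Hom.toLin (bimap (tensoring k) f (bimap (tensoring k) g h)))
      (alphaHom_u _ _ _ _ _ _).symm
  -- Both composites send the generator of `((x ⊗ y) ⊗ z) ⊗ a` to `u(x ⊗ u(y ⊗ u(z ⊗ a)))`.
  coherence X Y Z A := tenTensor_hom_ext₂ fun x y z a => by
    have e1 : DGAlg.Hom.toLin (bimap (tensoring k) ((coalgTensor k).a X Y Z).hom (𝟙 A))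
        (tenU (tensorObj (tensorObj X Y) Z) A (((x ⊗ₜ[k] y) ⊗ₜ[k] z) ⊗ₜ[k] a)) =
        tenU (tensorObj X (tensorObj Y Z)) A ((x ⊗ₜ[k] (y ⊗ₜ[k] z)) ⊗ₜ[k] a) :=
      bimap_tensoring_u _ _ _ _
    have e2 : DGAlg.Hom.toLin (bimap (tensoring k) (𝟙 X) (alphaHom Y Z A))
        (tenU X (tenObj (tensorObj Y Z) A)
          (x ⊗ₜ[k] tenU (tensorObj Y Z) A ((y ⊗ₜ[k] z) ⊗ₜ[k] a))) =
        tenU X (tenObj Y (tenObj Z A)) (x ⊗ₜ[k] tenU Y (tenObj Z A)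
          (y ⊗ₜ[k] tenU Z A (z ⊗ₜ[k] a))) := by
      rw [← alphaHom_u Y Z A]
      exact bimap_tensoring_u _ _ _ _
    refine (congrArg (DGAlg.Hom.toLin (alphaHom X (tensorObj Y Z) A ≫
      bimap (tensoring k) (𝟙 X) (alphaHom Y Z A))) e1).trans
        ((congrArg (DGAlg.Hom.toLin (bimap (tensoring k) (𝟙 X) (alphaHom Y Z A)))
          (alphaHom_u _ _ _ _ _ _)).trans (e2.trans ?_))
    refine Eq.symm ((congrArg (DGAlg.Hom.toLin (alphaHom X Y (tenObj Z A)))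
      (alphaHom_u (tensorObj X Y) Z A (x ⊗ₜ[k] y) z a)).trans ?_)
    exact alphaHom_u X Y (tenObj Z A) x y _

end Assoc

/-! ### The universal property of conilpotent cofree coalgebras -/

section CofreeLift

variable {k : Type u} [Field k]

/-! ### Last letters of words and the one-letter component -/

section Words
variable {V : Type u} [AddCommGroup V] [Module k V]

theorem toLetter_tmul (v : V) (w : TA k V) :
    toLetter k V (v ⊗ₜ w) = TensorAlgebra.algebraMapInv (R := k) (M := V) w • v := by
  simp [toLetter]

theorem toLetter_letter (v : V) : toLetter k V (letter k V v) = v := by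
  rw [letter_apply, toLetter_tmul, map_one, one_smul]

theorem counit_ι_mul (v : V) (w : TA k V) :
    TensorAlgebra.algebraMapInv (R := k) (M := V) (TensorAlgebra.ι k v * w) = 0 := by
  simp [TensorAlgebra.algebraMapInv]

theorem toLetter_ι_mul (v u : V) (w : TA k V) :
    toLetter k V (v ⊗ₜ (TensorAlgebra.ι k u * w)) = 0 := by
  rw [toLetter_tmul, counit_ι_mul, zero_smul]

theorem counit_inc (x : Wd k V) : TensorAlgebra.algebraMapInv (R := k) (M := V) (inc k V x) = 0 := by
  induction x using TensorProduct.induction_on with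
  | zero => simp
  | add x y hx hy => rw [map_add, map_add, hx, hy, add_zero]
  | tmul v w => rw [inc_tmul, counit_ι_mul]

theorem toLetter_conc (x y : Wd k V) : toLetter k V (conc k V x y) = 0 := by
  induction x using TensorProduct.induction_on with
  | zero => simp
  | add a b ha hb => rw [map_add, LinearMap.add_apply, map_add, ha, hb, add_zero]
  | tmul v w => rw [conc_apply, rmul_tmul, toLetter_tmul, map_mul, counit_inc, mul_zero, zero_smul]

theorem cut_letter (v : V) : cut k V (letter k V v) = 0 := by
  rw [letter_apply, cut_tmul, split_one]; simp

/-- A decomposition of `w v` with nonempty right part cuts either just before `v` or at an old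
place, in which case `v` is appended to the right part. -/
theorem split_mul_ι (w : TA k V) (v : V) : split k V (w * TensorAlgebra.ι k v) =
    w ⊗ₜ letter k V v + TensorProduct.map LinearMap.id ((conc k V).flip (letter k V v))
      (split k V w) := by
  have : split k V ∘ₗ LinearMap.mulRight k (TensorAlgebra.ι k v) =
      (TensorProduct.mk k (TA k V) (Wd k V)).flip (letter k V v) +
        TensorProduct.map LinearMap.id ((conc k V).flip (letter k V v)) ∘ₗ split k V := by
    refine ext_word ?_ fun u w hw => ?_
    · have := split_ι_mul (k := k) v 1
      rw [mul_one] at this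
      simp [this, split_one, letter_apply]
    · simp only [LinearMap.comp_apply, LinearMap.add_apply, LinearMap.mulRight_apply,
        LinearMap.flip_apply, TensorProduct.mk_apply] at hw ⊢
      rw [mul_assoc, split_ι_mul, hw, split_ι_mul, map_add, map_add]
      simp only [TensorProduct.map_tmul, LinearMap.id_apply, LinearMap.mulLeft_apply,
        LinearMap.flip_apply, conc_apply, rmul_tmul, letter_apply, inc_tmul, mul_one]
      rw [TensorProduct.map_map, TensorProduct.map_map, LinearMap.id_comp, LinearMap.comp_id,
        LinearMap.id_comp, LinearMap.comp_id]
      abel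
  exact LinearMap.congr_fun this w

/-- This rule for appending a last letter matches the recursion that defines `liftCmp`. It is what
makes the lift a morphism of coalgebras. -/
theorem cut_conc_letter (x : Wd k V) (v : V) : cut k V (conc k V x (letter k V v)) =
    x ⊗ₜ letter k V v + TensorProduct.map LinearMap.id ((conc k V).flip (letter k V v))
      (cut k V x) := by
  induction x using TensorProduct.induction_on with
  | zero => simp
  | add x y hx hy =>
    simp only [map_add, LinearMap.add_apply, hx, hy, TensorProduct.add_tmul]; abel
  | tmul u w =>
    have e : conc k V (u ⊗ₜ w) (letter k V v) = u ⊗ₜ (w * TensorAlgebra.ι k v) := by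
      rw [conc_apply, rmul_tmul, letter_apply, inc_tmul, mul_one]
    rw [e, cut_tmul, split_mul_ι, cut_tmul, TensorProduct.tmul_add, map_add,
      TensorProduct.assoc_symm_tmul]
    congr 1
    induction split k V w using TensorProduct.induction_on with
    | zero => simp
    | add x y hx hy => simp only [map_add, hx, hy, TensorProduct.tmul_add]
    | tmul a b => simp

/-- Projecting the right part of a decomposition to its one-letter component keeps only the cut
before the last letter, and multiplying back restores the word. Only the empty word has no such cut,
which accounts for the first summand. -/
theorem split_last (w : TA k V) :
    algebraMap k (TA k V) (TensorAlgebra.algebraMapInv (R := k) (M := V) w) +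
      TensorProduct.lift (LinearMap.mul k (TA k V)) (TensorProduct.map LinearMap.id
        (TensorAlgebra.ι k ∘ₗ toLetter k V) (split k V w)) = w := by
  have : Algebra.linearMap k (TA k V) ∘ₗ
      (TensorAlgebra.algebraMapInv (R := k) (M := V)).toLinearMap +
      TensorProduct.lift (LinearMap.mul k (TA k V)) ∘ₗ TensorProduct.map LinearMap.id
        (TensorAlgebra.ι k ∘ₗ toLetter k V) ∘ₗ split k V = LinearMap.id := by
    refine ext_word (by simp [split_one]) fun v w hw => ?_
    have e : ∀ t : TA k V ⊗[k] Wd k V, TensorProduct.lift (LinearMap.mul k (TA k V))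
        (TensorProduct.map LinearMap.id (TensorAlgebra.ι k ∘ₗ toLetter k V)
          (TensorProduct.map (LinearMap.mulLeft k (TensorAlgebra.ι k v)) LinearMap.id t)) =
        TensorAlgebra.ι k v * TensorProduct.lift (LinearMap.mul k (TA k V))
          (TensorProduct.map LinearMap.id (TensorAlgebra.ι k ∘ₗ toLetter k V) t) := by
      intro t
      induction t using TensorProduct.induction_on with
      | zero => simp
      | add x y hx hy => simp only [map_add, hx, hy, mul_add]
      | tmul a b => simp [mul_assoc]
    simp only [LinearMap.comp_apply, LinearMap.add_apply, LinearMap.id_apply,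
      AlgHom.toLinearMap_apply, Algebra.linearMap_apply] at hw ⊢
    rw [counit_ι_mul, map_zero, zero_add, split_ι_mul, map_add, map_add, e]
    simp only [TensorProduct.map_tmul, LinearMap.id_apply, LinearMap.comp_apply,
      TensorProduct.lift.tmul, LinearMap.mul_apply', one_mul, toLetter_tmul, map_smul]
    nth_rewrite 3 [← hw]
    rw [mul_add, Algebra.smul_def, Algebra.commutes]
  exact LinearMap.congr_fun this w

/-- A nonempty word is a letter or the concatenation of a word with its last letter. -/
theorem cut_last (x : Wd k V) : letter k V (toLetter k V x) +
    TensorProduct.lift (conc k V) (TensorProduct.map LinearMap.id (letter k V ∘ₗ toLetter k V)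
      (cut k V x)) = x := by
  induction x using TensorProduct.induction_on with
  | zero => simp
  | add x y hx hy =>
    simp only [map_add]
    nth_rewrite 3 [← hx]
    nth_rewrite 3 [← hy]
    abel
  | tmul v w =>
    have e : ∀ t : TA k V ⊗[k] Wd k V, TensorProduct.lift (conc k V) (TensorProduct.map
        LinearMap.id (letter k V ∘ₗ toLetter k V)
        ((TensorProduct.assoc k V (TA k V) (Wd k V)).symm (v ⊗ₜ t))) =
        v ⊗ₜ TensorProduct.lift (LinearMap.mul k (TA k V)) (TensorProduct.map LinearMap.id
          (TensorAlgebra.ι k ∘ₗ toLetter k V) t) := by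
      intro t
      induction t using TensorProduct.induction_on with
      | zero => simp
      | add x y hx hy => simp only [map_add, hx, hy, TensorProduct.tmul_add]
      | tmul a b => simp [conc_apply, rmul_tmul, letter_apply, inc_tmul]
    rw [cut_tmul, e, toLetter_tmul]
    nth_rewrite 3 [← split_last w]
    rw [TensorProduct.tmul_add, map_smul, letter_apply, Algebra.algebraMap_eq_smul_one,
      TensorProduct.tmul_smul]

/-- A coderivation term yields a single letter in two ways only: `d₁` applied to a one-letter word,
or `b` applied to a two-letter word. For the bar construction this formula becomes the Maurer–Cartan
equation. -/
theorem toLetter_coder [GrMod k V] (d₁ : V →ₗ[k] V) (b : V →ₗ[k] V →ₗ[k] V) (x : Wd k V) :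
    toLetter k V (coder d₁ b x) = d₁ (toLetter k V x) +
      TensorProduct.lift b (TensorProduct.map (toLetter k V) (toLetter k V) (cut k V x)) := by
  induction x using TensorProduct.induction_on with
  | zero => simp
  | add x y hx hy => simp only [map_add, hx, hy]; abel
  | tmul v w =>
    -- The operator `coderT` never produces the empty word, so the terms acting behind the first
    -- letter do not reach the one-letter component.
    have h1 : ∀ w, TensorAlgebra.algebraMapInv (R := k) (M := V) (coderT d₁ b w) = 0 := by
      intro w
      have : (TensorAlgebra.algebraMapInv (R := k) (M := V)).toLinearMap ∘ₗ coderT d₁ b = 0 :=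
        ext_word (by simp [coderT_one]) fun v w _ => by
          simp [coderT_ι_mul, counit_inc, counit_ι_mul]
      exact LinearMap.congr_fun this w
    rw [coder_tmul, map_add, map_add, toLetter_tmul, toLetter_tmul, toLetter_tmul, h1, zero_smul,
      add_zero, map_smul, cut_tmul]
    congr 1
    have : toLetter k V ∘ₗ merge b v ∘ₗ hd k V = TensorProduct.lift b ∘ₗ
        TensorProduct.map (toLetter k V) (toLetter k V) ∘ₗ
          (TensorProduct.assoc k V (TA k V) (Wd k V)).symm.toLinearMap ∘ₗ
          TensorProduct.mk k V _ v ∘ₗ split k V := by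
      refine ext_word (by simp [hd_one, split_one]) fun u w _ => ?_
      have e : ∀ t : TA k V ⊗[k] Wd k V, TensorProduct.map (toLetter k V) (toLetter k V)
          ((TensorProduct.assoc k V (TA k V) (Wd k V)).symm (v ⊗ₜ
            (TensorProduct.map (LinearMap.mulLeft k (TensorAlgebra.ι k u)) LinearMap.id t))) =
          0 := by
        intro t
        induction t using TensorProduct.induction_on with
        | zero => simp
        | add x y hx hy => simp only [map_add, hx, hy, TensorProduct.tmul_add, add_zero]
        | tmul a b => simp [toLetter_ι_mul]
      simp only [LinearMap.comp_apply, hd_ι_mul, merge_tmul, toLetter_tmul, split_ι_mul,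
        TensorProduct.mk_apply, map_add, LinearEquiv.coe_coe, e, add_zero,
        TensorProduct.assoc_symm_tmul, TensorProduct.map_tmul, TensorProduct.lift.tmul, map_one,
        one_smul, map_smul]
    exact LinearMap.congr_fun this w

end Words

/-! ### Induction over conilpotent coalgebras -/

/-- Induction on the `n` with `Δ^n c = 0`. It plays the role that induction on length plays for
words, and it is how conilpotency enters the uniqueness statements. -/
theorem conil_induction {C : CoDGA k} (S : Submodule k C)
    (h : ∀ c, Del k C c ∈ LinearMap.range (TensorProduct.map S.subtype (LinearMap.id : C →ₗ[k] C)) →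
      c ∈ S) (c : C) : c ∈ S := by
  have key : ∀ n, ∀ c, iterDel k C (Del k C) n c = 0 → c ∈ S := by
    intro n
    induction n with
    | zero =>
      intro c hc
      have : c = 0 := hc
      rw [this]; exact S.zero_mem
    | succ n ih =>
      intro c hc
      apply h
      -- Since `Δ^{n+1} = (Δ^n ⊗ 1) Δ`, the element `Δ c` lies in the kernel of `Δ^n ⊗ 1`. By
      -- flatness over a field this kernel comes from `ker Δ^n ⊗ C`, and `ker Δ^n` is contained in
      -- `S` by the induction hypothesis.
      have hx : Function.Exact (LinearMap.ker (iterDel k C (Del k C) n)).subtype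
          (iterDel k C (Del k C) n) := LinearMap.exact_subtype_ker_map _
      have hx' := Module.Flat.rTensor_exact C hx
      obtain ⟨t, ht⟩ := (hx' (Del k C c)).1 hc
      let i : LinearMap.ker (iterDel k C (Del k C) n) →ₗ[k] S :=
        Submodule.inclusion fun x hx => ih x hx
      refine ⟨TensorProduct.map i LinearMap.id t, ?_⟩
      rw [TensorProduct.map_map, ← ht]
      rfl
  obtain ⟨n, hn⟩ := C.conil c
  exact key n c hn

/-- Conilpotent induction on the equality locus of `f` and `g`. In use, a formula that expresses the
value at `c` through `(f ⊗ 1) Δ c` determines `f`. -/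
theorem conil_ext {C : CoDGA k} {M : Type u} [AddCommGroup M] [Module k M] {f g : C →ₗ[k] M}
    (h : ∀ c, TensorProduct.map f (LinearMap.id : C →ₗ[k] C) (Del k C c) =
      TensorProduct.map g LinearMap.id (Del k C c) → f c = g c) : f = g := by
  refine LinearMap.ext fun c => conil_induction (LinearMap.eqLocus f g) (fun c hc => h c ?_) c
  obtain ⟨t, ht⟩ := hc
  have e : f ∘ₗ (LinearMap.eqLocus f g).subtype = g ∘ₗ (LinearMap.eqLocus f g).subtype :=
    LinearMap.ext fun x => x.2
  rw [← ht, TensorProduct.map_map, TensorProduct.map_map, e]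

/-! ### The lift to the cofree coalgebra -/

section
variable {C : CoDGA k} {V : Type u} [AddCommGroup V] [Module k V]

/-- The component of the lift of `φ` in the words with `n + 1` letters. -/
noncomputable def liftCmp (φ : C →ₗ[k] V) : ℕ → (C →ₗ[k] Wd k V)
  | 0 => letter k V ∘ₗ φ
  | n + 1 => TensorProduct.lift (conc k V) ∘ₗ
      TensorProduct.map (liftCmp φ n) (letter k V ∘ₗ φ) ∘ₗ Del k C

/-- The component in words with `n + 1` letters sees only `Δ^n c`. Together with conilpotency this
makes the sum of all components finite at each element. -/
theorem liftCmp_factor (φ : C →ₗ[k] V) (n : ℕ) :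
    ∃ M : TPow k C n →ₗ[k] Wd k V, liftCmp φ n = M ∘ₗ iterDel k C (Del k C) n := by
  induction n with
  | zero => exact ⟨letter k V ∘ₗ φ, rfl⟩
  | succ n ih =>
    obtain ⟨M, hM⟩ := ih
    refine ⟨TensorProduct.lift (conc k V) ∘ₗ TensorProduct.map M (letter k V ∘ₗ φ), ?_⟩
    have : TensorProduct.map (liftCmp φ n) (letter k V ∘ₗ φ) =
        TensorProduct.map M (letter k V ∘ₗ φ) ∘ₗ
          TensorProduct.map (iterDel k C (Del k C) n) LinearMap.id := by
      rw [← TensorProduct.map_comp, hM, LinearMap.comp_id]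
    rw [liftCmp, this]; rfl

theorem liftCmp_eventually (φ : C →ₗ[k] V) (c : C) : ∃ N, ∀ n, N ≤ n → liftCmp φ n c = 0 := by
  obtain ⟨N, hN⟩ := C.conil c
  refine ⟨N, fun n hn => ?_⟩
  obtain ⟨M, hM⟩ := liftCmp_factor φ n
  rw [hM, LinearMap.comp_apply, iterDel_le _ hn hN, map_zero]

theorem liftCmp_support (φ : C →ₗ[k] V) (c : C) :
    (Function.support fun n => liftCmp φ n c).Finite := by
  obtain ⟨N, hN⟩ := liftCmp_eventually φ c
  refine (Finset.range N).finite_toSet.subset fun n hn => ?_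
  by_contra h
  exact hn (hN n (by simpa using h))

/-- The lift of `φ : C → V` to a map of coalgebras from `C` to the words. -/
noncomputable def liftWd (φ : C →ₗ[k] V) : C →ₗ[k] Wd k V where
  toFun c := ∑ᶠ n, liftCmp φ n c
  map_add' x y := by
    simp only [map_add]
    exact finsum_add_distrib (liftCmp_support φ x) (liftCmp_support φ y)
  map_smul' r x := by
    simp only [map_smul, RingHom.id_apply]
    exact (smul_finsum r _).symm

/-- The bound is stated for every sufficiently large `m`, so that bounds for several elements can be
merged into a common one. -/
theorem liftWd_eq (φ : C →ₗ[k] V) (c : C) : ∃ N, ∀ m, N ≤ m →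
    liftWd φ c = ∑ n ∈ Finset.range m, liftCmp φ n c := by
  obtain ⟨N, hN⟩ := liftCmp_eventually φ c
  refine ⟨N, fun m hm => finsum_eq_sum_of_support_subset _ fun n hn => ?_⟩
  by_contra h
  exact hn (hN n (hm.trans (by simpa using h)))

/-- The lift solves a recursion on the last letter. The values on components and the compatibility
with comultiplication are proved from this equation, not from the sum. -/
theorem liftWd_fix (φ : C →ₗ[k] V) (c : C) : liftWd φ c = letter k V (φ c) +
    TensorProduct.lift (conc k V) (TensorProduct.map (liftWd φ) (letter k V ∘ₗ φ) (Del k C c)) := by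
  have key : ∀ t : C ⊗[k] C, ∃ N, ∀ m, N ≤ m → TensorProduct.lift (conc k V)
      (TensorProduct.map (liftWd φ) (letter k V ∘ₗ φ) t) = ∑ n ∈ Finset.range m,
        TensorProduct.lift (conc k V) (TensorProduct.map (liftCmp φ n) (letter k V ∘ₗ φ) t) := by
    intro t
    induction t using TensorProduct.induction_on with
    | zero => exact ⟨0, fun m _ => by simp⟩
    | add x y hx hy =>
      obtain ⟨N, hN⟩ := hx
      obtain ⟨N', hN'⟩ := hy
      refine ⟨max N N', fun m hm => ?_⟩
      simp only [map_add, Finset.sum_add_distrib]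
      rw [hN m (le_of_max_le_left hm), hN' m (le_of_max_le_right hm)]
    | tmul x y =>
      obtain ⟨N, hN⟩ := liftWd_eq φ x
      refine ⟨N, fun m hm => ?_⟩
      simp only [TensorProduct.map_tmul, TensorProduct.lift.tmul]
      rw [hN m hm, map_sum, LinearMap.sum_apply]
  obtain ⟨N, hN⟩ := key (Del k C c)
  obtain ⟨N', hN'⟩ := liftWd_eq φ c
  -- The left side is summed one step further than the right: its term `n = 0` is the single letter,
  -- and the terms `n + 1` are the recursion applied to the components `n`.
  rw [hN' (max N N' + 1) (by omega), hN (max N N') (by omega), Finset.sum_range_succ', add_comm]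
  rfl

theorem toLetter_liftWd (φ : C →ₗ[k] V) (c : C) : toLetter k V (liftWd φ c) = φ c := by
  rw [liftWd_fix, map_add, toLetter_letter]
  have : ∀ t : Wd k V ⊗[k] Wd k V, toLetter k V (TensorProduct.lift (conc k V) t) = 0 := by
    intro t
    induction t using TensorProduct.induction_on with
    | zero => simp
    | add x y hx hy => rw [map_add, map_add, hx, hy, add_zero]
    | tmul x y => exact toLetter_conc x y
  rw [this, add_zero]

/-- Apply `cut` to the fixed-point equation. Cutting before the last letter gives one term, while
the earlier cuts are governed by the statement for the left factor of `Δ c`, which `conil_ext`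
supplies. Coassociativity and the fixed-point equation recombine the two. -/
theorem cut_liftWd (φ : C →ₗ[k] V) (c : C) :
    cut k V (liftWd φ c) = TensorProduct.map (liftWd φ) (liftWd φ) (Del k C c) := by
  have : cut k V ∘ₗ liftWd φ = TensorProduct.map (liftWd φ) (liftWd φ) ∘ₗ Del k C := by
    refine conil_ext fun c hc => ?_
    -- The map `(x ⊗ y) ⊗ c ↦ x ⊗ y φ(c)`: it appends the last letter to the right part of an
    -- existing cut.
    let R : (Wd k V ⊗[k] Wd k V) ⊗[k] C →ₗ[k] Wd k V ⊗[k] Wd k V :=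
      TensorProduct.map LinearMap.id (TensorProduct.lift (conc k V)) ∘ₗ
        (TensorProduct.assoc k _ _ _).toLinearMap ∘ₗ
          TensorProduct.map LinearMap.id (letter k V ∘ₗ φ)
    have e1 : ∀ t : C ⊗[k] C, cut k V (TensorProduct.lift (conc k V)
        (TensorProduct.map (liftWd φ) (letter k V ∘ₗ φ) t)) =
        TensorProduct.map (liftWd φ) (letter k V ∘ₗ φ) t +
          R (TensorProduct.map (cut k V ∘ₗ liftWd φ) LinearMap.id t) := by
      intro t
      induction t using TensorProduct.induction_on with
      | zero => simp
      | add x y hx hy => simp only [map_add, hx, hy]; abel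
      | tmul x y =>
        simp only [TensorProduct.map_tmul, TensorProduct.lift.tmul, LinearMap.comp_apply,
          cut_conc_letter, LinearMap.id_apply, R]
        congr 1
        induction cut k V (liftWd φ x) using TensorProduct.induction_on with
        | zero => simp
        | add x y hx hy => simp only [map_add, hx, hy, TensorProduct.add_tmul]
        | tmul a b => simp
    have e2 : ∀ t : C ⊗[k] C, R (TensorProduct.map (TensorProduct.map (liftWd φ) (liftWd φ) ∘ₗ
        Del k C) LinearMap.id t) = TensorProduct.map (liftWd φ) (TensorProduct.lift (conc k V) ∘ₗ
          TensorProduct.map (liftWd φ) (letter k V ∘ₗ φ))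
            (TensorProduct.assoc k C C C (TensorProduct.map (Del k C) LinearMap.id t)) := by
      intro t
      induction t using TensorProduct.induction_on with
      | zero => simp
      | add x y hx hy => simp only [map_add, hx, hy]
      | tmul x y =>
        simp only [TensorProduct.map_tmul, LinearMap.comp_apply, LinearMap.id_apply, R]
        induction Del k C x using TensorProduct.induction_on with
        | zero => simp
        | add x y hx hy => simp only [map_add, hx, hy, TensorProduct.add_tmul]
        | tmul a b => simp
    have e3 : liftWd φ = letter k V ∘ₗ φ + (TensorProduct.lift (conc k V) ∘ₗ
        TensorProduct.map (liftWd φ) (letter k V ∘ₗ φ)) ∘ₗ Del k C :=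
      LinearMap.ext fun c => liftWd_fix φ c
    -- The two terms have the common left factor `liftWd φ`. Their right factors are the single
    -- letter and the recursive part, and these add up to `liftWd φ` by `e3`.
    rw [LinearMap.comp_apply, liftWd_fix, map_add, cut_letter, zero_add, e1, hc, e2, DGC.coassoc,
      TensorProduct.map_map, LinearMap.comp_id, ← LinearMap.add_apply,
      ← TensorProduct.map_add_right, ← e3]
    rfl
  exact LinearMap.congr_fun this c

/-- Maps of coalgebras to the words are determined by their components in `V`. -/
theorem cofree_ext {f g : C →ₗ[k] Wd k V}
    (hf : ∀ c, cut k V (f c) = TensorProduct.map f f (Del k C c))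
    (hg : ∀ c, cut k V (g c) = TensorProduct.map g g (Del k C c))
    (h : ∀ c, toLetter k V (f c) = toLetter k V (g c)) : f = g := by
  refine conil_ext fun c hc => ?_
  have h' : letter k V ∘ₗ toLetter k V ∘ₗ f = letter k V ∘ₗ toLetter k V ∘ₗ g :=
    LinearMap.ext fun c => congrArg (letter k V) (h c)
  have e : ∀ f : C →ₗ[k] Wd k V, TensorProduct.map LinearMap.id (letter k V ∘ₗ toLetter k V)
      (TensorProduct.map f f (Del k C c)) =
      TensorProduct.map LinearMap.id (letter k V ∘ₗ toLetter k V ∘ₗ f)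
        (TensorProduct.map f LinearMap.id (Del k C c)) := fun f => by
    rw [TensorProduct.map_map, TensorProduct.map_map]; rfl
  -- By `cut_last` the value `f c` is rebuilt from its one-letter component and from `(f ⊗ p f) Δ c`
  -- with `p` the projection to letters. The components agree by `h`, and the left factors agree by
  -- `hc`.
  rw [← cut_last (f c), ← cut_last (g c), hf, hg, e, e, h, h', hc]

/-- Coderivations along a map of coalgebras to the words are determined by their components
in `V`. -/
theorem coder_ext [GrMod k V] {F f g : C →ₗ[k] Wd k V}
    (hf : ∀ c, cut k V (f c) = TensorProduct.map f F (Del k C c) +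
      TensorProduct.map (sig ∘ₗ F) f (Del k C c))
    (hg : ∀ c, cut k V (g c) = TensorProduct.map g F (Del k C c) +
      TensorProduct.map (sig ∘ₗ F) g (Del k C c))
    (h : ∀ c, toLetter k V (f c) = toLetter k V (g c)) : f = g := by
  refine conil_ext fun c hc => ?_
  have h' : (letter k V ∘ₗ toLetter k V) ∘ₗ f = (letter k V ∘ₗ toLetter k V) ∘ₗ g :=
    LinearMap.ext fun c => congrArg (letter k V) (h c)
  have e : ∀ f : C →ₗ[k] Wd k V, TensorProduct.map LinearMap.id (letter k V ∘ₗ toLetter k V)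
      (TensorProduct.map f F (Del k C c)) =
      TensorProduct.map LinearMap.id (letter k V ∘ₗ toLetter k V ∘ₗ F)
        (TensorProduct.map f LinearMap.id (Del k C c)) := fun f => by
    rw [TensorProduct.map_map, TensorProduct.map_map]; rfl
  have e' : ∀ f : C →ₗ[k] Wd k V, TensorProduct.map LinearMap.id (letter k V ∘ₗ toLetter k V)
      (TensorProduct.map (sig ∘ₗ F) f (Del k C c)) =
      TensorProduct.map (sig ∘ₗ F) ((letter k V ∘ₗ toLetter k V) ∘ₗ f) (Del k C c) := fun f => by
    rw [TensorProduct.map_map, LinearMap.id_comp]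
  -- As in `cofree_ext`, with two terms: in the first the left factor is handled by `hc`, and in the
  -- second only the one-letter component of `f` occurs, which is known.
  rw [← cut_last (f c), ← cut_last (g c), hf, hg, map_add, map_add, map_add, map_add, e, e, e', e',
    h, h', hc]

end

/-! ### Degrees and differentials of the lift -/

section
variable {C : CoDGA k} {V : Type u} [AddCommGroup V] [Module k V] [GrMod k V]

theorem liftCmp_homDeg {φ : C →ₗ[k] V} (hφ : φ ∈ homDeg k C V 0) (n : ℕ) :
    liftCmp φ n ∈ homDeg k C (Wd k V) 0 := by
  have h : letter k V ∘ₗ φ ∈ homDeg k C (Wd k V) 0 :=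
    homDeg_comp (fun n v hv => by rw [add_zero]; exact letter_mem hv) hφ (add_zero 0)
  have hc : TensorProduct.lift (conc k V) ∈ homDeg k (Wd k V ⊗[k] Wd k V) (Wd k V) 0 :=
    tensor_homDeg fun i j x hx y hy => by
      rw [TensorProduct.lift.tmul, add_zero]; exact conc_mem hx hy rfl
  induction n with
  | zero => exact h
  | succ n ih =>
    exact homDeg_comp hc (homDeg_comp (map_homDeg ih h (add_zero 0)) comul_homDeg (add_zero 0))
      (add_zero 0)

theorem liftWd_homDeg {φ : C →ₗ[k] V} (hφ : φ ∈ homDeg k C V 0) :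
    liftWd φ ∈ homDeg k C (Wd k V) 0 := fun n c hc => by
  obtain ⟨N, hN⟩ := liftWd_eq φ c
  rw [hN N le_rfl]
  exact Submodule.sum_mem _ fun m _ => liftCmp_homDeg hφ m n c hc

/-- Both composites are coderivations along the coalgebra map `liftWd φ`, so `coder_ext` reduces the
claim to one-letter components. There `toLetter_coder` turns it into the hypothesis on `φ`. -/
theorem liftWd_coder {d₁ : V →ₗ[k] V} {b : V →ₗ[k] V →ₗ[k] V} {φ : C →ₗ[k] V}
    (hφ : φ ∈ homDeg k C V 0)
    (h : ∀ c, φ (dd k C c) = d₁ (φ c) + TensorProduct.lift b (TensorProduct.map φ φ (Del k C c)))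
    (c : C) : liftWd φ (dd k C c) = coder d₁ b (liftWd φ c) := by
  have hl : toLetter k V ∘ₗ liftWd φ = φ := LinearMap.ext (toLetter_liftWd φ)
  have hs : liftWd φ ∘ₗ sig = sig ∘ₗ liftWd φ := degOp_comp_of (liftWd_homDeg hφ) _
  have : liftWd φ ∘ₗ dd k C = coder d₁ b ∘ₗ liftWd φ := by
    refine coder_ext (F := liftWd φ) (fun c => ?_) (fun c => ?_) fun c => ?_
    · rw [LinearMap.comp_apply, cut_liftWd, DGC.coleibniz, map_add, TensorProduct.map_map,
        TensorProduct.map_map, LinearMap.comp_id, hs]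
    · rw [LinearMap.comp_apply, cut_coder, cut_liftWd, TensorProduct.map_map,
        TensorProduct.map_map, LinearMap.id_comp]
    · rw [LinearMap.comp_apply, LinearMap.comp_apply, toLetter_liftWd, toLetter_coder,
        toLetter_liftWd, cut_liftWd, TensorProduct.map_map, hl, h]
  exact LinearMap.congr_fun this c

/-- The tensor coalgebra with the differential given by `d₁` and `b`. -/
noncomputable def cofreeObj {d₁ : V →ₗ[k] V} {b : V →ₗ[k] V →ₗ[k] V} (h : BarData d₁ b) :
    CoDGA k where
  carrier := Wd k V
  coalg := cofreeDGC h
  conil := cut_conil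

/-- The universal property of the tensor coalgebra. -/
noncomputable def cofreeLift {d₁ : V →ₗ[k] V} {b : V →ₗ[k] V →ₗ[k] V} (hb : BarData d₁ b)
    {φ : C →ₗ[k] V} (hφ : φ ∈ homDeg k C V 0)
    (h : ∀ c, φ (dd k C c) = d₁ (φ c) + TensorProduct.lift b (TensorProduct.map φ φ (Del k C c))) :
    C ⟶ cofreeObj hb where
  toLin := liftWd φ
  deg n c hc := by have := liftWd_homDeg hφ n c hc; rwa [add_zero] at this
  comm_d := liftWd_coder hφ h
  map_comul := cut_liftWd φ

theorem cofree_hom_ext {d₁ : V →ₗ[k] V} {b : V →ₗ[k] V →ₗ[k] V} {hb : BarData d₁ b}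
    {f g : C ⟶ cofreeObj hb}
    (h : ∀ c, toLetter k V (CoDGA.Hom.toLin f c) = toLetter k V (CoDGA.Hom.toLin g c)) : f = g :=
  CoDGA.hom_ext (cofree_ext (CoDGA.Hom.map_comul f) (CoDGA.Hom.map_comul g) h)

end

end CofreeLift

/-! ### The adjunction between tensoring and the enrichment -/

section EnrAdj

variable {k : Type u} [Field k]

/-- On a monomial tail the projection keeps the first letter if the tail is empty, hence of degree
zero, and is zero otherwise. -/
theorem toLetter_homDeg {V : Type u} [AddCommGroup V] [Module k V] [GrMod k V] :
    toLetter k V ∈ homDeg k (Wd k V) V 0 := by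
  have h : ∀ n, ∀ w : TA k V, IsMono k n w → ∀ i, ∀ v ∈ gr k V i,
      toLetter k V (v ⊗ₜ w) ∈ gr k V (i + n) := by
    intro n w hw i v hv
    cases hw with
    | one => rw [add_zero]; simpa [toLetter_tmul] using hv
    | cons _ _ =>
      rw [toLetter_tmul]
      simp [TensorAlgebra.algebraMapInv]
  refine tensor_homDeg fun i j v hv w hw => ?_
  have : Submodule.span k {w : TA k V | IsMono k j w} ≤
      (gr k V (i + j)).comap (toLetter k V ∘ₗ TensorProduct.mk k V (TA k V) v) :=
    Submodule.span_le.2 fun w hw => h j w hw i v hv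
  rw [add_zero]
  exact this hw

/-- Used with `IsDGSub.map`: the image of any morphism of dg coalgebras is a dg subcoalgebra. -/
theorem IsDGSub.top (C : CoDGA k) : IsDGSub C ⊤ where
  graded _ _ _ := trivial
  d_mem _ _ := trivial
  comul_mem x _ := (TensorProduct.map_surjective (g := (⊤ : Submodule k C).subtype)
    (g' := (⊤ : Submodule k C).subtype) (fun y => ⟨⟨y, trivial⟩, rfl⟩)
    fun y => ⟨⟨y, trivial⟩, rfl⟩) (Del k C x)

/-- The corestriction of a morphism to a subcoalgebra. -/
noncomputable def subLift {C D : CoDGA k} {S : Submodule k D} (hS : IsDGSub D S) (f : C ⟶ D)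
    (h : ∀ c, CoDGA.Hom.toLin f c ∈ S) : C ⟶ subCoalg D S hS where
  toLin := (CoDGA.Hom.toLin f).codRestrict S h
  deg n x hx := CoDGA.Hom.deg f n x hx
  comm_d x := Subtype.ext (CoDGA.Hom.comm_d f x)
  map_comul x := map_subtype_injective D S ((map_subComul D S hS _).trans
    ((CoDGA.Hom.map_comul f x).trans (TensorProduct.map_map S.subtype S.subtype
      ((CoDGA.Hom.toLin f).codRestrict S h) ((CoDGA.Hom.toLin f).codRestrict S h) _).symm))

theorem subIncl_mono {C D : CoDGA k} {S : Submodule k D} (hS : IsDGSub D S)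
    {f g : C ⟶ subCoalg D S hS} (h : f ≫ subIncl D S hS = g ≫ subIncl D S hS) : f = g :=
  CoDGA.hom_ext (LinearMap.ext fun c => Subtype.ext
    (LinearMap.congr_fun (congrArg CoDGA.Hom.toLin h) c))

variable {C C' : CoDGA k} {A A' B B' : DGAlg k}

/-- In contrast to `adjLin`, no twist is needed for currying in this direction, because `c` already
stands to the left of `a`. -/
theorem curry_homDeg {u : C ⊗[k] A →ₗ[k] B} (hu : u ∈ homDeg k (C ⊗[k] A) B 0) {n : ℤ} {c : C}
    (hc : c ∈ gr k C n) : TensorProduct.curry u c ∈ homDeg k A B n := fun i a ha => by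
  have := hu _ _ (tmul_mem_gr hc ha (add_comm n i))
  rwa [add_zero] at this

/-- The map `C → [A, B]` that corresponds to `C ⊗ A → B`. -/
noncomputable def curryHom (u : C ⊗[k] A →ₗ[k] B) (hu : u ∈ homDeg k (C ⊗[k] A) B 0) :
    C →ₗ[k] IHom k A B :=
  (TensorProduct.curry u).codRestrict (iHomSub k A B) fun c =>
    mem_of_gr ((iHomSub k A B).comap (TensorProduct.curry u))
      (fun n _ hc => homDeg_le n (curry_homDeg hu hc)) c

theorem curryHom_homDeg {u : C ⊗[k] A →ₗ[k] B} (hu : u ∈ homDeg k (C ⊗[k] A) B 0) :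
    curryHom u hu ∈ homDeg k C (IHom k A B) 0 := fun n c hc => by
  rw [add_zero]; exact curry_homDeg hu hc

/-- The term `(-1)^{|c|} u(c ⊗ d a)` of the chain map condition is, moved to the other side, the
second term of the differential of the internal hom. -/
theorem curryHom_d {u : C ⊗[k] A →ₗ[k] B} (hu : u ∈ homDeg k (C ⊗[k] A) B 0)
    (hd : ∀ t, u (dd k (C ⊗[k] A) t) = dd k B (u t)) (c : C) :
    curryHom u hu (dd k C c) = dd k (IHom k A B) (curryHom u hu c) := by
  have : TensorProduct.curry u ∘ₗ dd k C = dHom k A B ∘ₗ TensorProduct.curry u :=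
    ext_gr fun n c hc => LinearMap.ext fun a => by
      have h := hd (c ⊗ₜ a)
      rw [d_tmul, map_add, sig_of_mem hc, ← TensorProduct.smul_tmul', map_smul] at h
      rw [LinearMap.comp_apply, LinearMap.comp_apply, dHom_of_mem (curry_homDeg hu hc)]
      exact eq_sub_of_add_eq h
  exact Subtype.ext (LinearMap.congr_fun this c)

/-- The map to the cofree coalgebra that corresponds to a chain map `C ⊗ A → B`. -/
noncomputable def enrFreeLift {u : C ⊗[k] A →ₗ[k] B} (hu : IsMeas u) :
    C ⟶ cofreeCoalg k (IHom k A B) :=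
  cofreeLift cofreeData (curryHom_homDeg hu.deg) fun c => by
    rw [curryHom_d hu.deg hu.comm_d]
    -- The cofree coalgebra has no binary part in its differential, so the quadratic term in the
    -- lifting condition is zero.
    exact (add_eq_left.2 (LinearMap.congr_fun (TensorProduct.ext' (g := TensorProduct.lift
      (0 : IHom k A B →ₗ[k] IHom k A B →ₗ[k] IHom k A B)) (h := 0) fun _ _ => rfl) _)).symm

theorem evalMap_enrFreeLift {u : C ⊗[k] A →ₗ[k] B} (hu : IsMeas u) (c : C) (a : A) :
    evalMap A B (CoDGA.Hom.toLin (enrFreeLift hu) c ⊗ₜ a) = u (c ⊗ₜ a) :=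
  congrArg (fun h : IHom k A B => (h : A →ₗ[k] B) a) (toLetter_liftWd (curryHom u hu.deg) c)

/-- The image of the lift is a dg subcoalgebra. The evaluation restricts along it to `u`, so it is a
measuring there, and the largest such subcoalgebra contains the image. -/
theorem enrFreeLift_mem {u : C ⊗[k] A →ₗ[k] B} (hu : IsMeas u) (c : C) :
    CoDGA.Hom.toLin (enrFreeLift hu) c ∈ dgCore _ (measSub A B) := by
  refine le_dgCore ((IsDGSub.top C).map (enrFreeLift hu)) ?_ ⟨c, trivial, rfl⟩
  rintro _ ⟨c, -, rfl⟩ a a'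
  rw [evalMap_enrFreeLift, hu.meas]
  exact measMul_map (g := LinearMap.id) (h := LinearMap.id) (CoDGA.Hom.homDeg (enrFreeLift hu))
    (CoDGA.Hom.map_comul _) id_homDeg (fun _ _ => rfl)
    (fun c a => (evalMap_enrFreeLift hu c a).symm) a a' c

/-- The morphism `C → DGA(A, B)` that corresponds to a measuring. -/
noncomputable def enrLift {u : C ⊗[k] A →ₗ[k] B} (hu : IsMeas u) : C ⟶ enrObj A B :=
  subLift (dgCore_isDGSub _ _) (enrFreeLift hu) (enrFreeLift_mem hu)

/-- The inclusion of the enrichment into the cofree coalgebra. -/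
noncomputable def enrIncl (A B : DGAlg k) : enrObj A B ⟶ cofreeCoalg k (IHom k A B) :=
  subIncl _ _ (dgCore_isDGSub _ _)

/-- The evaluation of the enrichment. -/
noncomputable def enrEval (A B : DGAlg k) : enrObj A B ⊗[k] A →ₗ[k] B :=
  evalMap A B ∘ₗ TensorProduct.map (CoDGA.Hom.toLin (enrIncl A B)) LinearMap.id

theorem evalMap_homDeg (A B : DGAlg k) :
    evalMap A B ∈ homDeg k (cofreeCoalg k (IHom k A B) ⊗[k] A) B 0 :=
  tensor_homDeg fun i j w hw a ha => by
    have h : toLetter k (IHom k A B) w ∈ gr k (IHom k A B) (i + 0) := toLetter_homDeg i w hw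
    rw [add_zero] at h
    rw [add_zero, add_comm]
    exact h j a ha

/-- The projection to `[A, B]` is a chain map by `toLetter_coder` with zero binary part. The
differential `d f - (-1)^{|f|} f d` then makes evaluation a chain map. -/
theorem evalMap_d (A B : DGAlg k) (t : cofreeCoalg k (IHom k A B) ⊗[k] A) :
    evalMap A B (dd k (cofreeCoalg k (IHom k A B) ⊗[k] A) t) = dd k B (evalMap A B t) := by
  have : evalMap A B ∘ₗ dd k _ = dd k B ∘ₗ evalMap A B := ext_gr₂ fun i j w hw a ha => by
    have h : toLetter k (IHom k A B) w ∈ gr k (IHom k A B) (i + 0) := toLetter_homDeg i w hw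
    rw [add_zero] at h
    have h1 : toLetter k (IHom k A B) (dd k (cofreeCoalg k (IHom k A B)) w) =
        dd k (IHom k A B) (toLetter k (IHom k A B) w) :=
      (toLetter_coder (dd k (IHom k A B)) 0 w).trans (add_eq_left.2
        (LinearMap.congr_fun (TensorProduct.ext' (g := TensorProduct.lift
      (0 : IHom k A B →ₗ[k] IHom k A B →ₗ[k] IHom k A B)) (h := 0) fun _ _ => rfl) _))
    have h2 : evalMap A B (dd k (cofreeCoalg k (IHom k A B)) w ⊗ₜ a) =
        dHom k A B (toLetter k (IHom k A B) w : IHom k A B) a :=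
      congrArg (fun h : IHom k A B => (h : A →ₗ[k] B) a) h1
    rw [LinearMap.comp_apply, d_tmul, map_add, h2, sig_of_mem hw, ← TensorProduct.smul_tmul',
      map_smul]
    exact (congrArg (fun f => f a + sgn k i • evalMap A B (w ⊗ₜ dd k A a)) (dHom_of_mem h)).trans
      (sub_add_cancel _ _)
  exact LinearMap.congr_fun this t

/-- The measuring identity holds by the choice of the subcoalgebra, and it transfers from the cofree
coalgebra because the inclusion preserves comultiplication. -/
theorem enrEval_isMeas (A B : DGAlg k) : IsMeas (enrEval A B) where
  deg := homDeg_comp (evalMap_homDeg A B)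
    (map_homDeg (CoDGA.Hom.homDeg _) id_homDeg (add_zero 0)) (add_zero 0)
  comm_d t := (congrArg (evalMap A B) (d_map (g := LinearMap.id) (CoDGA.Hom.homDeg (enrIncl A B))
    (CoDGA.Hom.comm_d (enrIncl A B)) (fun _ => rfl) t)).trans (evalMap_d A B _)
  meas c a a' := (dgCore_le _ _ c.2 a a').trans
    (measMul_map (g := LinearMap.id) (h := LinearMap.id) (CoDGA.Hom.homDeg (enrIncl A B))
      (CoDGA.Hom.map_comul _) id_homDeg (fun _ _ => rfl) (fun _ _ => rfl) a a' c).symm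

theorem IsMeas.precomp {u : C ⊗[k] A →ₗ[k] B} (hu : IsMeas u) (f : C' ⟶ C) :
    IsMeas (u ∘ₗ TensorProduct.map (CoDGA.Hom.toLin f) LinearMap.id) where
  deg := homDeg_comp hu.deg (map_homDeg (CoDGA.Hom.homDeg _) id_homDeg (add_zero 0)) (add_zero 0)
  comm_d t := (congrArg u (d_map (g := LinearMap.id) (CoDGA.Hom.homDeg f) (CoDGA.Hom.comm_d f)
    (fun _ => rfl) t)).trans (hu.comm_d _)
  meas c a a' := (hu.meas _ a a').trans
    (measMul_map (g := LinearMap.id) (h := LinearMap.id) (CoDGA.Hom.homDeg f)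
      (CoDGA.Hom.map_comul _) id_homDeg (fun _ _ => rfl) (fun _ _ => rfl) a a' c).symm

theorem enrEval_enrLift {u : C ⊗[k] A →ₗ[k] B} (hu : IsMeas u) (c : C) (a : A) :
    enrEval A B (CoDGA.Hom.toLin (enrLift hu) c ⊗ₜ a) = u (c ⊗ₜ a) := evalMap_enrFreeLift hu c a

/-- A morphism into the enrichment is determined by its composite to the cofree coalgebra, which is
determined by its component in `[A, B]`. The evaluation records exactly this component. -/
theorem enr_hom_ext {f g : C ⟶ enrObj A B}
    (h : ∀ c a, enrEval A B (CoDGA.Hom.toLin f c ⊗ₜ a) = enrEval A B (CoDGA.Hom.toLin g c ⊗ₜ a)) :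
    f = g :=
  subIncl_mono _ (cofree_hom_ext (hb := cofreeData) fun c => Subtype.ext (LinearMap.ext (h c)))

/-- `DGA₀(C ▷ A, B) ≅ cDGA(C, DGA(A, B))` -/
noncomputable def enrEquiv (C : CoDGA k) (A B : DGAlg k) :
    (tenObj C A ⟶ B) ≃ (C ⟶ enrObj A B) where
  toFun g := enrLift ((tenU_isMeas C A).comp g)
  invFun f := tenLift ((enrEval_isMeas A B).precomp f)
  left_inv g := ten_hom_ext fun c a => (tenLift_u _ _).trans
    (enrEval_enrLift ((tenU_isMeas C A).comp g) c a)
  right_inv f := enr_hom_ext fun c a => (enrEval_enrLift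
    ((tenU_isMeas C A).comp (tenLift ((enrEval_isMeas A B).precomp f))) c a).trans
      (tenLift_u ((enrEval_isMeas A B).precomp f) _)

theorem enrEval_enrEquiv (g : tenObj C A ⟶ B) (c : C) (a : A) :
    enrEval A B (CoDGA.Hom.toLin (enrEquiv C A B g) c ⊗ₜ a) =
      DGAlg.Hom.toLin g (tenU C A (c ⊗ₜ a)) :=
  enrEval_enrLift ((tenU_isMeas C A).comp g) c a

theorem enrEval_enrMap (f : A' ⟶ A) (g : B ⟶ B') (w : enrObj A B) (a : A') :
    enrEval A' B' (CoDGA.Hom.toLin (enrMap f g) w ⊗ₜ a) =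
      DGAlg.Hom.toLin g (enrEval A B (w ⊗ₜ DGAlg.Hom.toLin f a)) := (evalMap_enr f g w.1 a).symm

theorem enrEquiv_comp (g : tenObj C A ⟶ B) (h : B ⟶ B') :
    enrEquiv C A B' (g ≫ h) = enrEquiv C A B g ≫ enrMap (𝟙 A) h := enr_hom_ext fun c a => by
  rw [enrEval_enrEquiv, CoDGA.toLin_comp, LinearMap.comp_apply, enrEval_enrMap]
  exact congrArg (DGAlg.Hom.toLin h) (enrEval_enrEquiv g c a).symm

theorem enrEquiv_tenMap (f : A ⟶ A') (h : tenObj C A' ⟶ B) :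
    enrEquiv C A B (tenMap (𝟙 C) f ≫ h) = enrEquiv C A' B h ≫ enrMap f (𝟙 B) :=
  enr_hom_ext fun c a => by
    rw [enrEval_enrEquiv, CoDGA.toLin_comp, LinearMap.comp_apply, enrEval_enrMap, DGAlg.toLin_comp,
      LinearMap.comp_apply, tenMap_u, enrEval_enrEquiv]
    rfl

theorem enrEquiv_symm_comp (f : C' ⟶ C) (g : C ⟶ enrObj A B) :
    (enrEquiv C' A B).symm (f ≫ g) = tenMap f (𝟙 A) ≫ (enrEquiv C A B).symm g :=
  ten_hom_ext fun c a => by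
    rw [DGAlg.toLin_comp, LinearMap.comp_apply, tenMap_u]
    exact (tenLift_u ((enrEval_isMeas A B).precomp (f ≫ g)) _).trans
      (tenLift_u ((enrEval_isMeas A B).precomp g) (CoDGA.Hom.toLin f c ⊗ₜ a)).symm

/-- Tensoring with `A` is left adjoint to the enrichment `DGA(A, -)`. -/
noncomputable def enrAdj (A : DGAlg k) :
    (tensoring k).flip.obj A ⊣ (enrichment k).obj (Opposite.op A) :=
  Adjunction.mkOfHomEquiv
    { homEquiv := fun C B => enrEquiv C A B
      homEquiv_naturality_left_symm := enrEquiv_symm_comp (A := A)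
      homEquiv_naturality_right := enrEquiv_comp }

variable (k) in
/-- The tensoring is left adjoint to the enrichment, naturally in the algebra. -/
noncomputable def enrAdj₂ : (tensoring k).flip ⊣₂ enrichment k :=
  ParametrizedAdjunction.mk' enrAdj fun {X Y} f {C B} g => by
    rw [enrAdj, enrAdj, Adjunction.mkOfHomEquiv_homEquiv, Adjunction.mkOfHomEquiv_homEquiv]
    exact enrEquiv_tenMap f g

end EnrAdj

/-! ### Twisting maps and the bar-cobar adjunction -/

section BarCobar

variable {k : Type u} [Field k] {C D : CoDGA k} {A B : DGAlg k}

/-- Twisting maps: maps `τ : C → A` of degree `-1` that satisfy the Maurer–Cartan equation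
`d τ + τ d + τ * τ = 0`. -/
structure IsTwisting (τ : C →ₗ[k] A) : Prop where
  deg : τ ∈ homDeg k C A (-1)
  eq : ∀ c, dd k A (τ c) =
    -τ (dd k C c) - TensorProduct.lift (mu k A) (TensorProduct.map (τ ∘ₗ sig) τ (Del k C c))

theorem wlift_sus (τ : C →ₗ[k] A) (c : C) : wlift (τ ∘ₗ ofShift k 1) (sus k C c) = τ c :=
  wlift_letter _ _

/-- The sign `(-1)^{|x|}` built into the cobar differential is the `sig` of the Maurer–Cartan
equation. -/
theorem wlift_susMul (τ : C →ₗ[k] A) (t : C ⊗[k] C) : wlift (τ ∘ₗ ofShift k 1) (susMul k C t) =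
    TensorProduct.lift (mu k A) (TensorProduct.map (τ ∘ₗ sig) τ t) := by
  induction t using TensorProduct.induction_on with
  | zero => simp
  | add x y hx hy => simp only [map_add, hx, hy]
  | tmul x y => rw [susMul_tmul, wlift_conc, wlift_sus, wlift_sus]; rfl

/-- The morphism `Ω C → A` that corresponds to a twisting map. -/
noncomputable def cobarLift {τ : C →ₗ[k] A} (h : IsTwisting τ) : cobarObj C ⟶ A :=
  have hd : τ ∘ₗ ofShift k 1 ∈ homDeg k (Shift 1 C) A 0 := fun n c hc => by
    have := h.deg (n + 1) (ofShift k 1 c) hc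
    rwa [show n + 1 + -1 = n + 0 by omega] at this
  { toLin := wlift (τ ∘ₗ ofShift k 1)
    deg := fun n x hx => by have := wlift_homDeg hd n x hx; rwa [add_zero] at this
    comm_d := wlift_der hd (cobarD k C) fun c => by
      rw [← toShift_ofShift (k := k) 1 c, cobarD_apply, map_sub, map_neg, wlift_sus, wlift_susMul]
      exact (h.eq (ofShift k 1 c)).symm
    map_mul := wlift_conc _ }

theorem cobarLift_gen {τ : C →ₗ[k] A} (h : IsTwisting τ) (c : C) :
    DGAlg.Hom.toLin (cobarLift h) (cobarGen C c) = τ c := wlift_sus τ c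

theorem cobar_hom_ext {f g : cobarObj C ⟶ A}
    (h : ∀ c, DGAlg.Hom.toLin f (cobarGen C c) = DGAlg.Hom.toLin g (cobarGen C c)) : f = g :=
  DGAlg.hom_ext (wd_ext_left (fun v => h (ofShift k 1 v)) fun v x hx =>
    (DGAlg.Hom.map_mul f _ x).trans ((congrArg₂ (fun a b => mu k A a b) (h (ofShift k 1 v)) hx).trans
      (DGAlg.Hom.map_mul g _ x).symm))

/-- The Maurer–Cartan equation for `c ↦ s c` is the definition of the cobar differential on
generators. This is the universal twisting map out of `C`. -/
theorem cobarGen_isTwisting (C : CoDGA k) : IsTwisting (cobarGen C) where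
  deg _ _ hc := sus_mem hc (by omega)
  eq c := (der_letter (cobarD k C) _).trans ((cobarD_apply c).trans (by
    have e : ∀ t, susMul k C t = TensorProduct.lift (conc k (Shift 1 C))
        (TensorProduct.map (sus k C ∘ₗ sig) (sus k C) t) := fun t =>
      LinearMap.congr_fun (TensorProduct.ext' (g := susMul k C)
        (h := TensorProduct.lift (conc k (Shift 1 C)) ∘ₗ
          TensorProduct.map (sus k C ∘ₗ sig) (sus k C)) fun _ _ => rfl) t
    rw [e]
    rfl))

theorem IsTwisting.comp {τ : C →ₗ[k] A} (h : IsTwisting τ) (g : A ⟶ B) :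
    IsTwisting (DGAlg.Hom.toLin g ∘ₗ τ) where
  deg := homDeg_comp (DGAlg.Hom.homDeg g) h.deg (add_zero _)
  eq c := by
    have e : ∀ t, DGAlg.Hom.toLin g (TensorProduct.lift (mu k A)
        (TensorProduct.map (τ ∘ₗ sig) τ t)) = TensorProduct.lift (mu k B)
        (TensorProduct.map ((DGAlg.Hom.toLin g ∘ₗ τ) ∘ₗ sig) (DGAlg.Hom.toLin g ∘ₗ τ) t) := fun t =>
      LinearMap.congr_fun (TensorProduct.ext' (g := DGAlg.Hom.toLin g ∘ₗ TensorProduct.lift (mu k A)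
        ∘ₗ TensorProduct.map (τ ∘ₗ sig) τ) (h := TensorProduct.lift (mu k B) ∘ₗ TensorProduct.map
          ((DGAlg.Hom.toLin g ∘ₗ τ) ∘ₗ sig) (DGAlg.Hom.toLin g ∘ₗ τ))
            fun _ _ => DGAlg.Hom.map_mul g _ _) t
    rw [LinearMap.comp_apply, ← DGAlg.Hom.comm_d, h.eq, map_sub, map_neg, e]
    rfl

theorem IsTwisting.precomp {τ : C →ₗ[k] A} (h : IsTwisting τ) (f : D ⟶ C) :
    IsTwisting (τ ∘ₗ CoDGA.Hom.toLin f) where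
  deg := homDeg_comp h.deg (CoDGA.Hom.homDeg f) (zero_add _)
  eq c := by
    have hs : sig ∘ₗ CoDGA.Hom.toLin f = CoDGA.Hom.toLin f ∘ₗ sig :=
      (degOp_comp_of (CoDGA.Hom.homDeg f) _).symm
    rw [LinearMap.comp_apply, h.eq, CoDGA.Hom.map_comul, TensorProduct.map_map,
      LinearMap.comp_assoc, hs, ← CoDGA.Hom.comm_d]
    rfl

/-- The morphism `C → B A` that corresponds to a twisting map. -/
noncomputable def barLift {τ : C →ₗ[k] A} (h : IsTwisting τ) : C ⟶ barObj A :=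
  cofreeLift (barData (k := k) (A := A)) (φ := toShift k (-1) ∘ₗ τ)
    (fun n c hc => toShift_mem (h.deg n c hc) (by omega)) fun c => by
      -- The bar construction puts the sign on `τ x`, while the Maurer–Cartan equation puts it on
      -- `x`. As `τ` is odd these differ by `-1`, which produces the minus sign of the quadratic
      -- term.
      have e : ∀ t, TensorProduct.lift (barB k A)
          (TensorProduct.map (toShift k (-1) ∘ₗ τ) (toShift k (-1) ∘ₗ τ) t) =
          -toShift k (-1) (TensorProduct.lift (mu k A) (TensorProduct.map (τ ∘ₗ sig) τ t)) := by
        intro t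
        induction t using TensorProduct.induction_on with
        | zero => simp
        | add x y hx hy => simp only [map_add, hx, hy]; abel
        | tmul x y =>
          simp only [TensorProduct.map_tmul, TensorProduct.lift.tmul, LinearMap.comp_apply,
            barB_apply, sig_odd h.deg, map_neg, LinearMap.neg_apply, neg_neg]
      rw [e, LinearMap.comp_apply, LinearMap.comp_apply, barD₁_apply, h.eq, map_sub, map_neg]
      abel

theorem barProj_barLift {τ : C →ₗ[k] A} (h : IsTwisting τ) (c : C) :
    barProj A (CoDGA.Hom.toLin (barLift h) c) = τ c :=
  congrArg (ofShift k (-1)) (toLetter_liftWd (toShift k (-1) ∘ₗ τ) c)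

theorem bar_hom_ext {f g : C ⟶ barObj A}
    (h : ∀ c, barProj A (CoDGA.Hom.toLin f c) = barProj A (CoDGA.Hom.toLin g c)) : f = g :=
  cofree_hom_ext (hb := barData (k := k) (A := A)) h

theorem barProj_homDeg (A : DGAlg k) : barProj A ∈ homDeg k (barObj A) A (-1) := fun n w hw => by
  have := toLetter_homDeg n w hw
  rw [add_zero] at this
  exact this

/-- The one-letter component of the bar differential is `-d` on letters plus the signed product on
two-letter words. Read through the odd map `barProj`, this is the Maurer–Cartan equation, and
`barProj` is the universal twisting map into `A`. -/
theorem barProj_isTwisting (A : DGAlg k) : IsTwisting (barProj A) where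
  deg := barProj_homDeg A
  eq w := by
    have h := barProj_homDeg A
    have e : ∀ t : barObj A ⊗[k] barObj A, ofShift k (-1) (TensorProduct.lift (barB k A)
        (TensorProduct.map (toLetter k (Shift (-1) A)) (toLetter k (Shift (-1) A)) t)) =
        -TensorProduct.lift (mu k A) (TensorProduct.map (barProj A ∘ₗ sig) (barProj A) t) := by
      refine fun t => LinearMap.congr_fun (TensorProduct.ext' (g := ofShift k (-1) ∘ₗ
        TensorProduct.lift (barB k A) ∘ₗ TensorProduct.map (toLetter k _) (toLetter k _))
        (h := -(TensorProduct.lift (mu k A) ∘ₗ TensorProduct.map (barProj A ∘ₗ sig) (barProj A)))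
        fun x y => ?_) t
      refine Eq.trans ?_ (congrArg (fun a => -mu k A a (barProj A y)) (sig_odd h x)).symm
      rw [map_neg, LinearMap.neg_apply, neg_neg]
      rfl
    have h1 : barProj A (dd k (barObj A) w) = -dd k A (barProj A w) +
        -TensorProduct.lift (mu k A) (TensorProduct.map (barProj A ∘ₗ sig) (barProj A)
          (Del k (barObj A) w)) := by
      rw [← e]
      exact congrArg (ofShift k (-1)) (toLetter_coder (barD₁ k A) (barB k A) w)
    rw [h1]
    abel

/-- `DGA₀(Ω C, A) ≅ cDGA(C, B A)` -/
noncomputable def cobarBarEquiv (C : CoDGA k) (A : DGAlg k) :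
    (cobarObj C ⟶ A) ≃ (C ⟶ barObj A) where
  toFun f := barLift ((cobarGen_isTwisting C).comp f)
  invFun g := cobarLift ((barProj_isTwisting A).precomp g)
  left_inv f := cobar_hom_ext fun c => (cobarLift_gen _ c).trans
    (barProj_barLift ((cobarGen_isTwisting C).comp f) c)
  right_inv g := bar_hom_ext fun c => (barProj_barLift _ c).trans
    (cobarLift_gen ((barProj_isTwisting A).precomp g) c)

theorem barProj_cobarBarEquiv (f : cobarObj C ⟶ A) (c : C) :
    barProj A (CoDGA.Hom.toLin (cobarBarEquiv C A f) c) = DGAlg.Hom.toLin f (cobarGen C c) :=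
  barProj_barLift ((cobarGen_isTwisting C).comp f) c

theorem cobar_map_gen (f : C ⟶ D) (c : C) :
    DGAlg.Hom.toLin ((cobar k).map f) (cobarGen C c) = cobarGen D (CoDGA.Hom.toLin f c) :=
  wmap_letter _ _

theorem barProj_bar_map (f : A ⟶ B) (w : barObj A) :
    barProj B (CoDGA.Hom.toLin ((bar k).map f) w) = DGAlg.Hom.toLin f (barProj A w) :=
  congrArg (ofShift k (-1)) (toLetter_wmap (shiftMap k (-1) (DGAlg.Hom.toLin f)) w)

theorem cobarBarEquiv_symm_comp (f : D ⟶ C) (g : C ⟶ barObj A) :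
    (cobarBarEquiv D A).symm (f ≫ g) = (cobar k).map f ≫ (cobarBarEquiv C A).symm g :=
  cobar_hom_ext fun c => (cobarLift_gen ((barProj_isTwisting A).precomp (f ≫ g)) c).trans
    ((cobarLift_gen ((barProj_isTwisting A).precomp g) (CoDGA.Hom.toLin f c)).symm.trans
      (congrArg (DGAlg.Hom.toLin ((cobarBarEquiv C A).symm g)) (cobar_map_gen f c).symm))

theorem cobarBarEquiv_comp (f : cobarObj C ⟶ A) (g : A ⟶ B) :
    cobarBarEquiv C B (f ≫ g) = cobarBarEquiv C A f ≫ (bar k).map g :=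
  bar_hom_ext fun c => (barProj_cobarBarEquiv (f ≫ g) c).trans
    ((congrArg (DGAlg.Hom.toLin g) (barProj_cobarBarEquiv f c).symm).trans
      (barProj_bar_map g (CoDGA.Hom.toLin (cobarBarEquiv C A f) c)).symm)

variable (k) in
/-- The bar-cobar adjunction. -/
noncomputable def cobarBarAdj : cobar k ⊣ bar k :=
  Adjunction.mkOfHomEquiv
    { homEquiv := cobarBarEquiv
      homEquiv_naturality_left_symm := cobarBarEquiv_symm_comp
      homEquiv_naturality_right := cobarBarEquiv_comp }

theorem barProj_cobarBarAdj (f : (cobar k).obj C ⟶ A) (c : C) :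
    barProj A (CoDGA.Hom.toLin ((cobarBarAdj k).homEquiv C A f) c) =
      DGAlg.Hom.toLin f (cobarGen C c) := by
  rw [cobarBarAdj, Adjunction.mkOfHomEquiv_homEquiv]
  exact barProj_cobarBarEquiv f c

end BarCobar

/-! ### The cobar construction as a tensoring -/

section CobarTensoring

variable {k : Type u} [Field k] {C D : CoDGA k} {A B : DGAlg k}

/-- The morphism from the universal Maurer–Cartan algebra that corresponds to a Maurer–Cartan
element. -/
noncomputable def mcLift (b : B) (hb : b ∈ gr k B (-1)) (h : dd k B b = -mu k B b b) : mc k ⟶ B :=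
  let f : MCGen k →ₗ[k] B := LinearMap.toSpanSingleton k B b
  have hx : f (mcX k) = b := one_smul k b
  have hd : f ∈ homDeg k (MCGen k) B 0 := fun n v hv => by
    by_cases hn : n = -1
    · subst hn
      obtain ⟨c, rfl⟩ := mc_span k v
      rw [map_smul, hx, add_zero]
      exact Submodule.smul_mem _ _ hb
    · have : v = 0 := by
        change v ∈ (if n = -1 then (⊤ : Submodule k (MCGen k)) else ⊥) at hv
        simpa [hn] using hv
      rw [this, map_zero]
      exact Submodule.zero_mem _
  { toLin := wlift f
    deg := fun n x hx => by have := wlift_homDeg hd n x hx; rwa [add_zero] at this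
    comm_d := wlift_der hd (mcD k) fun v => by
      obtain ⟨c, rfl⟩ := mc_span k v
      rw [map_smul, map_smul, map_smul, map_smul, mcD_x, map_neg, wlift_conc, wlift_letter, hx, h]
    map_mul := wlift_conc _ }

variable (k) in
/-- The generator of the universal Maurer–Cartan algebra. -/
noncomputable def mcGen : mc k := letter k (MCGen k) (mcX k)

theorem mcGen_mem : mcGen k ∈ gr k (mc k) (-1) := letter_mem (mcX_mem k)

theorem d_mcGen : dd k (mc k) (mcGen k) = -mu k (mc k) (mcGen k) (mcGen k) :=
  (der_letter (mcD k) (mcX k)).trans (mcD_x k)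

theorem mcLift_gen (b : B) (hb : b ∈ gr k B (-1)) (h : dd k B b = -mu k B b b) :
    DGAlg.Hom.toLin (mcLift b hb h) (mcGen k) = b :=
  (wlift_letter _ _).trans (one_smul k b)

/-- The algebra is free on the line spanned by `x`, so linearity settles all letters and
multiplicativity all words. -/
theorem mc_hom_ext {f g : mc k ⟶ B}
    (h : DGAlg.Hom.toLin f (mcGen k) = DGAlg.Hom.toLin g (mcGen k)) : f = g := by
  have h1 : ∀ v, DGAlg.Hom.toLin f (letter k (MCGen k) v) =
      DGAlg.Hom.toLin g (letter k (MCGen k) v) := fun v => by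
    obtain ⟨c, rfl⟩ := mc_span k v
    rw [map_smul]
    exact (map_smul (DGAlg.Hom.toLin f) c (mcGen k)).trans ((congrArg (c • ·) h).trans
      (map_smul (DGAlg.Hom.toLin g) c (mcGen k)).symm)
  exact DGAlg.hom_ext (wd_ext_left h1 fun v x hx => (DGAlg.Hom.map_mul f _ x).trans
    ((congrArg₂ (fun a b => mu k B a b) (h1 v) hx).trans (DGAlg.Hom.map_mul g _ x).symm))

/-- By the convolution adjunction such a morphism is a morphism `mc → {C, B}`, hence is determined
by the image of `x`. That image is a map `C → B` which agrees with `u(c ⊗ x)` up to sign. -/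
theorem tenMC_hom_ext {f g : tenObj C (mc k) ⟶ B}
    (h : ∀ c, DGAlg.Hom.toLin f (tenU C (mc k) (c ⊗ₜ mcGen k)) =
      DGAlg.Hom.toLin g (tenU C (mc k) (c ⊗ₜ mcGen k))) : f = g := by
  refine (convEquiv C (mc k) B).injective (mc_hom_ext (Subtype.ext (LinearMap.ext fun c => ?_)))
  exact (adjLin_of_mem (DGAlg.Hom.toLin f ∘ₗ tenU C (mc k)) mcGen_mem c).trans
    ((h _).trans (adjLin_of_mem (DGAlg.Hom.toLin g ∘ₗ tenU C (mc k))
      mcGen_mem c).symm)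

/-- The map `c ↦ (-1)^{|c|} u (c ⊗ x)`. -/
noncomputable def tenTwist (C : CoDGA k) : C →ₗ[k] tenObj C (mc k) :=
  (TensorProduct.curry (tenU C (mc k))).flip (mcGen k) ∘ₗ sig

/-- The chain map condition for `u` at `(-1)^{|c|} c ⊗ x` involves `u(c ⊗ d x) = -u(c ⊗ x²)`, which
the measuring identity expands over `Δ c`. -/
theorem tenTwist_isTwisting (C : CoDGA k) : IsTwisting (tenTwist C) where
  deg n c hc := by
    have := (tenU_isMeas C (mc k)).deg _ _ (tmul_mem_gr (sig_mem hc) (mcGen_mem (k := k)) rfl)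
    rwa [add_zero] at this
  eq c := by
    have h1 := (tenU_isMeas C (mc k)).comm_d (sig (k := k) c ⊗ₜ mcGen k)
    have h2 := (tenU_isMeas C (mc k)).meas c (mcGen k) (mcGen k)
    rw [measMul_of_mem _ mcGen_mem, kap_neg_one] at h2
    rw [d_tmul, sig_sig, d_mcGen, map_add, TensorProduct.tmul_neg, map_neg, h2, d_sig,
      TensorProduct.neg_tmul, map_neg] at h1
    -- The measuring sign for `|x| = -1` sits on the second factor, whereas the Maurer–Cartan
    -- equation has `sig` on the first. The sign in `tenTwist` moves it from one to the other.
    have h3 : tenTwist C ∘ₗ sig = (TensorProduct.curry (tenU C (mc k))).flip (mcGen k) :=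
      LinearMap.ext fun c => by rw [tenTwist, LinearMap.comp_apply, LinearMap.comp_apply, sig_sig]
    rw [h3]
    exact h1.symm.trans (sub_eq_add_neg _ _).symm

/-- A twisting map is a Maurer–Cartan element of the convolution algebra. -/
noncomputable def twistLift {τ : C →ₗ[k] B} (h : IsTwisting τ) : mc k ⟶ convObj C B :=
  mcLift (B := convObj C B) ⟨τ, homDeg_le (-1) h.deg⟩ h.deg (Subtype.ext (by
    have e1 := dHom_of_mem h.deg
    have e2 := convMul_of_mem τ h.deg
    refine e1.trans (Eq.trans ?_ (congrArg Neg.neg e2).symm)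
    refine LinearMap.ext fun c => ?_
    -- In degree `-1` the differential of the internal hom is `d τ + τ d`, and the convolution
    -- square is formed with `kap (-1) = sig`. With these values the equation `d b = -b²` is the
    -- twisting equation.
    rw [kap_neg_one, sgn_odd (by decide), neg_one_smul, sub_neg_eq_add]
    exact (congrArg (· + τ (dd k C c)) (h.eq c)).trans (by
      rw [sub_eq_add_neg, add_comm, ← add_assoc, add_neg_cancel, zero_add]
      rfl)))

/-- The morphism `C ▷ mc → Ω C` -/
noncomputable def cobarInv (C : CoDGA k) : tenObj C (mc k) ⟶ cobarObj C :=
  (convEquiv C (mc k) (cobarObj C)).symm (twistLift (cobarGen_isTwisting C))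

/-- The sign is the twist of the convolution adjunction at `|x| = -1`, and it cancels the sign in
`tenTwist`. -/
theorem cobarInv_u (C : CoDGA k) (c : C) :
    DGAlg.Hom.toLin (cobarInv C) (tenU C (mc k) (c ⊗ₜ mcGen k)) = cobarGen C (sig (k := k) c) := by
  have h1 : DGAlg.Hom.toLin (cobarInv C) (tenU C (mc k) (c ⊗ₜ mcGen k)) =
      convU (twistLift (cobarGen_isTwisting C)) (c ⊗ₜ mcGen k) :=
    tenLift_u (convU_isMeas (twistLift (cobarGen_isTwisting C))) _
  have h2 : convCoe (twistLift (cobarGen_isTwisting C)) (mcGen k) = cobarGen C :=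
    congrArg (iHomSub k C (cobarObj C)).subtype (mcLift_gen (B := convObj C (cobarObj C)) _ _ _)
  rw [h1, convU, LinearMap.comp_apply, bsgn_of_mem _ mcGen_mem, kap_neg_one]
  exact LinearMap.congr_fun h2 _

/-- `Ω C ≅ C ▷ mc` -/
noncomputable def cobarIso (C : CoDGA k) : cobarObj C ≅ tenObj C (mc k) where
  hom := cobarLift (tenTwist_isTwisting C)
  inv := cobarInv C
  hom_inv_id := cobar_hom_ext fun c => by
    rw [DGAlg.toLin_comp, LinearMap.comp_apply, cobarLift_gen]
    exact (cobarInv_u C _).trans (congrArg (cobarGen C) (sig_sig c))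
  inv_hom_id := tenMC_hom_ext fun c => by
    rw [DGAlg.toLin_comp, LinearMap.comp_apply, cobarInv_u, cobarLift_gen, tenTwist,
      LinearMap.comp_apply, sig_sig]
    rfl

variable (k) in
/-- `Ω ≅ - ▷ mc` -/
noncomputable def cobarNatIso : cobar k ≅ (tensoring k).flip.obj (mc k) :=
  NatIso.ofComponents (fun C => cobarIso C) fun {C D} f => cobar_hom_ext fun c => by
    have e1 : DGAlg.Hom.toLin ((cobar k).map f ≫ (cobarIso D).hom) (cobarGen C c) =
        tenTwist D (CoDGA.Hom.toLin f c) :=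
      (congrArg (DGAlg.Hom.toLin (cobarIso D).hom) (cobar_map_gen f c)).trans
        (cobarLift_gen (tenTwist_isTwisting D) _)
    have e2 : DGAlg.Hom.toLin ((cobarIso C).hom ≫ tenMap f (𝟙 (mc k))) (cobarGen C c) =
        DGAlg.Hom.toLin (tenMap f (𝟙 (mc k))) (tenTwist C c) :=
      congrArg (DGAlg.Hom.toLin (tenMap f (𝟙 (mc k)))) (cobarLift_gen (tenTwist_isTwisting C) c)
    refine e1.trans (Eq.trans ?_ e2.symm)
    refine Eq.trans ?_ (tenMap_u f (𝟙 (mc k)) (sig (k := k) c) (mcGen k)).symm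
    exact congrArg (fun d => tenU D (mc k) (d ⊗ₜ mcGen k))
      (degOp_comm (CoDGA.Hom.homDeg f) _ c).symm

variable (k) in
/-- `B ≅ DGA(mc, -)` -/
noncomputable def barNatIso : bar k ≅ (enrichment k).obj (Opposite.op (mc k)) :=
  -- Both functors are right adjoint to the cobar construction, the second one after replacing `- ▷
  -- mc` by it.
  (cobarBarAdj k).rightAdjointUniq ((enrAdj (mc k)).ofNatIsoLeft (cobarNatIso k).symm)

end CobarTensoring

/-! ### Tensoring with an object as a module functor -/

section ModuleFunctors

universe v₁ v₂ u₁ u₂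

variable {𝒱 : Type u₁} [Category.{v₁} 𝒱] {S : SemiMonoidal 𝒱} {𝒞 : Type u₂} [Category.{v₂} 𝒞]
  {act : 𝒱 ⥤ 𝒞 ⥤ 𝒞} (M : SemiModule S act) {A : 𝒞} {F : 𝒱 ⥤ 𝒞} (e : F ≅ act.flip.obj A)

/-- The isomorphism `X ▷ F C ≅ F (X ⊗ C)` for a functor `F ≅ - ▷ A`. -/
def actIso (X C : 𝒱) : (act.obj X).obj (F.obj C) ≅ F.obj ((S.tensor.obj X).obj C) :=
  (act.obj X).mapIso (e.app C) ≪≫ (M.α X C A).symm ≪≫ (e.app ((S.tensor.obj X).obj C)).symm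

/-- This equation characterizes `actIso`, since `e` and `α` are invertible. The module functor
axioms below are derived from it by composing with these isomorphisms. -/
theorem actIso_comp (X C : 𝒱) :
    (actIso M e X C).hom ≫ e.hom.app ((S.tensor.obj X).obj C) ≫ (M.α X C A).hom =
      (act.obj X).map (e.hom.app C) := by
  simp [actIso]

/-- After composing with `e` and `α`, both sides are brought to the same form by the naturality of
`e`, of `α` and of the action. -/
theorem actIso_naturality {X X' C C' : 𝒱} (f : X ⟶ X') (g : C ⟶ C') :
    bimap act f (F.map g) ≫ (actIso M e X' C').hom =
      (actIso M e X C).hom ≫ F.map (bimap S.tensor f g) := by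
  have hα := M.α_naturality f g (𝟙 A)
  have he := e.hom.naturality g
  have he' := e.hom.naturality (bimap S.tensor f g)
  rw [← cancel_mono (e.hom.app ((S.tensor.obj X').obj C')), ← cancel_mono (M.α X' C' A).hom]
  simp only [Category.assoc]
  rw [actIso_comp, reassoc_of% he']
  have h1 : (act.flip.obj A).map (bimap S.tensor f g) ≫ (M.α X' C' A).hom =
      (M.α X C A).hom ≫ bimap act f ((act.map g).app A) := by
    simpa [bimap] using hα
  rw [h1, reassoc_of% (actIso_comp M e X C)]
  have h2 : F.map g ≫ e.hom.app C' = e.hom.app C ≫ (act.map g).app A := he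
  have h3 : (act.obj X).map (e.hom.app C) ≫ (act.map f).app ((act.obj C).obj A) =
      (act.map f).app (F.obj C) ≫ (act.obj X').map (e.hom.app C) := (act.map f).naturality _
  rw [bimap, ← Functor.map_comp, h2, Functor.map_comp]
  exact ((reassoc_of% h3) _).symm

/-- Composing with `e` and twice with `α` turns the axiom into the coherence law of the module
structure at `(X, Y, C, A)`. What remains is naturality of `α` with respect to `e` at `C`. -/
theorem actIso_coherence (X Y C : 𝒱) :
    (actIso M e ((S.tensor.obj X).obj Y) C).hom ≫ F.map (S.a X Y C).hom =
      (M.α X Y (F.obj C)).hom ≫ bimap act (𝟙 X) (actIso M e Y C).hom ≫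
        (actIso M e X ((S.tensor.obj Y).obj C)).hom := by
  have hα := M.α_naturality (𝟙 X) (𝟙 Y) (e.hom.app C)
  have hc := M.coherence X Y C A
  have he : F.map (S.a X Y C).hom ≫ e.hom.app _ = e.hom.app _ ≫ (act.map (S.a X Y C).hom).app A :=
    e.hom.naturality (S.a X Y C).hom
  have h1 : (act.obj ((S.tensor.obj X).obj Y)).map (e.hom.app C) ≫ (M.α X Y ((act.obj C).obj A)).hom =
      (M.α X Y (F.obj C)).hom ≫ (act.obj X).map ((act.obj Y).map (e.hom.app C)) := by
    simpa [bimap] using hα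
  have h2 : (act.map (S.a X Y C).hom).app A ≫ (M.α X ((S.tensor.obj Y).obj C) A).hom ≫
      (act.obj X).map (M.α Y C A).hom =
      (M.α ((S.tensor.obj X).obj Y) C A).hom ≫ (M.α X Y ((act.obj C).obj A)).hom := by
    simpa [bimap] using hc
  rw [← cancel_mono (e.hom.app _), ← cancel_mono (M.α X ((S.tensor.obj Y).obj C) A).hom,
    ← cancel_mono ((act.obj X).map (M.α Y C A).hom)]
  simp only [Category.assoc]
  rw [reassoc_of% he, h2, reassoc_of% (actIso_comp M e ((S.tensor.obj X).obj Y) C), h1,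
    reassoc_of% (actIso_comp M e X ((S.tensor.obj Y).obj C)), ← actIso_comp M e Y C]
  simp

/-- A functor of the form `- ▷ A` is a module functor. -/
def actModuleFunctor : ModuleFunctor S.self M F where
  m := actIso M e
  m_naturality := actIso_naturality M e
  coherence := actIso_coherence M e

end ModuleFunctors

end Koszul

theorem mainTheorem7 (k : Type u) [Field k] :
    Nonempty (Koszul.tensoring k ⊣₂ Koszul.conv k) ∧
    Nonempty ((Koszul.tensoring k).flip ⊣₂ Koszul.enrichment k) ∧
    Nonempty (Koszul.bar k ≅ (Koszul.enrichment k).obj (Opposite.op (Koszul.mc k))) ∧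
    ∃ e : Koszul.cobar k ≅ (Koszul.tensoring k).flip.obj (Koszul.mc k),
    ∃ M : Koszul.SemiModule (Koszul.coalgTensor k) (Koszul.tensoring k),
      (∀ (C D : Koszul.CoDGA k) (A : Koszul.DGAlg k) (c : C) (d : D) (a : A),
        Koszul.DGAlg.Hom.toLin (M.α C D A).hom
            (Koszul.tenU (Koszul.tensorObj C D) A ((c ⊗ₜ[k] d) ⊗ₜ[k] a)) =
          Koszul.tenU C (Koszul.tenObj D A) (c ⊗ₜ[k] Koszul.tenU D A (d ⊗ₜ[k] a))) ∧
      ∃ P : Koszul.ModuleAdjunction (Koszul.coalgTensor k).self M (Koszul.cobar k) (Koszul.bar k),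
        (∀ (C : Koszul.CoDGA k) (A : Koszul.DGAlg k) (f : (Koszul.cobar k).obj C ⟶ A) (c : C),
          Koszul.barProj A (Koszul.CoDGA.Hom.toLin (P.adj.homEquiv C A f) c) =
            Koszul.DGAlg.Hom.toLin f (Koszul.cobarGen C c)) ∧
        ∀ X C : Koszul.CoDGA k,
          (P.str.m X C).hom ≫ e.hom.app (Koszul.tensorObj X C) ≫ (M.α X C (Koszul.mc k)).hom =
            ((Koszul.tensoring k).obj X).map (e.hom.app C) := by
  -- The structure isomorphism is that of `actIso` for the chosen `e` and the chosen `α`, so the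
  -- last clause is `actIso_comp` itself.
  refine ⟨⟨Koszul.convAdj₂ k⟩, ⟨Koszul.enrAdj₂ k⟩, ⟨Koszul.barNatIso k⟩, Koszul.cobarNatIso k,
    Koszul.tensoringModule k, Koszul.alphaHom_u,
    ⟨Koszul.cobarBarAdj k, Koszul.actModuleFunctor (Koszul.tensoringModule k)
      (Koszul.cobarNatIso k)⟩, fun C A f c => Koszul.barProj_cobarBarAdj f c,
    Koszul.actIso_comp (Koszul.tensoringModule k) (Koszul.cobarNatIso k)⟩
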